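/- **Setting.** A *parametric ACTMC* $\mathcal N=(S,\lambda,P,A,(S_a),(P_a),(F_a[x]),(\ell_a),(u_a))$ consists of a nonempty finite set of states $S$, a common rate $\lambda\in\mathbb Q_{>0}$, a rational probability matrix $P$ on $S$ (delay transitions), a finite set of alarms $A$, pairwise disjoint sets $S_a\subseteq S$ (states where alarm $a$ is enabled), rational probability matrices $P_a$ on $S$ with $P_a(s,s)=1$ for $s\notin S_a$ (alarm transitions), rationals $\ell_a\le u_a$, and for each $d\in[\ell_a,u_a]$ a distribution $F_a[d]$ on $(0,\infty)$ with finite mean. Let $S_{\rm off}=S\setminus\bigcup_a S_a$. Fixing a parameter function $\mathbf d$, $\mathbf d(a)\in[\ell_a,u_a]$, gives the process $\mathcal N^{\mathbf d}$: in a state $s$ a delay $t$, exponential with rate $\lambda$, is drawn; if $s\in S_a$ and the current timer $\eta$ satisfies $\eta\le t$, the alarm rings after time $\eta$ and the successor is drawn from $P_a(s,\cdot)$; otherwise after time $t$ the successor is drawn from $P(s,\cdot)$. The timer is newly drawn from $F_b[\mathbf d(b)]$ whenever a state of $S_b$ is entered by an alarm transition or from outside $S_b$ (and in the initial state), is $\infty$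 in $S_{\rm off}$, and otherwise decreases by the elapsed time. Rational nonnegative cost functions are given: rates $\mathcal R(s)$, and instant costs $\mathcal I(s,s')$ of delay transitions and $\mathcal I_A(s,s')$ of alarm transitions. The mean-payoff of a run is the $\limsup_n$ of the cost of the first $n$ steps divided by their duration. For $\varepsilon>0$, $\mathbf d$ is *$\varepsilon$-optimal* if its expected mean-payoff, from every initial state, is at most the infimum over all parameter functions plus $\varepsilon$. $\mathcal N$ is *strongly connected* if the graph of its delay and alarm transitions is. A state $s\in S_a$ is *alarm-setting* if $P_b(s',s)>0$ for some $b\in A$, $s'\in S_b$, or $P(s',s)>0$ for some $s'\notin S_a$; $S_{\rm set}$ is the set of these states. The alarms are *localized* if $S_{\rm set}\cap S_a$ is a singleton for each $a$. **Semi-MDPs.** Put $M=S_{\rm set}\cup S_{\rm off}$. A configuration is regenerative if its state lies in $S_{\rm off}$ or its timer has just been newly set. For $s\in S_{\rm set}\cap S_a$ and $d\in[\ell_a,u_a]$ let $\Pi_s(d)$ be the distribution on $M$ of the state of the first regenerative configuration after the start in $s$ (with timer drawn from $F_a[d]$), and $\Theta_s(d)$, $c_s(d)$ the expected time and cost until then.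 For $s\in S_{\rm off}$, $\Pi_s=P(s,\cdot)$, $\Theta_s=1/\lambda$, $c_s=\mathcal R(s)/\lambda+\sum_{s'}P(s,s')\mathcal I(s,s')$. For $\delta\colon S_{\rm set}\to\mathbb Q_{>0}$, $\mathcal M\langle\delta\rangle$ is the semi-MDP with states $M$ in which the actions of $s\in S_{\rm set}\cap S_a$ are the values $\ell_a+i\,\delta(s)<u_a$ ($i\in\mathbb N_0$) and $u_a$, each $s\in S_{\rm off}$ has one action, and the effects are given by $\Pi,\Theta,c$. A $\kappa$-approximation of such effects replaces each distribution by a distribution with the same support, and each time and cost by a nonnegative number, changing all values by at most $\kappa$; $[\mathcal M\langle\delta\rangle]_\kappa$ is the set of the resulting semi-MDPs. A strategy $\sigma$ chooses one action in each state; it is optimal if its expected mean-payoff ($\limsup$ of accumulated cost over accumulated time) is minimal among the strategies, and $\mathbf d^\sigma(a)$ denotes the value that $\sigma$ chooses in the $a$-setting state. **Assumptions.** "Computable" means: computable from (an index of) the instance and from the arguments mentioned. 1. From each $\varepsilon\in\mathbb Q_{>0}$ one can compute $\delta\colon S_{\rm set}\to\mathbb Q_{>0}$ and $\kappa\in\mathbb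 Q_{>0}$, with $\kappa$ smaller than all expected times in $\mathcal M\langle\delta\rangle$, such that for every $\mathcal M'\in[\mathcal M\langle\delta\rangle]_\kappa$ and every optimal strategy $\sigma$ of $\mathcal M'$, $\mathbf d^\sigma$ is $\varepsilon$-optimal. 2. For $s\in S_{\rm set}\cap S_a$ there are rational $\kappa$-approximations $\Pi^\kappa_s(d),\Theta^\kappa_s(d),c^\kappa_s(d)$ of $\Pi_s(d),\Theta_s(d),c_s(d)$, computable from $\kappa\in\mathbb Q_{>0}$ and $d\in[\ell_a,u_a]\cap\mathbb Q$. 3. For all $s\in S_{\rm set}\cap S_a$ and $e,\kappa\in\mathbb Q_{>0}$ there are $\kappa$-approximations $\boldsymbol\Pi_s,\boldsymbol\Theta_s,\boldsymbol c_s$ of $\Pi_s,\Theta_s,c_s$ on $[\ell_a,u_a]$ such that for all rational $g,\mathbf h$ the function $\boldsymbol F[g,\mathbf h]=\boldsymbol c_s-g\,\boldsymbol\Theta_s+\boldsymbol\Pi_s\cdot\mathbf h$ is differentiable on $[\ell_a,u_a]$; and from $s,e,\kappa,g,\mathbf h$ one can compute a finite list of rationals that contains, for each root of the derivative in $[\ell_a,u_a]$,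 a number at distance at most $e$ from it. 4. For each $s\in S_{\rm set}\cap S_a$ there is a computable $\Pi^{\min}_s\in\mathbb Q_{>0}$ such that for all $d\in[\ell_a,u_a]$ and $s'\in M$, $\Pi_s(d)(s')>0$ implies $\Pi_s(d)(s')\ge\Pi_s^{\min}$. **Algorithm (symbolic policy iteration).** Given $\varepsilon$, take $\delta,\kappa$ from 1, let $\xi=\min(\{\kappa/4\}\cup\{\Pi^{\min}_s/3:s\in S_{\rm set}\})$, and let $\mathcal M_\xi$ be the semi-MDP on the actions of $\mathcal M\langle\delta\rangle$ with the effects $\Pi^\xi,\Theta^\xi,c^\xi$ of 2 in $S_{\rm set}$ and the exact effects in $S_{\rm off}$. Choose any $s_0\in M$ and any strategy. Repeat, until the strategy does not change: for the current strategy $\sigma$ compute the gain $g$ (its expected mean-payoff in $\mathcal M_\xi$) and the bias $\mathbf h\colon M\to\mathbb Q$ with $\mathbf h(s_0)=0$ and $\mathbf h(s)=F_s(\sigma(s))$ for all $s\in M$, where $F_s(d)=c^\xi_s(d)-g\,\Theta^\xi_s(d)+\Pi^\xi_s(d)\cdot\mathbf h$ (with the exact effects if $s\in S_{\rm off}$);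 for each $s\in S_{\rm set}\cap S_a$ compute by 3 a list $R$ approximating the roots with $e=\delta(s)/2$ and $\kappa=\xi$, let $C$ consist of $\sigma(s)$ and all actions $d$ of $s$ with $|d-r|\le 3\delta(s)/2$ for some $r\in R\cup\{\ell_a,u_a\}$, let $B$ be the set of minimizers of $F_s$ on $C$; keep $\sigma(s)$ if $\sigma(s)\in B$, and otherwise replace it by any element of $B$. Finally return $\mathbf d^\sigma$. **Theorem.** Let a family of strongly connected parametric ACTMCs with localized alarms and rational cost functions be given whose rational data are computable from the index and which satisfies Assumptions 1–4, the functions there being computable uniformly in the index. (A family with one member is a single ACTMC.) Then the symbolic policy iteration algorithm effectively solves the $\varepsilon$-optimal parameter synthesis problem: for every instance and every $\varepsilon\in\mathbb Q_{>0}$, $\mathcal M_\xi$ is well defined and belongs to $[\mathcal M\langle\delta\rangle]_\xi$; whatever choices are made, every step of the algorithm can be carried out, it terminates, and the parameter function it returns is $\varepsilon$-optimal; and there is a computable function that maps each instance and each $\varepsilon\in\mathbb Q_{>0}$ to a (rational) parameter function returned by the algorithm. -/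

import Mathlib

open MeasureTheory ProbabilityTheory Filter
open scoped ENNReal

noncomputable section

/-! ## Finite distributions and κ-approximations -/

/-- The discrete law on a finite set with weights `p`. -/
def choiceLaw {M : Type} [Fintype M] [MeasurableSpace M] (p : M → ℝ) : Measure M :=
  ∑ m, ENNReal.ofReal (p m) • Measure.dirac m

/-- `p` is a probability distribution on the finite set `M`. -/
def IsDistr {M : Type} [Fintype M] (p : M → ℝ) : Prop :=
  (∀ m, 0 ≤ p m) ∧ ∑ m, p m = 1

theorem IsDistr.isProbabilityMeasure {M : Type} [Fintype M] [MeasurableSpace M] {p : M → ℝ}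
    (hp : IsDistr p) : IsProbabilityMeasure (choiceLaw p) := by
  constructor
  simp only [choiceLaw, Measure.coe_finsetSum, Finset.sum_apply, Measure.smul_apply,
    smul_eq_mul, measure_univ, mul_one]
  rw [← ENNReal.ofReal_sum_of_nonneg (fun m _ => hp.1 m), hp.2, ENNReal.ofReal_one]

/-- The effect of one action: `(q', t', c')` (successor distribution, expected time, expected cost)
is a `κ`-approximation of `(q, t, c)`. -/
structure IsKappaApprox {M : Type} [Fintype M] (κ : ℝ) (q : M → ℝ) (t c : ℝ)
    (q' : M → ℝ) (t' c' : ℝ) : Prop where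
  distr : IsDistr q'
  time_nonneg : 0 ≤ t'
  cost_nonneg : 0 ≤ c'
  support : ∀ m, q' m = 0 ↔ q m = 0
  prob_close : ∀ m, |q m - q' m| ≤ κ
  time_close : |t - t'| ≤ κ
  cost_close : |c - c'| ≤ κ

/-! ## Semi-Markov decision processes -/

/-- A semi-MDP with finite state set `M`; `Act m` is the set of actions enabled in `m`. -/
structure SemiMDP (M : Type) [Fintype M] (Act : M → Type) where
  /-- successor distributions -/
  Q : ∀ m, Act m → M → ℝ
  /-- expected times -/
  t : ∀ m, Act m → ℝ
  /-- expected costs -/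
  c : ∀ m, Act m → ℝ
  distr : ∀ m b, IsDistr (Q m b)
  t_nonneg : ∀ m b, 0 ≤ t m b
  c_nonneg : ∀ m b, 0 ≤ c m b

namespace SemiMDP

variable {M : Type} [Fintype M] [MeasurableSpace M] [DiscreteMeasurableSpace M] {Act : M → Type}

/-- One step of the Markov chain obtained by applying the stationary deterministic strategy `σ`:
the next state is drawn from `Q (σ m)`, where `m` is the last state of the history. -/
def stepKernel (D : SemiMDP M Act) (σ : ∀ m, Act m) (n : ℕ) :
    Kernel ((_ : Finset.Iic n) → M) M :=
  Kernel.ofFunOfCountable fun x =>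
    choiceLaw (D.Q (x ⟨n, by simp⟩) (σ (x ⟨n, by simp⟩)))

instance (D : SemiMDP M Act) (σ : ∀ m, Act m) (n : ℕ) : IsMarkovKernel (D.stepKernel σ n) :=
  ⟨fun x => (D.distr _ (σ (x ⟨n, by simp⟩))).isProbabilityMeasure⟩

/-- The probability measure on the runs `m₀ m₁ m₂ …` under `σ` with initial state `m₀`. -/
def runMeasure (D : SemiMDP M Act) (σ : ∀ m, Act m) (m₀ : M) : Measure (ℕ → M) :=
  Kernel.traj (X := fun _ => M) (D.stepKernel σ) 0 (fun _ => m₀)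

/-- The mean-payoff of a run under `σ`. -/
def meanPayoff (D : SemiMDP M Act) (σ : ∀ m, Act m) (ω : ℕ → M) : ℝ≥0∞ :=
  limsup (fun n : ℕ =>
    ENNReal.ofReal (∑ i ∈ Finset.range (n + 1), D.c (ω i) (σ (ω i))) /
      ENNReal.ofReal (∑ i ∈ Finset.range (n + 1), D.t (ω i) (σ (ω i)))) atTop

/-- The expected mean-payoff of `σ` from the initial state `m₀`. -/
def expMP (D : SemiMDP M Act) (σ : ∀ m, Act m) (m₀ : M) : ℝ≥0∞ :=
  ∫⁻ ω, D.meanPayoff σ ω ∂D.runMeasure σ m₀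

/-- `σ` achieves the minimal expected mean-payoff (from every initial state). -/
def IsOptimal (D : SemiMDP M Act) (σ : ∀ m, Act m) : Prop :=
  ∀ (m₀ : M) (τ : ∀ m, Act m), D.expMP σ m₀ ≤ D.expMP τ m₀

end SemiMDP

/-! ## Continuous-time Markov chains with alarms -/

/-- Cost structure: cost rates, and instant costs of delay and of alarm transitions. -/
structure Costs (S : Type) where
  R : S → ℚ
  I : S → S → ℚ
  IA : S → S → ℚ
  R_nonneg : ∀ s, 0 ≤ R s
  I_nonneg : ∀ s s', 0 ≤ I s s'
  IA_nonneg : ∀ s s', 0 ≤ IA s s'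

/-- A CTMC with alarms. At most one alarm is enabled in a state: `alarm s = some a` says that
`s ∈ S_a`, and `alarm s = none` that no alarm is enabled in `s`. The distribution of the ringing
time of `a` is given as the probability measure `law a` on `ℝ`. -/
structure ACTMC (S A : Type) [Fintype S] where
  rate : ℝ
  rate_pos : 0 < rate
  P : S → S → ℝ
  P_distr : ∀ s, IsDistr (P s)
  alarm : S → Option A
  Pa : A → S → S → ℝ
  Pa_distr : ∀ a s, IsDistr (Pa a s)
  Pa_self : ∀ a s, alarm s ≠ some a → Pa a s s = 1
  law : A → Measure ℝ
  law_prob : ∀ a, IsProbabilityMeasure (law a)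
  law_pos : ∀ a, law a (Set.Iic 0) = 0
  law_mean : ∀ a, Integrable (fun x : ℝ => x) (law a)

namespace ACTMC

variable {S A : Type} [Fintype S] [Fintype A] [MeasurableSpace S]

/-- The random input of one step: the exponential delay, for every state a successor by a delay
transition and one by an alarm transition, and a fresh ringing time for every alarm. -/
abbrev Noise (S A : Type) : Type := ℝ × (S → S) × (S → S) × (A → ℝ)

/-- The law of an alarm transition from `s`. -/
def alarmLaw (X : ACTMC S A) (s : S) : Measure S :=
  match X.alarm s with
  | none => Measure.dirac s
  | some a => choiceLaw (X.Pa a s)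

/-- The law of the input of one step; its components are independent. -/
def noiseLaw (X : ACTMC S A) : Measure (Noise S A) :=
  (expMeasure X.rate).prod ((Measure.pi fun s => choiceLaw (X.P s)).prod
    ((Measure.pi fun s => X.alarmLaw s).prod (Measure.pi fun a => X.law a)))

/-- The probability space on which runs are defined: an i.i.d. sequence of inputs. -/
def pathLaw (X : ACTMC S A) : Measure (ℕ → Noise S A) :=
  Measure.infinitePi fun _ => X.noiseLaw

/-- The timer value of a freshly set timer in `s`. -/
def freshTimer (X : ACTMC S A) (z : Noise S A) (s : S) : ℝ≥0∞ :=
  match X.alarm s with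
  | none => ∞
  | some a => ENNReal.ofReal (z.2.2.2 a)

/-- In configuration `x = (s, η)` the alarm rings before the delay transition. -/
def rings (x : S × ℝ≥0∞) (z : Noise S A) : Prop := x.2 ≤ ENNReal.ofReal z.1

open scoped Classical in
/-- The next state. -/
def nextState (x : S × ℝ≥0∞) (z : Noise S A) : S :=
  if rings x z then z.2.2.1 x.1 else z.2.1 x.1

/-- The configuration that follows `x` is regenerative: no alarm is enabled or the timer is newly
set. -/
def renews (X : ACTMC S A) (x : S × ℝ≥0∞) (z : Noise S A) : Prop :=
  rings x z ∨ X.alarm (nextState x z) = none ∨ X.alarm (nextState x z) ≠ X.alarm x.1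

open scoped Classical in
/-- The next configuration. -/
def nextConf (X : ACTMC S A) (x : S × ℝ≥0∞) (z : Noise S A) : S × ℝ≥0∞ :=
  (nextState x z,
    if X.renews x z then X.freshTimer z (nextState x z) else x.2 - ENNReal.ofReal z.1)

/-- The configurations `(s_n, η_n)` of the run that starts in `s₀` (with a newly set timer if an
alarm is enabled there). -/
def conf (X : ACTMC S A) (s₀ : S) (ω : ℕ → Noise S A) : ℕ → S × ℝ≥0∞
  | 0 => (s₀, X.freshTimer (ω 0) s₀)
  | n + 1 => X.nextConf (X.conf s₀ ω n) (ω (n + 1))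

open scoped Classical in
/-- The time `t_n` spent in the `n`-th configuration. -/
def dwell (X : ACTMC S A) (s₀ : S) (ω : ℕ → Noise S A) (n : ℕ) : ℝ :=
  if rings (X.conf s₀ ω n) (ω (n + 1)) then (X.conf s₀ ω n).2.toReal else (ω (n + 1)).1

open scoped Classical in
/-- The cost `R(s_n) t_n + J(s_n, s_{n+1})` paid in the `n`-th step. -/
def stepCost (X : ACTMC S A) (C : Costs S) (s₀ : S) (ω : ℕ → Noise S A) (n : ℕ) : ℝ :=
  C.R (X.conf s₀ ω n).1 * X.dwell s₀ ω n +
    (if rings (X.conf s₀ ω n) (ω (n + 1))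
      then (C.IA (X.conf s₀ ω n).1 (X.conf s₀ ω (n + 1)).1 : ℝ)
      else (C.I (X.conf s₀ ω n).1 (X.conf s₀ ω (n + 1)).1 : ℝ))

/-- The mean-payoff of a run. -/
def meanPayoff (X : ACTMC S A) (C : Costs S) (s₀ : S) (ω : ℕ → Noise S A) : ℝ≥0∞ :=
  limsup (fun n : ℕ =>
    ENNReal.ofReal (∑ i ∈ Finset.range (n + 1), X.stepCost C s₀ ω i) /
      ENNReal.ofReal (∑ i ∈ Finset.range (n + 1), X.dwell s₀ ω i)) atTop

/-- The expected mean-payoff from the initial state `s₀`. -/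
def expMP (X : ACTMC S A) (C : Costs S) (s₀ : S) : ℝ≥0∞ :=
  ∫⁻ ω, X.meanPayoff C s₀ ω ∂X.pathLaw

/-- The configurations with index `1, …, j` are not regenerative. -/
def NotRenewedUpTo (X : ACTMC S A) (s₀ : S) (ω : ℕ → Noise S A) (j : ℕ) : Prop :=
  ∀ i < j, ¬ X.renews (X.conf s₀ ω i) (ω (i + 1))

/-- The probability that the first regenerative configuration after the start is in state `s'`. -/
def cycleProb (X : ACTMC S A) (s₀ s' : S) : ℝ :=
  (X.pathLaw {ω | ∃ j, X.NotRenewedUpTo s₀ ω j ∧ X.renews (X.conf s₀ ω j) (ω (j + 1)) ∧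
    (X.conf s₀ ω (j + 1)).1 = s'}).toReal

open scoped Classical in
/-- The expected time until the next regenerative configuration. -/
def cycleTime (X : ACTMC S A) (s₀ : S) : ℝ :=
  (∫⁻ ω, ∑' j, (if X.NotRenewedUpTo s₀ ω j then ENNReal.ofReal (X.dwell s₀ ω j) else 0)
    ∂X.pathLaw).toReal

open scoped Classical in
/-- The expected cost accumulated until the next regenerative configuration. -/
def cycleCost (X : ACTMC S A) (C : Costs S) (s₀ : S) : ℝ :=
  (∫⁻ ω, ∑' j, (if X.NotRenewedUpTo s₀ ω j then ENNReal.ofReal (X.stepCost C s₀ ω j) else 0)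
    ∂X.pathLaw).toReal

end ACTMC

/-! ## Parametric ACTMCs -/

/-- A parametric ACTMC with rational transition probabilities, rate and interval bounds. For
`d ∈ [lo a, hi a]`, the measure `law a d` is the distribution `F_a[d]` of the ringing time. -/
structure ParametricACTMC (S A : Type) [Fintype S] where
  rate : ℚ
  rate_pos : 0 < rate
  P : S → S → ℚ
  P_distr : ∀ s, IsDistr fun s' => (P s s' : ℝ)
  alarm : S → Option A
  Pa : A → S → S → ℚ
  Pa_distr : ∀ a s, IsDistr fun s' => (Pa a s s' : ℝ)
  Pa_self : ∀ a s, alarm s ≠ some a → Pa a s s = 1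
  lo : A → ℚ
  hi : A → ℚ
  lo_le_hi : ∀ a, lo a ≤ hi a
  law : A → ℝ → Measure ℝ
  law_prob : ∀ a, ∀ d ∈ Set.Icc (lo a : ℝ) (hi a), IsProbabilityMeasure (law a d)
  law_pos : ∀ a, ∀ d ∈ Set.Icc (lo a : ℝ) (hi a), law a d (Set.Iic 0) = 0
  law_mean : ∀ a, ∀ d ∈ Set.Icc (lo a : ℝ) (hi a), Integrable (fun x : ℝ => x) (law a d)

namespace ParametricACTMC

section Basic

variable {S A : Type} [Fintype S]

/-- The parameter functions. -/
def Param (N : ParametricACTMC S A) : Type :=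
  {d : A → ℝ // ∀ a, d a ∈ Set.Icc (N.lo a : ℝ) (N.hi a)}

/-- The ACTMC obtained by instantiating the parameters. -/
def inst (N : ParametricACTMC S A) (d : N.Param) : ACTMC S A where
  rate := N.rate
  rate_pos := by exact_mod_cast N.rate_pos
  P s s' := N.P s s'
  P_distr := N.P_distr
  alarm := N.alarm
  Pa a s s' := N.Pa a s s'
  Pa_distr := N.Pa_distr
  Pa_self a s h := by exact_mod_cast N.Pa_self a s h
  law a := N.law a (d.1 a)
  law_prob a := N.law_prob a _ (d.2 a)
  law_pos a := N.law_pos a _ (d.2 a)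
  law_mean a := N.law_mean a _ (d.2 a)

/-- There is a delay transition or an alarm transition from `s` to `s'`. -/
def Edge (N : ParametricACTMC S A) (s s' : S) : Prop :=
  0 < N.P s s' ∨ ∃ a, 0 < N.Pa a s s'

def StronglyConnected (N : ParametricACTMC S A) : Prop :=
  ∀ s s', Relation.ReflTransGen N.Edge s s'

/-- `s` is an alarm-setting state: an alarm `a` is enabled in `s`, and `s` can be entered by the
ringing of an alarm or by a delay transition from a state in which `a` is not enabled. -/
def IsSetting (N : ParametricACTMC S A) (s : S) : Prop :=
  ∃ a, N.alarm s = some a ∧ ∃ s', (∃ b, N.alarm s' = some b ∧ 0 < N.Pa b s' s) ∨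
    (N.alarm s' ≠ some a ∧ 0 < N.P s' s)

/-- The alarms are localized: every alarm has exactly one setting state. -/
def Localized (N : ParametricACTMC S A) : Prop :=
  ∀ a, ∃! s, N.alarm s = some a ∧ N.IsSetting s

/-- The states in `S_set ∪ S_off`. -/
def RegState (N : ParametricACTMC S A) : Type :=
  {s : S // N.alarm s = none ∨ N.IsSetting s}

instance (N : ParametricACTMC S A) : Fintype N.RegState :=
  have : Finite N.RegState := inferInstanceAs (Finite {s : S // N.alarm s = none ∨ N.IsSetting s})
  Fintype.ofFinite _

instance (N : ParametricACTMC S A) : MeasurableSpace N.RegState := ⊤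

instance (N : ParametricACTMC S A) : DiscreteMeasurableSpace N.RegState := ⟨fun _ => trivial⟩

/-- The parameter values of the discretized actions of a state: `ℓ_a + i δ(s) < u_a` and `u_a` in
a state with alarm `a`, and the single dummy value `0` in a state without alarm. -/
def actionSet (N : ParametricACTMC S A) (δ : S → ℚ) (s : S) : Set ℚ :=
  match N.alarm s with
  | none => {0}
  | some a => {d | d < N.hi a ∧ ∃ i : ℕ, d = N.lo a + i * δ s} ∪ {N.hi a}

/-- The actions enabled in a state of the `δ`-discretization. -/
def Act (N : ParametricACTMC S A) (δ : S → ℚ) (s : N.RegState) : Type :=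
  {d : ℚ // d ∈ N.actionSet δ s.1}

/-- Strategies for the `δ`-discretization (and its approximations). -/
abbrev Strategy (N : ParametricACTMC S A) (δ : S → ℚ) : Type := ∀ s, N.Act δ s

open scoped Classical in
/-- The parameter function of a strategy: the value chosen in the `a`-setting state. -/
def paramOf (N : ParametricACTMC S A) {δ : S → ℚ} (σ : N.Strategy δ) (a : A) : ℚ :=
  if h : ∃ s : N.RegState, N.alarm s.1 = some a then (σ h.choose).1 else N.lo a

open scoped Classical in
/-- A parameter function with value `d` at `a` (provided that `d ∈ [lo a, hi a]`); the values at
the other alarms do not matter below. -/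
def paramAt (N : ParametricACTMC S A) (a : A) (d : ℝ) : N.Param :=
  ⟨fun b => if b = a
      then Set.projIcc (N.lo b : ℝ) (N.hi b) (by exact_mod_cast N.lo_le_hi b) d
      else N.lo b, fun b => by
    dsimp only
    split_ifs
    · exact Subtype.property _
    · exact ⟨le_rfl, by exact_mod_cast N.lo_le_hi b⟩⟩

end Basic

variable {S A : Type} [Fintype S] [Fintype A] [MeasurableSpace S]

/-- `d` is an `ε`-optimal parameter function. -/
def EpsOptimal (N : ParametricACTMC S A) (C : Costs S) (ε : ℚ) (d : A → ℝ) : Prop :=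
  ∃ hd : ∀ a, d a ∈ Set.Icc (N.lo a : ℝ) (N.hi a), ∀ s₀,
    (N.inst ⟨d, hd⟩).expMP C s₀ ≤ (⨅ d' : N.Param, (N.inst d').expMP C s₀) + ENNReal.ofReal ε

/-- The distribution `Π_s(d)`. -/
def effProb (N : ParametricACTMC S A) (s : N.RegState) (d : ℝ) (s' : N.RegState) : ℝ :=
  match N.alarm s.1 with
  | none => N.P s.1 s'.1
  | some a => (N.inst (N.paramAt a d)).cycleProb s.1 s'.1

/-- The expected time `Θ_s(d)`. -/
def effTime (N : ParametricACTMC S A) (s : N.RegState) (d : ℝ) : ℝ :=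
  match N.alarm s.1 with
  | none => 1 / N.rate
  | some a => (N.inst (N.paramAt a d)).cycleTime s.1

/-- The expected cost of the action with parameter `d` in `s`. -/
def effCost (N : ParametricACTMC S A) (C : Costs S) (s : N.RegState) (d : ℝ) : ℝ :=
  match N.alarm s.1 with
  | none => C.R s.1 / N.rate + ∑ s', N.P s.1 s' * C.I s.1 s'
  | some a => (N.inst (N.paramAt a d)).cycleCost C s.1

/-- `M` is a `κ`-approximation of the `δ`-discretization of the semi-MDP of `N`. -/
def IsApprox (N : ParametricACTMC S A) (C : Costs S) (δ : S → ℚ) (κ : ℚ)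
    (M : SemiMDP N.RegState (N.Act δ)) : Prop :=
  ∀ s (b : N.Act δ s), IsKappaApprox (κ : ℝ)
    (N.effProb s (b.1 : ℝ)) (N.effTime s (b.1 : ℝ)) (N.effCost C s (b.1 : ℝ))
    (M.Q s b) (M.t s b) (M.c s b)

end ParametricACTMC

/-! ## The data used by the algorithm and the four assumptions -/

/-- The functions that the algorithm calls. States that are not alarm-setting and parameters out
of range are irrelevant. -/
structure Oracles (S : Type) where
  /-- discretization function for a given `ε` -/
  δ : ℚ → S → ℚ
  /-- approximation precision for a given `ε` -/
  κ : ℚ → ℚ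
  /-- lower bounds on positive probabilities -/
  pmin : S → ℚ
  /-- rational approximation, for a given precision, of `Π_s(d)` -/
  prob : ℚ → S → ℚ → S → ℚ
  /-- rational approximation, for a given precision, of `Θ_s(d)` -/
  time : ℚ → S → ℚ → ℚ
  /-- rational approximation, for a given precision, of the expected cost -/
  cost : ℚ → S → ℚ → ℚ
  /-- `roots s e κ g h` approximates, up to the error `e`, the roots of the derivative of the
  analytic ranking function of precision `κ` in `s` for the gain `g` and the bias `h` -/
  roots : S → ℚ → ℚ → ℚ → (S → ℚ) → List ℚ

namespace Oracles

section Assumptions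

variable {S A : Type} [Fintype S] [Fintype A] [MeasurableSpace S]

/-- First assumption: for every `ε`, every optimal strategy of every `κ`-approximation of the
`δ`-discretization induces an `ε`-optimal parameter function. The precision is smaller than all
expected times, so that the expected times, and with them the mean-payoff, of all
`κ`-approximations are meaningful. -/
def Assumption1 (O : Oracles S) (N : ParametricACTMC S A) (C : Costs S) : Prop :=
  ∀ ε : ℚ, 0 < ε →
    (∀ s, N.IsSetting s → 0 < O.δ ε s) ∧ 0 < O.κ ε ∧
    (∀ (s : N.RegState) (b : N.Act (O.δ ε) s), (O.κ ε : ℝ) < N.effTime s (b.1 : ℝ)) ∧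
    ∀ M : SemiMDP N.RegState (N.Act (O.δ ε)), N.IsApprox C (O.δ ε) (O.κ ε) M →
      ∀ σ : N.Strategy (O.δ ε), M.IsOptimal σ →
        N.EpsOptimal C ε fun a => (N.paramOf σ a : ℝ)

/-- Second assumption: rational `κ`-approximations. -/
def Assumption2 (O : Oracles S) (N : ParametricACTMC S A) (C : Costs S) : Prop :=
  ∀ κ : ℚ, 0 < κ → ∀ (s : N.RegState) (a : A), N.alarm s.1 = some a →
    ∀ d : ℚ, d ∈ Set.Icc (N.lo a) (N.hi a) →
      IsKappaApprox (κ : ℝ) (N.effProb s (d : ℝ)) (N.effTime s (d : ℝ)) (N.effCost C s (d : ℝ))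
        (fun s' => (O.prob κ s.1 d s'.1 : ℝ)) (O.time κ s.1 d) (O.cost κ s.1 d)

/-- The ranking function for given effects `q, t, c` of the actions. -/
def rankReal {N : ParametricACTMC S A} (q : ℝ → N.RegState → ℝ) (t c : ℝ → ℝ) (g : ℝ)
    (h : N.RegState → ℝ) (d : ℝ) : ℝ :=
  c d - g * t d + ∑ s', q d s' * h s'

/-- Third assumption: for every alarm-setting state, error bound `e` and precision `κ` there are
analytic `κ`-approximations `q, t, c` on `[ℓ_a, u_a]` whose ranking functions are differentiable,
and `roots` yields an approximation up to the error `e` of every root of the derivative. -/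
def Assumption3 (O : Oracles S) (N : ParametricACTMC S A) (C : Costs S) : Prop :=
  ∀ (s : N.RegState) (a : A), N.alarm s.1 = some a → ∀ e κ : ℚ, 0 < e → 0 < κ →
    ∃ (q : ℝ → N.RegState → ℝ) (t c : ℝ → ℝ),
      (∀ d ∈ Set.Icc (N.lo a : ℝ) (N.hi a),
        IsKappaApprox (κ : ℝ) (N.effProb s d) (N.effTime s d) (N.effCost C s d)
          (q d) (t d) (c d)) ∧
      ∀ (g : ℚ) (h : S → ℚ),
        DifferentiableOn ℝ (rankReal q t c g fun s' => (h s'.1 : ℝ))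
          (Set.Icc (N.lo a : ℝ) (N.hi a)) ∧
        ∀ x ∈ Set.Icc (N.lo a : ℝ) (N.hi a),
          HasDerivWithinAt (rankReal q t c g fun s' => (h s'.1 : ℝ)) 0
            (Set.Icc (N.lo a : ℝ) (N.hi a)) x →
          ∃ r ∈ O.roots s.1 e κ g h, |x - (r : ℝ)| ≤ e

/-- Fourth assumption: positive lower bounds on the positive probabilities. -/
def Assumption4 (O : Oracles S) (N : ParametricACTMC S A) : Prop :=
  ∀ (s : N.RegState) (a : A), N.alarm s.1 = some a → 0 < O.pmin s.1 ∧
    ∀ d ∈ Set.Icc (N.lo a : ℝ) (N.hi a), ∀ s' : N.RegState,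
      0 < N.effProb s d s' → (O.pmin s.1 : ℝ) ≤ N.effProb s d s'

end Assumptions

/-! ## The symbolic policy iteration algorithm -/

section Algorithm

variable {S A : Type} [Fintype S]

open scoped Classical in
/-- The precision `ξ = min {κ/4, Π_s^min/3 : s ∈ S_set}`. -/
def xi (O : Oracles S) (N : ParametricACTMC S A) (ε : ℚ) : ℚ :=
  (insert (O.κ ε / 4)
    ((Finset.univ.filter fun s => N.IsSetting s).image fun s => O.pmin s / 3)).min'
    (Finset.insert_nonempty _ _)

/-- `M` is the semi-MDP `M_ξ` determined by the rational `ξ`-approximations in the alarm-setting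
states and by the exact values in the states without alarm. -/
def Determines (O : Oracles S) (N : ParametricACTMC S A) (C : Costs S) (ε : ℚ)
    (M : SemiMDP N.RegState (N.Act (O.δ ε))) : Prop :=
  ∀ s (b : N.Act (O.δ ε) s),
    (N.alarm s.1 = none →
      (∀ s', M.Q s b s' = N.P s.1 s'.1) ∧ M.t s b = 1 / N.rate ∧
        M.c s b = C.R s.1 / N.rate + ∑ s', N.P s.1 s' * C.I s.1 s') ∧
    (N.alarm s.1 ≠ none →
      (∀ s', M.Q s b s' = O.prob (O.xi N ε) s.1 b.1 s'.1) ∧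
        M.t s b = O.time (O.xi N ε) s.1 b.1 ∧ M.c s b = O.cost (O.xi N ε) s.1 b.1)

/-- The rank of the action `b` in `s` with respect to gain `g` and bias `h`. -/
def rank {N : ParametricACTMC S A} {δ : S → ℚ} (M : SemiMDP N.RegState (N.Act δ))
    (g : ℚ) (h : N.RegState → ℚ) (s : N.RegState) (b : N.Act δ s) : ℝ :=
  M.c s b - g * M.t s b + ∑ s', M.Q s b s' * h s'

/-- Policy evaluation: `g` is the gain of `σ`, and `h` is its bias, normalized at `s₀`. -/
def IsEvaluation {N : ParametricACTMC S A} {δ : S → ℚ} (M : SemiMDP N.RegState (N.Act δ))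
    (s₀ : N.RegState) (σ : N.Strategy δ) (g : ℚ) (h : N.RegState → ℚ) : Prop :=
  0 ≤ g ∧ (∀ s, M.expMP σ s = ENNReal.ofReal g) ∧
    h s₀ = 0 ∧ ∀ s, (h s : ℝ) = rank M g h s (σ s)

open scoped Classical in
/-- The bias vector as a function on all states (`0` outside of `S_set ∪ S_off`). -/
def extend {N : ParametricACTMC S A} (h : N.RegState → ℚ) (s : S) : ℚ :=
  if hs : N.alarm s = none ∨ N.IsSetting s then h ⟨s, hs⟩ else 0

/-- The candidate actions in the state `s` with alarm `a`. -/
def candidates (O : Oracles S) (N : ParametricACTMC S A) (ε : ℚ) (σ : N.Strategy (O.δ ε))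
    (g : ℚ) (h : N.RegState → ℚ) (s : N.RegState) (a : A) : Set (N.Act (O.δ ε) s) :=
  {σ s} ∪ {b | ∃ r ∈ (O.roots s.1 (O.δ ε s.1 / 2) (O.xi N ε) g (extend h)) ++ [N.lo a, N.hi a],
    |b.1 - r| ≤ 3 * O.δ ε s.1 / 2}

/-- The best-ranked candidate actions. -/
def best (O : Oracles S) (N : ParametricACTMC S A) (ε : ℚ) (M : SemiMDP N.RegState (N.Act (O.δ ε)))
    (σ : N.Strategy (O.δ ε)) (g : ℚ) (h : N.RegState → ℚ) (s : N.RegState) (a : A) :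
    Set (N.Act (O.δ ε) s) :=
  {b | b ∈ O.candidates N ε σ g h s a ∧
    ∀ b' ∈ O.candidates N ε σ g h s a, rank M g h s b ≤ rank M g h s b'}

/-- One iteration of the loop of the algorithm: policy evaluation of `σ`, followed by policy
improvement, may yield `σ'`. -/
def Step (O : Oracles S) (N : ParametricACTMC S A) (ε : ℚ) (M : SemiMDP N.RegState (N.Act (O.δ ε)))
    (s₀ : N.RegState) (σ σ' : N.Strategy (O.δ ε)) : Prop :=
  ∃ (g : ℚ) (h : N.RegState → ℚ), IsEvaluation M s₀ σ g h ∧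
    ∀ s, (N.alarm s.1 = none → σ' s = σ s) ∧
      ∀ a, N.alarm s.1 = some a →
        (σ s ∈ O.best N ε M σ g h s a → σ' s = σ s) ∧
        (σ s ∉ O.best N ε M σ g h s a → σ' s ∈ O.best N ε M σ g h s a)

/-- The algorithm, started with `s₀` and the strategy `σ₀`, may leave its loop with `σ`, so that
it returns the parameter function of `σ`. -/
def Returns (O : Oracles S) (N : ParametricACTMC S A) (ε : ℚ)
    (M : SemiMDP N.RegState (N.Act (O.δ ε))) (s₀ : N.RegState) (σ₀ σ : N.Strategy (O.δ ε)) : Prop :=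
  Relation.ReflTransGen (fun τ τ' => O.Step N ε M s₀ τ τ' ∧ τ' ≠ τ) σ₀ σ ∧ O.Step N ε M s₀ σ σ

/-- The algorithm terminates for all of its nondeterministic choices: in each iteration the policy
evaluation and improvement can be carried out, and the loop is not repeated forever. -/
def Terminates (O : Oracles S) (N : ParametricACTMC S A) (ε : ℚ)
    (M : SemiMDP N.RegState (N.Act (O.δ ε))) : Prop :=
  ∀ s₀ : N.RegState, (∀ σ, ∃ σ', O.Step N ε M s₀ σ σ') ∧
    ¬ ∃ τ : ℕ → N.Strategy (O.δ ε), ∀ n, O.Step N ε M s₀ (τ n) (τ (n + 1)) ∧ τ (n + 1) ≠ τ n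

end Algorithm

end Oracles

/-! ## Effectivity -/

/-- The finite rational description of an instance, without the alarm distributions. -/
def instanceData {n k : ℕ} (N : ParametricACTMC (Fin n) (Fin k)) (C : Costs (Fin n)) :
    ℚ × List (List ℚ) × List (Option ℕ) × List (List (List ℚ)) × List ℚ × List ℚ ×
      List ℚ × List (List ℚ) × List (List ℚ) :=
  (N.rate, List.ofFn fun s => List.ofFn fun s' => N.P s s',
    List.ofFn fun s => (N.alarm s).map Fin.val,
    List.ofFn fun a => List.ofFn fun s => List.ofFn fun s' => N.Pa a s s',
    List.ofFn N.lo, List.ofFn N.hi,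
    List.ofFn C.R, List.ofFn fun s => List.ofFn fun s' => C.I s s',
    List.ofFn fun s => List.ofFn fun s' => C.IA s s')

/-- The instances of the family `(N, C)` are computable from their indices. -/
def ComputableInstances {ι : Type} [Primcodable ι] {n k : ι → ℕ}
    (N : ∀ i, ParametricACTMC (Fin (n i)) (Fin (k i))) (C : ∀ i, Costs (Fin (n i))) : Prop :=
  Computable fun i => instanceData (N i) (C i)

/-- The oracles are computable, uniformly in the instance. -/
structure ComputableOracles {ι : Type} [Primcodable ι] {n : ι → ℕ}
    (O : ∀ i, Oracles (Fin (n i))) : Prop where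
  δ : Computable fun x : ι × ℚ => List.ofFn ((O x.1).δ x.2)
  κ : Computable fun x : ι × ℚ => (O x.1).κ x.2
  pmin : Computable fun i => List.ofFn (O i).pmin
  prob : Computable fun x : ι × ℚ × ℚ =>
    List.ofFn fun s => List.ofFn fun s' => (O x.1).prob x.2.1 s x.2.2 s'
  time : Computable fun x : ι × ℚ × ℚ => List.ofFn fun s => (O x.1).time x.2.1 s x.2.2
  cost : Computable fun x : ι × ℚ × ℚ => List.ofFn fun s => (O x.1).cost x.2.1 s x.2.2
  roots : ∃ f : ι × ℕ × ℚ × ℚ × ℚ × List ℚ → List ℚ, Computable f ∧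
    ∀ i s e κ g h, (O i).roots s e κ g h = f (i, s.val, e, κ, g, List.ofFn h)

end

/-! ## Computable predicates and rational arithmetic -/

section Computability

variable {α β γ : Type*} [Primcodable α] [Primcodable β] [Primcodable γ]

/-! Gain and bias of a strategy solve the Poisson equation h = c - gΘ + Πh. Which regenerative
states can end a cycle depends only on the transition graph, not on the timer distributions
(`ACTMC.cycleProb_pos_iff`): a timer lies in some interval (c, B] with c > 0 with positive
probability, and exponential delays can be arbitrarily short or long. By strong connectivity and
localization, every strategy therefore induces an irreducible chain in every approximation
(`ParametricACTMC.IsApprox.reflTransGen`). Hence the Poisson equation with h(s₀) = 0 is solvable,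
over ℚ if the effects are rational (`exists_poisson_solution`), and a law of large numbers for
martingale differences identifies g with the expected mean-payoff (`SemiMDP.expMP_eq_ofReal`). An
iteration that changes the strategy lowers some rank and raises none, which by the minimum principle
strictly lowers the gain (`gain_lt_of_improvement`). As there are finitely many strategies, the loop
ends (`Oracles.terminates`).

The final strategy σ is only known to beat the candidates, so it need not be optimal in M_ξ. It is
optimal in another member M' of [M⟨δ⟩]_κ, which suffices by the first assumption
(`Oracles.epsOptimal_of_step_self`). M' keeps the effects of the candidates. For any other action b,
let b₀ minimize the analytic ranking function over all actions. This b₀ is a candidate: unless it is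
close to an end of the interval, its two grid neighbours are no better, so the derivative has a root
within δ (`Oracles.mem_candidates_of_isMin`). Give b its analytic effects plus the difference, at
b₀, between the effects of M_ξ and the analytic ones. Up to a small correction, b is then ranked at
least as high as b₀ in M_ξ, hence at least h(s). The total change is at most 4ξ ≤ κ, and 3ξ ≤ Π^min
preserves the support (`exists_approx_rank_ge`). Every strategy of M' now satisfies h ≤ c - gΘ + Πh,
so its mean-payoff is at least g (`SemiMDP.ofReal_le_expMP`).

For the computable function the loop is not simulated. The initial strategy is arbitrary, so a
strategy that one iteration can leave unchanged is returned at once when the algorithm starts with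
it. Such a strategy has a finite certificate: parameters, gain, bias, ξ, a bound for the grid
indices and a base state. Checking it means deciding finitely many equations and inequalities
between rationals (`Tables.isStable_iff`, `Tables.computablePred_isStable`); termination guarantees
that a certificate exists, and unbounded search finds one
(`ComputablePred.exists_computable_choice`). This requires rational arithmetic to be computable for
the given coding of ℚ, which lists the rationals in increasing order of their numerator-denominator
codes (`Rat.computable_pairCode`). -/

theorem ComputablePred.comp_computable {p : β → Prop} (hp : ComputablePred p) {f : α → β}
    (hf : Computable f) : ComputablePred fun a => p (f a) := by
  classical
  exact (hp.decide.comp hf).computablePred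

theorem ComputablePred.and_pred {p q : α → Prop} (hp : ComputablePred p) (hq : ComputablePred q) :
    ComputablePred fun a => p a ∧ q a := by
  classical
  refine Computable.computablePred ((Primrec.and.to_comp.comp hp.decide hq.decide).of_eq ?_)
  intro a
  simp

theorem ComputablePred.or_pred {p q : α → Prop} (hp : ComputablePred p) (hq : ComputablePred q) :
    ComputablePred fun a => p a ∨ q a := by
  classical
  refine Computable.computablePred ((Primrec.or.to_comp.comp hp.decide hq.decide).of_eq ?_)
  intro a
  simp

theorem ComputablePred.imp_pred {p q : α → Prop} (hp : ComputablePred p) (hq : ComputablePred q) :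
    ComputablePred fun a => p a → q a :=
  (hp.not.or_pred hq).of_eq fun a => by tauto

theorem Computable.eq_pred {f g : α → β} (hf : Computable f) (hg : Computable g) :
    ComputablePred fun a => f a = g a := by
  classical
  exact (Primrec.eq (α := β)).computablePred.comp_computable (hf.pair hg)

theorem Computable.ite_pred {p : α → Prop} [DecidablePred p] (hp : ComputablePred p)
    {f g : α → β} (hf : Computable f) (hg : Computable g) :
    Computable fun a => if p a then f a else g a :=
  (Computable.cond hp.decide hf hg).of_eq fun a => by by_cases h : p a <;> simp [h]

/-- A bounded conjunction is evaluated by primitive recursion on its bound. -/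
theorem ComputablePred.forall_lt_pred {p : α → ℕ → Prop}
    (hp : ComputablePred fun x : α × ℕ => p x.1 x.2) {f : α → ℕ} (hf : Computable f) :
    ComputablePred fun a => ∀ i < f a, p a i := by
  classical
  refine Computable.computablePred ((Computable.nat_rec hf (Computable.const true)
    (h := fun a x => x.2 && decide (p a x.1)) ?_).of_eq ?_)
  · exact Primrec.and.to_comp.comp (Computable.snd.comp Computable.snd)
      (hp.decide.comp (Computable.pair Computable.fst (Computable.fst.comp Computable.snd)))
  · intro a
    induction f a with
    | zero => simp
    | succ m ih =>
      simp only [ih]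
      rw [Bool.eq_iff_iff]
      simp only [Bool.and_eq_true, decide_eq_true_eq]
      constructor
      · rintro ⟨h1, h2⟩ i hi
        rcases Nat.lt_succ_iff_lt_or_eq.1 hi with h | rfl
        exacts [h1 i h, h2]
      · exact fun h => ⟨fun i hi => h i (by omega), h m (by omega)⟩

theorem ComputablePred.exists_lt_pred {p : α → ℕ → Prop}
    (hp : ComputablePred fun x : α × ℕ => p x.1 x.2) {f : α → ℕ} (hf : Computable f) :
    ComputablePred fun a => ∃ i < f a, p a i :=
  (ComputablePred.forall_lt_pred (p := fun a i => ¬ p a i) hp.not hf).not.of_eq fun a => by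
    push Not; rfl

/-- A function whose graph is decidable is computable. -/
theorem Computable.of_graph {δ : Type*} [Denumerable δ] {f : α → δ}
    (hf : ComputablePred fun x : α × ℕ => Denumerable.ofNat δ x.2 = f x.1) :
    Computable f := by
  classical
  have hex : ∀ a, ∃ m, Denumerable.ofNat δ m = f a := fun a =>
    ⟨Encodable.encode (f a), Denumerable.ofNat_encode _⟩
  have := Computable.find (P := fun a m => Denumerable.ofNat δ m = f a) hf hex
  exact ((Computable.ofNat δ).comp this).of_eq fun a => Nat.find_spec (hex a)

end Computability

/-! ### Numerator and denominator are computable from the code of a rational number. -/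

namespace Rat

/-- The code of a rational number from which its numerator and denominator are read off. -/
abbrev pairCode (q : ℚ) : ℕ := Nat.pair (Encodable.encode q.num) q.den

/-- The denumeration of ℚ comes from enumerating increasingly the infinite range of the encoding by
numerator-denominator pairs. -/
theorem ofNat_pairCode_lt (m : ℕ) :
    pairCode (Denumerable.ofNat ℚ m) < pairCode (Denumerable.ofNat ℚ (m + 1)) := by
  let := @Encodable.decidableRangeEncode ℚ Rat.instEncodable
  have : Infinite (Set.range (@Encodable.encode ℚ Rat.instEncodable)) :=
    Infinite.of_injective _ (Equiv.ofInjective _ Encodable.encode_injective).injective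
  have key : ∀ j, pairCode (Denumerable.ofNat ℚ j) =
      (Nat.Subtype.ofNat (Set.range (@Encodable.encode ℚ Rat.instEncodable)) j : ℕ) := by
    intro j
    have h : Denumerable.ofNat ℚ j = (@Encodable.equivRangeEncode ℚ Rat.instEncodable).symm
        (Nat.Subtype.ofNat (Set.range (@Encodable.encode ℚ Rat.instEncodable)) j) := rfl
    rw [h]
    have h2 : ∀ x, (@Encodable.encode ℚ Rat.instEncodable
      ((@Encodable.equivRangeEncode ℚ Rat.instEncodable).symm x)) = (x : ℕ) := fun x =>
      congrArg Subtype.val ((@Encodable.equivRangeEncode ℚ Rat.instEncodable).apply_symm_apply x)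
    exact h2 _
  rw [key, key]
  exact Nat.Subtype.lt_succ_self _

/-- A pair codes a rational iff it is a reduced fraction. Coprimality is stated with a bounded
quantifier to make it visibly decidable. -/
theorem range_pairCode (m : ℕ) : (∃ q : ℚ, pairCode q = m) ↔
    0 < m.unpair.2 ∧
      ∀ i < m.unpair.1 + m.unpair.2 + 1,
        (if m.unpair.1 % 2 = 0 then m.unpair.1 / 2 else m.unpair.1 / 2 + 1) % i = 0 →
        m.unpair.2 % i = 0 → i = 1 := by
  -- The integer code is 2a for a, and 2a + 1 for -(a + 1).
  have hcode : ∀ z : ℤ, z.natAbs = if Encodable.encode z % 2 = 0 then Encodable.encode z / 2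
      else Encodable.encode z / 2 + 1 := by
    intro z
    change z.natAbs = if Equiv.intEquivNat z % 2 = 0 then Equiv.intEquivNat z / 2
      else Equiv.intEquivNat z / 2 + 1
    cases z with
    | ofNat a =>
      have : Equiv.intEquivNat (Int.ofNat a) = 2 * a := rfl
      rw [this]; simp
    | negSucc a =>
      have : Equiv.intEquivNat (Int.negSucc a) = 2 * a + 1 := rfl
      rw [this, if_neg (by omega)]; simp; omega
  -- The gcd divides d > 0 and is thus at most d, so every bound b ≥ d tests it.
  have hcop : ∀ a d b : ℕ, 0 < d → d ≤ b → (a.Coprime d ↔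
      ∀ i < b + 1, a % i = 0 → d % i = 0 → i = 1) := by
    intro a d b hd hb
    constructor
    · intro h i _ h1 h2
      exact Nat.dvd_one.1 (h ▸ Nat.dvd_gcd (Nat.dvd_of_mod_eq_zero h1) (Nat.dvd_of_mod_eq_zero h2))
    · intro h
      have := Nat.le_of_dvd hd (Nat.gcd_dvd_right a d)
      exact h _ (by omega) (Nat.mod_eq_zero_of_dvd (Nat.gcd_dvd_left a d))
        (Nat.mod_eq_zero_of_dvd (Nat.gcd_dvd_right a d))
  constructor
  · rintro ⟨q, rfl⟩
    simp only [pairCode, Nat.unpair_pair]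
    refine ⟨q.den_pos, ?_⟩
    rw [← hcode]
    exact (hcop _ _ _ q.den_pos (by omega)).1 q.reduced
  · rintro ⟨hd, h⟩
    obtain ⟨z, hz⟩ : ∃ z : ℤ, Encodable.encode z = m.unpair.1 :=
      ⟨Equiv.intEquivNat.symm m.unpair.1, Equiv.apply_symm_apply _ _⟩
    rw [← hz, ← hcode] at h
    refine ⟨⟨z, m.unpair.2, hd.ne', (hcop _ _ _ hd (by omega)).2 h⟩, ?_⟩
    exact (congrArg (fun x => Nat.pair x m.unpair.2) hz).trans (Nat.pair_unpair m)

/-- The pair codes form a decidable infinite set, and `f` lists it increasingly; hence `f` is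
computed by iterating the search for the next element of the set. -/
theorem computable_pairCode : Computable pairCode := by
  classical
  have hr : ComputablePred fun m : ℕ => ∃ q : ℚ, pairCode q = m := by
    have h1 : Computable fun m : ℕ => m.unpair.1 := Computable.fst.comp Computable.unpair
    have h2 : Computable fun m : ℕ => m.unpair.2 := Computable.snd.comp Computable.unpair
    have hmod : ∀ {f g : ℕ × ℕ → ℕ}, Computable f → Computable g →
        Computable fun x => f x % g x := fun hf hg => Primrec.nat_mod.to_comp.comp hf hg
    have hhalf : Computable fun m : ℕ => m.unpair.1 / 2 :=
      Primrec.nat_div.to_comp.comp h1 (Computable.const 2)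
    have habs : Computable fun m : ℕ =>
        if m.unpair.1 % 2 = 0 then m.unpair.1 / 2 else m.unpair.1 / 2 + 1 :=
      Computable.ite_pred (Computable.eq_pred
        (Primrec.nat_mod.to_comp.comp h1 (Computable.const 2)) (Computable.const 0))
        hhalf (Computable.succ.comp hhalf)
    refine ComputablePred.of_eq ?_ fun m => (range_pairCode m).symm
    refine ComputablePred.and_pred ?_ ?_
    · exact (Primrec.nat_lt.computablePred).comp_computable ((Computable.const 0).pair h2)
    · refine ComputablePred.forall_lt_pred ?_
        (Computable.succ.comp (Primrec.nat_add.to_comp.comp h1 h2))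
      exact (Computable.eq_pred (hmod (habs.comp Computable.fst) Computable.snd)
        (Computable.const 0)).imp_pred ((Computable.eq_pred (hmod (h2.comp Computable.fst)
          Computable.snd) (Computable.const 0)).imp_pred
            (Computable.eq_pred Computable.snd (Computable.const 1)))
  set f : ℕ → ℕ := fun m => pairCode (Denumerable.ofNat ℚ m) with hf
  have hmono : StrictMono f := strictMono_nat_of_lt_succ ofNat_pairCode_lt
  have hex : ∀ x : ℕ, ∃ m, x < m ∧ ∃ q : ℚ, pairCode q = m := fun x =>
    ⟨f (x + 1), lt_of_lt_of_le (Nat.lt_succ_self x) hmono.le_apply, _, rfl⟩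
  -- Every pair code is a value of `f`, and no value of a strictly increasing sequence lies strictly
  -- between two consecutive ones.
  have hsucc : ∀ m, f (m + 1) = Nat.find (hex (f m)) := by
    intro m
    symm
    rw [Nat.find_eq_iff]
    refine ⟨⟨hmono (Nat.lt_succ_self m), _, rfl⟩, ?_⟩
    rintro j hj ⟨hlt, q, rfl⟩
    have hq : pairCode q = f (@Encodable.encode ℚ Primcodable.toEncodable q) :=
      congrArg pairCode (Denumerable.ofNat_encode q).symm
    rw [hq] at hj hlt
    have a1 := hmono.lt_iff_lt.1 hj
    have a2 := hmono.lt_iff_lt.1 hlt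
    omega
  have hfind : Computable fun x => Nat.find (hex x) := by
    refine Computable.find (P := fun x m => x < m ∧ ∃ q : ℚ, pairCode q = m) ?_ hex
    exact ComputablePred.and_pred Primrec.nat_lt.computablePred
      (hr.comp_computable Computable.snd)
  have hfc : Computable f := by
    refine (Computable.nat_rec Computable.id (Computable.const (f 0))
      (h := fun _ x => Nat.find (hex x.2))
      (hfind.comp (Computable.snd.comp Computable.snd))).of_eq ?_
    intro m
    simp only [id]
    induction m with
    | zero => rfl
    | succ m ih => simp only [ih, hsucc]
  exact (hfc.comp Computable.encode).of_eq fun q =>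
    congrArg pairCode (Denumerable.ofNat_encode q)

theorem computable_den : Computable fun q : ℚ => q.den :=
  ((Computable.snd.comp Computable.unpair).comp computable_pairCode).of_eq fun q => by
    simp [pairCode]

theorem computable_num_toNat : Computable fun q : ℚ => q.num.toNat := by
  have h1 : Computable fun q : ℚ => Encodable.encode q.num :=
    ((Computable.fst.comp Computable.unpair).comp computable_pairCode).of_eq fun q => by
      simp [pairCode]
  refine (Computable.ite_pred (p := fun q : ℚ => Encodable.encode q.num % 2 = 0)
    (Computable.eq_pred (Primrec.nat_mod.to_comp.comp h1 (Computable.const 2))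
      (Computable.const 0)) (Primrec.nat_div.to_comp.comp h1 (Computable.const 2))
      (Computable.const 0)).of_eq fun q => ?_
  change (if Equiv.intEquivNat q.num % 2 = 0 then Equiv.intEquivNat q.num / 2 else 0) = _
  cases h : q.num with
  | ofNat a =>
    have : Equiv.intEquivNat (Int.ofNat a) = 2 * a := rfl
    rw [this]; simp
  | negSucc a =>
    have : Equiv.intEquivNat (Int.negSucc a) = 2 * a + 1 := rfl
    rw [this, if_neg (by omega)]; simp

theorem computable_neg_num_toNat : Computable fun q : ℚ => (-q.num).toNat := by
  have h1 : Computable fun q : ℚ => Encodable.encode q.num :=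
    ((Computable.fst.comp Computable.unpair).comp computable_pairCode).of_eq fun q => by
      simp [pairCode]
  refine (Computable.ite_pred (p := fun q : ℚ => Encodable.encode q.num % 2 = 0)
    (Computable.eq_pred (Primrec.nat_mod.to_comp.comp h1 (Computable.const 2))
      (Computable.const 0)) (Computable.const 0) (Computable.succ.comp
        (Primrec.nat_div.to_comp.comp h1 (Computable.const 2)))).of_eq fun q => ?_
  change (if Equiv.intEquivNat q.num % 2 = 0 then 0 else Equiv.intEquivNat q.num / 2 + 1) = _
  cases h : q.num with
  | ofNat a =>
    have : Equiv.intEquivNat (Int.ofNat a) = 2 * a := rfl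
    rw [this]; simp
  | negSucc a =>
    have : Equiv.intEquivNat (Int.negSucc a) = 2 * a + 1 := rfl
    rw [this, if_neg (by omega), Int.neg_negSucc]
    simp only [Int.toNat_natCast]
    omega

/-- Writing the numerator as a difference of naturals turns relations between rationals, after
clearing denominators and moving negative terms across, into relations between naturals. -/
theorem eq_toNat_div (q : ℚ) : q = ((q.num.toNat : ℚ) - ((-q.num).toNat : ℚ)) / (q.den : ℚ) := by
  conv_lhs => rw [← Rat.num_div_den q]
  congr 1
  have := Int.toNat_sub_toNat_neg q.num
  exact_mod_cast this.symm

end Rat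

/-! ### Computable order and arithmetic of ℚ. -/

section RationalArithmetic

variable {α : Type*} [Primcodable α]

theorem Computable.nat_add' {f g : α → ℕ} (hf : Computable f) (hg : Computable g) :
    Computable fun a => f a + g a := Primrec.nat_add.to_comp.comp hf hg

theorem Computable.nat_mul' {f g : α → ℕ} (hf : Computable f) (hg : Computable g) :
    Computable fun a => f a * g a := Primrec.nat_mul.to_comp.comp hf hg

theorem Computable.rat_le {f g : α → ℚ} (hf : Computable f) (hg : Computable g) :
    ComputablePred fun a => f a ≤ g a := by
  have hp := fun {f : α → ℚ} (hf : Computable f) => Rat.computable_num_toNat.comp hf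
  have hm := fun {f : α → ℚ} (hf : Computable f) => Rat.computable_neg_num_toNat.comp hf
  have hd := fun {f : α → ℚ} (hf : Computable f) => Rat.computable_den.comp hf
  refine ((Primrec.nat_le.computablePred).comp_computable
    (Computable.pair
      (((hp hf).nat_mul' (hd hg)).nat_add' ((hm hg).nat_mul' (hd hf)))
      (((hp hg).nat_mul' (hd hf)).nat_add' ((hm hf).nat_mul' (hd hg))))).of_eq fun a => ?_
  generalize f a = p
  generalize g a = q
  have h1 : (0 : ℚ) < p.den := by exact_mod_cast p.den_pos
  have h2 : (0 : ℚ) < q.den := by exact_mod_cast q.den_pos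
  conv_rhs => rw [Rat.eq_toNat_div p, Rat.eq_toNat_div q, div_le_div_iff₀ h1 h2]
  change _ ≤ _ ↔ _
  rw [← @Nat.cast_le ℚ]
  push_cast
  constructor <;> intro h <;> linarith

theorem Computable.rat_lt {f g : α → ℚ} (hf : Computable f) (hg : Computable g) :
    ComputablePred fun a => f a < g a :=
  (hg.rat_le hf).not.of_eq fun _ => not_le

/-- The graph r = p + q, cleared of denominators and signs, is an identity between naturals and so
decidable; the sum is then found by searching through all codes. -/
theorem Computable.rat_add {f g : α → ℚ} (hf : Computable f) (hg : Computable g) :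
    Computable fun a => f a + g a := by
  have hp := fun {f : α × ℕ → ℚ} (hf : Computable f) => Rat.computable_num_toNat.comp hf
  have hm := fun {f : α × ℕ → ℚ} (hf : Computable f) => Rat.computable_neg_num_toNat.comp hf
  have hd := fun {f : α × ℕ → ℚ} (hf : Computable f) => Rat.computable_den.comp hf
  refine Computable.of_graph ?_
  have hr : Computable fun x : α × ℕ => Denumerable.ofNat ℚ x.2 :=
    (Computable.ofNat ℚ).comp Computable.snd
  replace hf : Computable fun x : α × ℕ => f x.1 := hf.comp Computable.fst
  replace hg : Computable fun x : α × ℕ => g x.1 := hg.comp Computable.fst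
  refine (Computable.eq_pred
    (((hp hr).nat_mul' ((hd hf).nat_mul' (hd hg))).nat_add'
      (((hm hf).nat_mul' ((hd hg).nat_mul' (hd hr))).nat_add'
        ((hm hg).nat_mul' ((hd hf).nat_mul' (hd hr)))))
    (((hm hr).nat_mul' ((hd hf).nat_mul' (hd hg))).nat_add'
      (((hp hf).nat_mul' ((hd hg).nat_mul' (hd hr))).nat_add'
        ((hp hg).nat_mul' ((hd hf).nat_mul' (hd hr)))))).of_eq fun x => ?_
  generalize f x.1 = p
  generalize g x.1 = q
  generalize Denumerable.ofNat ℚ x.2 = r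
  have h1 : (p.den : ℚ) ≠ 0 := by exact_mod_cast p.den_nz
  have h2 : (q.den : ℚ) ≠ 0 := by exact_mod_cast q.den_nz
  have h3 : (r.den : ℚ) ≠ 0 := by exact_mod_cast r.den_nz
  conv_rhs => rw [Rat.eq_toNat_div p, Rat.eq_toNat_div q, Rat.eq_toNat_div r,
    div_add_div _ _ h1 h2, div_eq_div_iff h3 (mul_ne_zero h1 h2)]
  rw [← @Nat.cast_inj ℚ]
  push_cast
  constructor <;> intro h <;> linarith

theorem Computable.rat_mul {f g : α → ℚ} (hf : Computable f) (hg : Computable g) :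
    Computable fun a => f a * g a := by
  have hp := fun {f : α × ℕ → ℚ} (hf : Computable f) => Rat.computable_num_toNat.comp hf
  have hm := fun {f : α × ℕ → ℚ} (hf : Computable f) => Rat.computable_neg_num_toNat.comp hf
  have hd := fun {f : α × ℕ → ℚ} (hf : Computable f) => Rat.computable_den.comp hf
  refine Computable.of_graph ?_
  have hr : Computable fun x : α × ℕ => Denumerable.ofNat ℚ x.2 :=
    (Computable.ofNat ℚ).comp Computable.snd
  replace hf : Computable fun x : α × ℕ => f x.1 := hf.comp Computable.fst
  replace hg : Computable fun x : α × ℕ => g x.1 := hg.comp Computable.fst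
  refine (Computable.eq_pred
    (((hp hr).nat_mul' ((hd hf).nat_mul' (hd hg))).nat_add'
      ((((hp hf).nat_mul' (hm hg)).nat_add' ((hm hf).nat_mul' (hp hg))).nat_mul' (hd hr)))
    (((hm hr).nat_mul' ((hd hf).nat_mul' (hd hg))).nat_add'
      ((((hp hf).nat_mul' (hp hg)).nat_add' ((hm hf).nat_mul' (hm hg))).nat_mul'
        (hd hr)))).of_eq fun x => ?_
  generalize f x.1 = p
  generalize g x.1 = q
  generalize Denumerable.ofNat ℚ x.2 = r
  have h1 : (p.den : ℚ) ≠ 0 := by exact_mod_cast p.den_nz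
  have h2 : (q.den : ℚ) ≠ 0 := by exact_mod_cast q.den_nz
  have h3 : (r.den : ℚ) ≠ 0 := by exact_mod_cast r.den_nz
  conv_rhs => rw [Rat.eq_toNat_div p, Rat.eq_toNat_div q, Rat.eq_toNat_div r,
    div_mul_div_comm, div_eq_div_iff h3 (mul_ne_zero h1 h2)]
  rw [← @Nat.cast_inj ℚ]
  push_cast
  constructor <;> intro h <;> linarith

theorem Computable.rat_natCast {f : α → ℕ} (hf : Computable f) :
    Computable fun a => (f a : ℚ) := by
  refine (Computable.nat_rec hf (Computable.const (0 : ℚ)) (h := fun _ x => x.2 + 1)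
    ((Computable.snd.comp Computable.snd).rat_add (Computable.const 1))).of_eq fun a => ?_
  induction f a with
  | zero => simp
  | succ m ih => simp only [ih]; push_cast; rfl

theorem Computable.rat_sum_range {f : α → ℕ} {g : α → ℕ → ℚ} (hf : Computable f)
    (hg : Computable fun x : α × ℕ => g x.1 x.2) :
    Computable fun a => ∑ i ∈ Finset.range (f a), g a i := by
  have hg' : Computable fun y : α × ℕ × ℚ => g y.1 y.2.1 :=
    Computable.comp (f := fun x : α × ℕ => g x.1 x.2) (g := fun y : α × ℕ × ℚ => (y.1, y.2.1)) hg
      (Computable.fst.pair (Computable.fst.comp Computable.snd))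
  have hs : Computable fun y : α × ℕ × ℚ => y.2.2 := Computable.snd.comp Computable.snd
  have hstep : Computable₂ fun (a : α) (x : ℕ × ℚ) => x.2 + g a x.1 := hs.rat_add hg'
  refine (Computable.nat_rec hf (Computable.const (0 : ℚ)) hstep).of_eq fun a => ?_
  induction f a with
  | zero => simp
  | succ m ih => simp only [ih, Finset.sum_range_succ]

theorem Computable.list_getD {β : Type*} [Primcodable β] {f : α → List β} {g : α → ℕ} (b : β)
    (hf : Computable f) (hg : Computable g) : Computable fun a => (f a).getD (g a) b :=
  (Computable.option_getD (Computable.list_getElem?.comp hf hg) (Computable.const b)).of_eq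
    fun a => by simp [List.getD]

end RationalArithmetic

/-! ## Mean-payoff of a semi-MDP from the optimality equations -/

theorem integral_choiceLaw {M : Type} [Fintype M] [MeasurableSpace M] [DiscreteMeasurableSpace M]
    {p : M → ℝ} (hp : IsDistr p) (f : M → ℝ) : ∫ m, f m ∂choiceLaw p = ∑ m, p m * f m := by
  rw [choiceLaw, integral_finsetSum_measure]
  · refine Finset.sum_congr rfl fun m _ => ?_
    rw [integral_smul_measure, integral_dirac, ENNReal.toReal_ofReal (hp.1 m), smul_eq_mul]
  · intro m _
    exact (integrable_dirac (by simp)).smul_measure ENNReal.ofReal_ne_top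

/-- Between consecutive squares k² and (k + 1)², the sequence moves by at most 2kK, which is
negligible compared with k²; so the limit along squares decides. -/
theorem tendsto_div_natCast_of_sq {u : ℕ → ℝ} {K : ℝ}
    (hu : ∀ m n, m ≤ n → |u n - u m| ≤ K * (n - m : ℝ))
    (hsq : Tendsto (fun k : ℕ => u (k ^ 2) / (k ^ 2 : ℝ)) atTop (nhds 0)) :
    Tendsto (fun n : ℕ => u n / n) atTop (nhds 0) := by
  have hK : 0 ≤ K := by
    have := (abs_nonneg _).trans (hu 0 1 (by norm_num))
    simpa using this
  have hsqrt : Tendsto Nat.sqrt atTop atTop := by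
    refine tendsto_atTop_atTop.2 fun b => ⟨b ^ 2, fun a ha => ?_⟩
    exact Nat.le_sqrt'.2 ha
  have h1 : Tendsto (fun n : ℕ => |u (n.sqrt ^ 2) / (n.sqrt ^ 2 : ℝ)| + 2 * K / (n.sqrt : ℝ)) atTop
      (nhds 0) := by
    have a := (hsq.comp hsqrt).abs
    have b := (tendsto_const_div_atTop_nhds_zero_nat (2 * K)).comp hsqrt
    simpa [Function.comp_def] using a.add b
  refine squeeze_zero_norm' ?_ h1
  filter_upwards [eventually_ge_atTop 1] with n hn
  have hk : 1 ≤ n.sqrt := Nat.le_sqrt'.2 (by simpa using hn)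
  have hkn : n.sqrt ^ 2 ≤ n := Nat.sqrt_le' n
  have hkn' : n ≤ n.sqrt ^ 2 + 2 * n.sqrt := by
    have := Nat.lt_succ_sqrt' n
    simp only [Nat.succ_eq_add_one] at this
    nlinarith
  set k := n.sqrt
  have hk0 : (0 : ℝ) < k := by exact_mod_cast hk
  have hn0 : (0 : ℝ) < n := by exact_mod_cast hn
  have c1 : ((k : ℝ) ^ 2) ≤ n := by exact_mod_cast hkn
  have c2 : (n : ℝ) ≤ k ^ 2 + 2 * k := by exact_mod_cast hkn'
  have h3 := hu (k ^ 2) n hkn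
  push_cast at h3
  have h4 : |u n| ≤ |u (k ^ 2)| + K * (2 * k) := by
    have : |u n| ≤ |u (k ^ 2)| + |u n - u (k ^ 2)| := by
      have := abs_add_le (u (k ^ 2)) (u n - u (k ^ 2))
      simpa using this
    have h5 : K * ((n : ℝ) - k ^ 2) ≤ K * (2 * k) := mul_le_mul_of_nonneg_left (by linarith) hK
    linarith
  rw [Real.norm_eq_abs, abs_div, abs_of_pos hn0, abs_div, abs_of_pos (pow_pos hk0 2)]
  calc |u n| / n ≤ (|u (k ^ 2)| + K * (2 * k)) / k ^ 2 := by gcongr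
    _ = |u (k ^ 2)| / k ^ 2 + 2 * K / k := by field_simp

/-! ### A law of large numbers for the runs of a semi-MDP. -/

namespace SemiMDP

variable {M : Type} [Fintype M] [MeasurableSpace M] [DiscreteMeasurableSpace M] {Act : M → Type}

instance (D : SemiMDP M Act) (σ : ∀ m, Act m) (m₀ : M) :
    IsProbabilityMeasure (D.runMeasure σ m₀) := by
  unfold runMeasure
  infer_instance

/-- The partial sums of `f (ω i) (ω (i + 1))`. -/
abbrev stepSum (f : M → M → ℝ) (n : ℕ) (ω : ℕ → M) : ℝ :=
  ∑ i ∈ Finset.range n, f (ω i) (ω (i + 1))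

theorem measurable_step (f : M → M → ℝ) (i : ℕ) :
    Measurable fun ω : ℕ → M => f (ω i) (ω (i + 1)) :=
  Measurable.comp (f := fun ω : ℕ → M => (ω i, ω (i + 1))) (measurable_of_finite (Function.uncurry f))
    ((measurable_pi_apply i).prodMk (measurable_pi_apply (i + 1)))

theorem measurable_stepSum (f : M → M → ℝ) (n : ℕ) : Measurable (stepSum f n) :=
  Finset.measurable_sum _ fun i _ => measurable_step f i

omit [Fintype M] [MeasurableSpace M] [DiscreteMeasurableSpace M] in
theorem abs_stepSum_sub_le {f : M → M → ℝ} {K : ℝ} (hK : ∀ x y, |f x y| ≤ K) (ω : ℕ → M)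
    (m n : ℕ) (h : m ≤ n) : |stepSum f n ω - stepSum f m ω| ≤ K * (n - m : ℝ) := by
  rw [stepSum, stepSum, ← Finset.sum_Ico_eq_sub _ h]
  refine (Finset.abs_sum_le_sum_abs _ _).trans ((Finset.sum_le_card_nsmul _ _ K fun i _ =>
    hK _ _).trans ?_)
  rw [Nat.card_Ico, nsmul_eq_mul, Nat.cast_sub h, mul_comm]

omit [Fintype M] [MeasurableSpace M] [DiscreteMeasurableSpace M] in
theorem abs_stepSum_le {f : M → M → ℝ} {K : ℝ} (hK : ∀ x y, |f x y| ≤ K) (ω : ℕ → M)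
    (n : ℕ) : |stepSum f n ω| ≤ K * n := by
  simpa [stepSum] using abs_stepSum_sub_le hK ω 0 n (Nat.zero_le n)

/-- Disintegrating the run measure at time n, the inner integral over the next state is zero by
`hf`: the steps are martingale differences. -/
theorem integral_past_mul_step (D : SemiMDP M Act) (σ : ∀ m, Act m) (m₀ : M) {f : M → M → ℝ}
    (hf : ∀ x, ∑ y, D.Q x (σ x) y * f x y = 0) (n : ℕ) (G : ((_ : Finset.Iic n) → M) → ℝ) :
    ∫ ω, G (Preorder.frestrictLe n ω) * f (ω n) (ω (n + 1)) ∂D.runMeasure σ m₀ = 0 := by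
  have h := Kernel.partialTraj_compProd_eq_map_traj (X := fun _ => M) (κ := D.stepKernel σ)
    (Nat.zero_le n) (x₀ := fun _ => m₀)
  have h1 : ∫ ω, G (Preorder.frestrictLe n ω) * f (ω n) (ω (n + 1)) ∂D.runMeasure σ m₀ =
      ∫ z, G z.1 * f (z.1 ⟨n, by simp⟩) z.2 ∂(D.runMeasure σ m₀).map
        (fun x => (Preorder.frestrictLe n x, x (n + 1))) := by
    rw [integral_map]
    · rfl
    · exact ((Preorder.measurable_frestrictLe n).prodMk (measurable_pi_apply _)).aemeasurable
    · exact (measurable_of_finite _).aestronglyMeasurable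
  rw [h1, runMeasure, ← h, Measure.integral_compProd (Integrable.of_finite)]
  refine integral_eq_zero_of_ae (Eventually.of_forall fun x => ?_)
  have h2 : D.stepKernel σ n x = choiceLaw (D.Q (x ⟨n, by simp⟩) (σ (x ⟨n, by simp⟩))) := rfl
  simp only [h2, Pi.zero_apply]
  rw [integral_choiceLaw (D.distr _ _)]
  have h3 := hf (x ⟨n, by simp⟩)
  calc _ = G x * ∑ y, D.Q (x ⟨n, by simp⟩) (σ (x ⟨n, by simp⟩)) y * f (x ⟨n, by simp⟩) y := by
        rw [Finset.mul_sum]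
        exact Finset.sum_congr rfl fun y _ => by ring
    _ = 0 := by rw [h3, mul_zero]

theorem integral_stepSum_mul_step (D : SemiMDP M Act) (σ : ∀ m, Act m) (m₀ : M) {f : M → M → ℝ}
    (hf : ∀ x, ∑ y, D.Q x (σ x) y * f x y = 0) (n : ℕ) :
    ∫ ω, stepSum f n ω * f (ω n) (ω (n + 1)) ∂D.runMeasure σ m₀ = 0 := by
  -- The minima only keep the indices within the first n + 1 states; for i < n they change nothing.
  rw [← D.integral_past_mul_step σ m₀ hf n fun x => ∑ i ∈ Finset.range n,
    f (x ⟨min i n, by simp⟩) (x ⟨min (i + 1) n, by simp⟩)]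
  refine integral_congr_ae (Eventually.of_forall fun ω => ?_)
  simp only [stepSum]
  congr 1
  refine Finset.sum_congr rfl fun i hi => ?_
  have hi' := Finset.mem_range.1 hi
  simp only [Preorder.frestrictLe_apply]
  rw [min_eq_left hi'.le, min_eq_left (Nat.succ_le_of_lt hi')]

/-- Martingale differences are orthogonal, so the second moment grows by at most K² per step. -/
theorem integral_stepSum_sq_le (D : SemiMDP M Act) (σ : ∀ m, Act m) (m₀ : M) {f : M → M → ℝ}
    (hf : ∀ x, ∑ y, D.Q x (σ x) y * f x y = 0) {K : ℝ} (hK : ∀ x y, |f x y| ≤ K) (n : ℕ) :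
    ∫ ω, stepSum f n ω ^ 2 ∂D.runMeasure σ m₀ ≤ K ^ 2 * n := by
  have hint : ∀ (g : (ℕ → M) → ℝ) (B : ℝ), Measurable g → (∀ ω, |g ω| ≤ B) →
      Integrable g (D.runMeasure σ m₀) := fun g B hg hB =>
    Integrable.of_bound hg.aestronglyMeasurable B (Eventually.of_forall hB)
  have hsqK : ∀ x y, f x y ^ 2 ≤ K ^ 2 := fun x y => sq_le_sq' (abs_le.1 (hK x y)).1 (abs_le.1 (hK x y)).2
  have hS : ∀ n, Integrable (fun ω => stepSum f n ω ^ 2) (D.runMeasure σ m₀) := fun n =>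
    hint _ ((K * n) ^ 2) ((measurable_stepSum f n).pow_const 2) fun ω => by
      rw [abs_pow]
      exact pow_le_pow_left₀ (abs_nonneg _) (abs_stepSum_le hK ω n) 2
  induction n with
  | zero => simp [stepSum]
  | succ n ih =>
    have h1 : ∀ ω : ℕ → M, stepSum f (n + 1) ω ^ 2 = stepSum f n ω ^ 2 +
        2 * (stepSum f n ω * f (ω n) (ω (n + 1))) + f (ω n) (ω (n + 1)) ^ 2 := by
      intro ω
      simp only [stepSum, Finset.sum_range_succ]
      ring
    have i2 : Integrable (fun ω => f (ω n) (ω (n + 1)) ^ 2) (D.runMeasure σ m₀) :=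
      hint _ (K ^ 2) ((measurable_step f n).pow_const 2) fun ω => by
        rw [abs_of_nonneg (sq_nonneg _)]
        exact hsqK _ _
    have i3 : Integrable (fun ω => stepSum f n ω * f (ω n) (ω (n + 1))) (D.runMeasure σ m₀) :=
      hint _ (K * n * K) ((measurable_stepSum f n).mul (measurable_step f n)) fun ω => by
        rw [abs_mul]
        exact mul_le_mul (abs_stepSum_le hK ω n) (hK _ _) (abs_nonneg _)
          ((abs_nonneg _).trans (abs_stepSum_le hK ω n))
    have i23 : Integrable (fun ω => stepSum f n ω ^ 2 +
        2 * (stepSum f n ω * f (ω n) (ω (n + 1)))) (D.runMeasure σ m₀) :=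
      (hS n).add (i3.const_mul 2)
    simp only [h1]
    rw [integral_add i23 i2, integral_add (hS n) (i3.const_mul 2),
      integral_const_mul, D.integral_stepSum_mul_step σ m₀ hf n]
    have h4 : ∫ ω, f (ω n) (ω (n + 1)) ^ 2 ∂D.runMeasure σ m₀ ≤ K ^ 2 := by
      have := integral_mono i2 (integrable_const (K ^ 2)) (fun ω => hsqK (ω n) (ω (n + 1)))
      simpa using this
    push_cast
    linarith

/-- Strong law of large numbers for bounded martingale differences along the runs. -/
theorem ae_tendsto_stepSum_div (D : SemiMDP M Act) (σ : ∀ m, Act m) (m₀ : M) {f : M → M → ℝ}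
    (hf : ∀ x, ∑ y, D.Q x (σ x) y * f x y = 0) :
    ∀ᵐ ω ∂D.runMeasure σ m₀, Tendsto (fun n : ℕ => stepSum f n ω / n) atTop (nhds 0) := by
  obtain ⟨K, hK⟩ : ∃ K, ∀ x y, |f x y| ≤ K := by
    refine ⟨∑ x, ∑ y, |f x y|, fun x y => ?_⟩
    exact (Finset.single_le_sum (f := fun y => |f x y|) (fun _ _ => abs_nonneg _)
      (Finset.mem_univ y)).trans (Finset.single_le_sum (f := fun x => ∑ y, |f x y|)
        (fun _ _ => Finset.sum_nonneg fun _ _ => abs_nonneg _) (Finset.mem_univ x))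
  -- Along the squares the averages have second moments at most K²/(k + 1)², which are summable, so
  -- almost surely these averages tend to 0. The shift by one avoids division by zero.
  set u : ℕ → (ℕ → M) → ℝ≥0∞ := fun k ω =>
    ENNReal.ofReal ((stepSum f ((k + 1) ^ 2) ω / ((k + 1 : ℕ) ^ 2 : ℝ)) ^ 2) with hu
  have hmeas : ∀ k, Measurable (u k) := fun k =>
    (((measurable_stepSum f _).div_const _).pow_const 2).ennreal_ofReal
  have hle : ∀ k, ∫⁻ ω, u k ω ∂D.runMeasure σ m₀ ≤
      ENNReal.ofReal (K ^ 2 * (1 / ((k + 1 : ℕ) : ℝ) ^ 2)) := by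
    intro k
    have hi : Integrable (fun ω => (stepSum f ((k + 1) ^ 2) ω / ((k + 1 : ℕ) ^ 2 : ℝ)) ^ 2)
        (D.runMeasure σ m₀) := by
      refine Integrable.of_bound (((measurable_stepSum f _).div_const _).pow_const
        2).aestronglyMeasurable (K ^ 2) (Eventually.of_forall fun ω => ?_)
      rw [Real.norm_eq_abs, abs_pow]
      refine pow_le_pow_left₀ (abs_nonneg _) ?_ 2
      rw [abs_div, abs_of_pos (by positivity : (0 : ℝ) < ((k + 1 : ℕ) ^ 2 : ℝ)),
        div_le_iff₀ (by positivity)]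
      have := abs_stepSum_le hK ω ((k + 1) ^ 2)
      push_cast at this ⊢
      exact this
    rw [← ofReal_integral_eq_lintegral_ofReal hi (Eventually.of_forall fun _ => sq_nonneg _)]
    refine ENNReal.ofReal_le_ofReal ?_
    simp only [div_pow]
    rw [integral_div, div_le_iff₀ (by positivity)]
    refine (D.integral_stepSum_sq_le σ m₀ hf hK _).trans (le_of_eq ?_)
    push_cast
    field_simp
  have hsum : ∫⁻ ω, ∑' k, u k ω ∂D.runMeasure σ m₀ ≠ ∞ := by
    rw [lintegral_tsum fun k => (hmeas k).aemeasurable]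
    have hs : Summable fun k : ℕ => K ^ 2 * (1 / ((k + 1 : ℕ) : ℝ) ^ 2) :=
      ((summable_nat_add_iff 1 (f := fun k : ℕ => 1 / (k : ℝ) ^ 2)).2
        (Real.summable_one_div_nat_pow.2 (by norm_num))).mul_left _
    exact ne_top_of_le_ne_top hs.tsum_ofReal_ne_top (ENNReal.tsum_le_tsum hle)
  have hae := ae_lt_top (Measurable.tsum hmeas) hsum
  filter_upwards [hae] with ω hω
  have h0 : Tendsto (fun k => u k ω) atTop (nhds 0) := ENNReal.tendsto_atTop_zero_of_tsum_ne_top hω.ne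
  have h1 : Tendsto (fun k : ℕ => (stepSum f ((k + 1) ^ 2) ω / ((k + 1 : ℕ) ^ 2 : ℝ)) ^ 2) atTop
      (nhds 0) := by
    have := (ENNReal.tendsto_toReal (ENNReal.zero_ne_top)).comp h0
    simpa [hu, Function.comp_def, ENNReal.toReal_ofReal, sq_nonneg] using this
  have h2 : Tendsto (fun k : ℕ => stepSum f ((k + 1) ^ 2) ω / ((k + 1 : ℕ) ^ 2 : ℝ)) atTop
      (nhds 0) := by
    have := h1.sqrt
    simp only [Real.sqrt_sq_eq_abs, Real.sqrt_zero] at this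
    exact (tendsto_zero_iff_abs_tendsto_zero _).2 this
  exact tendsto_div_natCast_of_sq (u := fun n => stepSum f n ω) (abs_stepSum_sub_le hK ω)
    ((tendsto_add_atTop_iff_nat 1).1 h2)

/-! ### From the Poisson equation to the mean-payoff. -/

variable [Nonempty M]

/-- Along almost every run, the ratio of cost and time exceeds `g` up to a vanishing error. -/
theorem ae_ratio_bound (D : SemiMDP M Act) (σ : ∀ m, Act m) (m₀ : M)
    (ht : ∀ m, 0 < D.t m (σ m)) (h : M → ℝ) :
    ∀ᵐ ω ∂D.runMeasure σ m₀, ∃ e : ℕ → ℝ, Tendsto e atTop (nhds 0) ∧ ∀ n,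
      |(∑ i ∈ Finset.range (n + 1), (h (ω i) - ∑ y, D.Q (ω i) (σ (ω i)) y * h y)) /
        (∑ i ∈ Finset.range (n + 1), D.t (ω i) (σ (ω i)))| ≤ e n := by
  set f : M → M → ℝ := fun x y => h y - ∑ z, D.Q x (σ x) z * h z with hfdef
  have hf : ∀ x, ∑ y, D.Q x (σ x) y * f x y = 0 := by
    intro x
    simp only [hfdef, mul_sub, Finset.sum_sub_distrib]
    rw [← Finset.sum_mul, (D.distr x (σ x)).2, one_mul, sub_self]
  obtain ⟨x₀, hx₀⟩ := Finite.exists_min fun m => D.t m (σ m)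
  set τ := D.t x₀ (σ x₀) with hτ
  have hτ0 : 0 < τ := ht x₀
  set H := ∑ m, |h m| with hH
  have hHm : ∀ m, |h m| ≤ H := fun m => Finset.single_le_sum (f := fun m => |h m|)
    (fun _ _ => abs_nonneg _) (Finset.mem_univ m)
  filter_upwards [D.ae_tendsto_stepSum_div σ m₀ hf] with ω hω
  -- The sum of h - Πh along the run telescopes to h(ω₀) - h(ω_{n+1}) plus the martingale, hence is
  -- at most 2H plus the martingale in absolute value; the elapsed time is at least (n + 1)τ.
  refine ⟨fun n => (2 * H / ((n + 1 : ℕ) : ℝ) + |stepSum f (n + 1) ω / ((n + 1 : ℕ) : ℝ)|) / τ, ?_, ?_⟩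
  · have a := (tendsto_add_atTop_iff_nat 1).2 (tendsto_const_div_atTop_nhds_zero_nat (2 * H))
    have b := ((tendsto_add_atTop_iff_nat 1).2 hω).abs
    simpa using (a.add b).div_const τ
  · intro n
    have hn : (0 : ℝ) < ((n + 1 : ℕ) : ℝ) := by positivity
    have hT : ((n + 1 : ℕ) : ℝ) * τ ≤ ∑ i ∈ Finset.range (n + 1), D.t (ω i) (σ (ω i)) := by
      have := Finset.card_nsmul_le_sum (Finset.range (n + 1)) (fun i => D.t (ω i) (σ (ω i))) τ
        fun i _ => hx₀ _
      simpa using this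
    have hsum : ∑ i ∈ Finset.range (n + 1), (h (ω i) - ∑ y, D.Q (ω i) (σ (ω i)) y * h y) =
        h (ω 0) - h (ω (n + 1)) + stepSum f (n + 1) ω := by
      have := Finset.sum_range_sub' (fun i => h (ω i)) (n + 1)
      rw [← this, stepSum, ← Finset.sum_add_distrib]
      exact Finset.sum_congr rfl fun i _ => by simp only [hfdef]; ring
    have hT0 : 0 < ∑ i ∈ Finset.range (n + 1), D.t (ω i) (σ (ω i)) :=
      lt_of_lt_of_le (by positivity) hT
    beta_reduce
    rw [hsum, abs_div, abs_of_pos hT0, abs_div, abs_of_pos hn, ← add_div, div_div]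
    have hnum : |h (ω 0) - h (ω (n + 1)) + stepSum f (n + 1) ω| ≤ 2 * H + |stepSum f (n + 1) ω| := by
      refine (abs_add_le _ _).trans (add_le_add_left ?_ _)
      exact (abs_sub _ _).trans (by linarith [hHm (ω 0), hHm (ω (n + 1))])
    exact div_le_div₀ (by positivity) hnum (by positivity) hT

/-- Summing the inequality along a run bounds the cost below by g times the elapsed time plus the
sum of h - Πh, and the latter is negligible compared with the time. -/
theorem ofReal_le_expMP (D : SemiMDP M Act) (σ : ∀ m, Act m) (m₀ : M)
    (ht : ∀ m, 0 < D.t m (σ m)) {g : ℝ} {h : M → ℝ}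
    (hg : ∀ m, h m ≤ D.c m (σ m) - g * D.t m (σ m) + ∑ y, D.Q m (σ m) y * h y) :
    ENNReal.ofReal g ≤ D.expMP σ m₀ := by
  have hae : ∀ᵐ ω ∂D.runMeasure σ m₀, ENNReal.ofReal g ≤ D.meanPayoff σ ω := by
    filter_upwards [D.ae_ratio_bound σ m₀ ht h] with ω ⟨e, he, hb⟩
    have hlim : Tendsto (fun n => ENNReal.ofReal (g - e n)) atTop (nhds (ENNReal.ofReal g)) := by
      have : Tendsto (fun n => g - e n) atTop (nhds (g - 0)) := tendsto_const_nhds.sub he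
      rw [sub_zero] at this
      exact ENNReal.tendsto_ofReal this
    rw [← hlim.limsup_eq]
    refine limsup_le_limsup (Eventually.of_forall fun n => ?_)
    have hT0 : 0 < ∑ i ∈ Finset.range (n + 1), D.t (ω i) (σ (ω i)) :=
      Finset.sum_pos (fun i _ => ht _) (by simp)
    simp only
    rw [← ENNReal.ofReal_div_of_pos hT0]
    refine ENNReal.ofReal_le_ofReal ?_
    have h1 := (abs_le.1 (hb n)).1
    have h2 : g + (∑ i ∈ Finset.range (n + 1), (h (ω i) - ∑ y, D.Q (ω i) (σ (ω i)) y * h y)) /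
        (∑ i ∈ Finset.range (n + 1), D.t (ω i) (σ (ω i))) ≤
        (∑ i ∈ Finset.range (n + 1), D.c (ω i) (σ (ω i))) /
        (∑ i ∈ Finset.range (n + 1), D.t (ω i) (σ (ω i))) := by
      rw [le_div_iff₀ hT0, add_mul, div_mul_cancel₀ _ hT0.ne', Finset.mul_sum,
        ← Finset.sum_add_distrib]
      exact Finset.sum_le_sum fun i _ => by linarith [hg (ω i)]
    linarith
  calc ENNReal.ofReal g = ∫⁻ _, ENNReal.ofReal g ∂D.runMeasure σ m₀ := by simp
    _ ≤ D.expMP σ m₀ := lintegral_mono_ae hae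

/-- With equality in place of the inequality, cost divided by time converges to g almost surely. -/
theorem expMP_eq_ofReal (D : SemiMDP M Act) (σ : ∀ m, Act m) (m₀ : M)
    (ht : ∀ m, 0 < D.t m (σ m)) {g : ℝ} {h : M → ℝ}
    (hg : ∀ m, h m = D.c m (σ m) - g * D.t m (σ m) + ∑ y, D.Q m (σ m) y * h y) :
    D.expMP σ m₀ = ENNReal.ofReal g := by
  have hae : ∀ᵐ ω ∂D.runMeasure σ m₀, D.meanPayoff σ ω = ENNReal.ofReal g := by
    filter_upwards [D.ae_ratio_bound σ m₀ ht h] with ω ⟨e, he, hb⟩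
    refine Tendsto.limsup_eq ?_
    have hT0 : ∀ n, 0 < ∑ i ∈ Finset.range (n + 1), D.t (ω i) (σ (ω i)) := fun n =>
      Finset.sum_pos (fun i _ => ht _) (by simp)
    simp only [← ENNReal.ofReal_div_of_pos (hT0 _)]
    refine ENNReal.tendsto_ofReal ?_
    rw [tendsto_iff_norm_sub_tendsto_zero]
    refine squeeze_zero (fun _ => norm_nonneg _) (fun n => ?_) he
    refine le_trans (le_of_eq ?_) (hb n)
    rw [Real.norm_eq_abs]
    congr 1
    rw [eq_div_iff (hT0 n).ne', sub_mul, div_mul_cancel₀ _ (hT0 n).ne', Finset.mul_sum,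
      ← Finset.sum_sub_distrib]
    exact Finset.sum_congr rfl fun i _ => by linarith [hg (ω i)]
  rw [expMP, lintegral_congr_ae hae]
  simp

end SemiMDP

/-! ## Policy evaluation and policy improvement for irreducible chains -/

section Poisson

variable {M 𝕜 : Type*} [Fintype M] [Field 𝕜] [LinearOrder 𝕜] [IsStrictOrderedRing 𝕜]

/-- At a minimum of u, the average of u is at least u. -/
theorem exists_nonpos_of_add_average_le [Nonempty M] {Q : M → M → 𝕜} (hQ : ∀ x y, 0 ≤ Q x y)
    (hQ1 : ∀ x, ∑ y, Q x y = 1) {u b : M → 𝕜} (h : ∀ x, b x + ∑ y, Q x y * u y ≤ u x) :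
    ∃ x, b x ≤ 0 := by
  obtain ⟨x, hx⟩ := Finite.exists_min u
  refine ⟨x, ?_⟩
  have : u x ≤ ∑ y, Q x y * u y := by
    calc u x = ∑ y, Q x y * u x := by rw [← Finset.sum_mul, hQ1, one_mul]
      _ ≤ _ := Finset.sum_le_sum fun y _ => mul_le_mul_of_nonneg_left (hx y) (hQ x y)
  linarith [h x]

/-- Minimum principle: where u is minimal and dominates its average, it is minimal at all successors
too, and irreducibility spreads this to every state. -/
theorem eq_of_average_le [Nonempty M] {Q : M → M → 𝕜} (hQ : ∀ x y, 0 ≤ Q x y)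
    (hQ1 : ∀ x, ∑ y, Q x y = 1)
    (hirr : ∀ x y, Relation.ReflTransGen (fun x y => 0 < Q x y) x y)
    {u : M → 𝕜} (h : ∀ x, ∑ y, Q x y * u y ≤ u x) (x y : M) : u x = u y := by
  obtain ⟨z, hz⟩ := Finite.exists_min u
  have key : ∀ w, u w = u z := by
    intro w
    induction hirr z w with
    | refl => rfl
    | @tail a b _ hab ih =>
      by_contra hne
      have hlt : u z < u b := lt_of_le_of_ne (hz b) (Ne.symm hne)
      have : u z < ∑ y, Q a y * u y := by
        calc u z = ∑ y, Q a y * u z := by rw [← Finset.sum_mul, hQ1, one_mul]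
          _ < _ := Finset.sum_lt_sum (fun y _ => mul_le_mul_of_nonneg_left (hz y) (hQ a y))
            ⟨b, Finset.mem_univ b, mul_lt_mul_of_pos_left hlt hab⟩
      linarith [h a]
  rw [key x, key y]

/-- The linear map (h, g) ↦ (h - Qh + gt, h(s₀)) has trivial kernel, hence is onto. The argument
works over any ordered field, so rational data have a rational gain and bias. -/
theorem exists_poisson_solution {Q : M → M → 𝕜} (hQ : ∀ x y, 0 ≤ Q x y)
    (hQ1 : ∀ x, ∑ y, Q x y = 1)
    (hirr : ∀ x y, Relation.ReflTransGen (fun x y => 0 < Q x y) x y)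
    {t : M → 𝕜} (ht : ∀ x, 0 < t x) (c : M → 𝕜) (s₀ : M) :
    ∃ (g : 𝕜) (h : M → 𝕜), h s₀ = 0 ∧ ∀ x, h x = c x - g * t x + ∑ y, Q x y * h y := by
  have : Nonempty M := ⟨s₀⟩
  let L : ((M → 𝕜) × 𝕜) →ₗ[𝕜] ((M → 𝕜) × 𝕜) :=
    { toFun := fun p => (fun x => p.1 x - ∑ y, Q x y * p.1 y + p.2 * t x, p.1 s₀)
      map_add' := by
        intro p q
        ext x
        · simp only [Prod.fst_add, Prod.snd_add, Pi.add_apply, mul_add, Finset.sum_add_distrib]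
          ring
        · simp
      map_smul' := by
        intro r p
        ext x
        · simp only [Prod.smul_fst, Prod.smul_snd, Pi.smul_apply, smul_eq_mul, RingHom.id_apply,
            mul_left_comm _ r, ← Finset.mul_sum]
          ring
        · simp }
  -- In the kernel -h is its own average plus gt; at a minimum of -h this forces g ≤ 0. Applied to
  -- -p as well, it gives g = 0.
  have hker : ∀ p : (M → 𝕜) × 𝕜, L p = 0 → p.2 ≤ 0 := by
    intro p hp
    have h1 : ∀ x, p.1 x - ∑ y, Q x y * p.1 y + p.2 * t x = 0 := fun x =>
      congrFun (congrArg Prod.fst hp) x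
    obtain ⟨x, hx⟩ := exists_nonpos_of_add_average_le hQ hQ1 (u := fun y => - p.1 y)
      (b := fun x => p.2 * t x) (fun x => by
        simp only [mul_neg, Finset.sum_neg_distrib]
        linarith [h1 x])
    by_contra hlt
    exact absurd hx (not_le.2 (mul_pos (not_le.1 hlt) (ht x)))
  have hinj : Function.Injective L := by
    rw [← LinearMap.ker_eq_bot, LinearMap.ker_eq_bot']
    intro p hp
    have h2 : p.2 = 0 := le_antisymm (hker p hp) (by
      have := hker (-p) (by rw [map_neg, hp, neg_zero])
      simpa using this)
    have h1 : ∀ x, p.1 x - ∑ y, Q x y * p.1 y + p.2 * t x = 0 := fun x =>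
      congrFun (congrArg Prod.fst hp) x
    have h0 : p.1 s₀ = 0 := congrArg Prod.snd hp
    have h3 := eq_of_average_le hQ hQ1 hirr (u := p.1) fun x => by
      have := h1 x
      rw [h2] at this
      linarith
    ext x
    · simpa [h0] using h3 x s₀
    · simpa using h2
  obtain ⟨p, hp⟩ := (LinearMap.injective_iff_surjective.1 hinj) (c, 0)
  refine ⟨p.2, p.1, congrArg Prod.snd hp, fun x => ?_⟩
  have : p.1 x - ∑ y, Q x y * p.1 y + p.2 * t x = c x := congrFun (congrArg Prod.fst hp) x
  linarith

/-- Strict policy improvement strictly decreases the gain. -/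
theorem gain_lt_of_improvement [Nonempty M] {Q : M → M → 𝕜} (hQ : ∀ x y, 0 ≤ Q x y)
    (hQ1 : ∀ x, ∑ y, Q x y = 1)
    (hirr : ∀ x y, Relation.ReflTransGen (fun x y => 0 < Q x y) x y)
    {t : M → 𝕜} (ht : ∀ x, 0 < t x) {c : M → 𝕜} {g g' : 𝕜} {h h' : M → 𝕜}
    (h1 : ∀ x, h' x = c x - g' * t x + ∑ y, Q x y * h' y)
    (h2 : ∀ x, c x - g * t x + ∑ y, Q x y * h y ≤ h x)
    (h3 : ∃ x, c x - g * t x + ∑ y, Q x y * h y < h x) : g' < g := by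
  have h4 : ∀ x, ∑ y, Q x y * (h y - h' y) = ∑ y, Q x y * h y - ∑ y, Q x y * h' y := fun x => by
    simp only [mul_sub, Finset.sum_sub_distrib]
  have hle : g' ≤ g := by
    obtain ⟨x, hx⟩ := exists_nonpos_of_add_average_le hQ hQ1 (u := fun y => h y - h' y)
      (b := fun x => (g' - g) * t x) (fun x => by rw [h4]; linarith [h1 x, h2 x])
    by_contra hlt
    exact absurd hx (not_le.2 (mul_pos (sub_pos.2 (not_le.1 hlt)) (ht x)))
  -- If the gains agree, h - h' dominates its average and so is constant; then no state can improve
  -- strictly.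
  refine lt_of_le_of_ne hle fun heq => ?_
  subst heq
  have h5 := eq_of_average_le hQ hQ1 hirr (u := fun y => h y - h' y) fun x => by
    rw [h4]; linarith [h1 x, h2 x]
  obtain ⟨x, hx⟩ := h3
  have h6 : ∑ y, Q x y * (h y - h' y) = h x - h' x := by
    simp only [fun y => h5 y x]
    rw [← Finset.sum_mul, hQ1, one_mul]
  rw [h4] at h6
  linarith [h1 x]

theorem gain_nonneg [Nonempty M] {Q : M → M → 𝕜} (hQ : ∀ x y, 0 ≤ Q x y)
    (hQ1 : ∀ x, ∑ y, Q x y = 1) {t : M → 𝕜} (ht : ∀ x, 0 < t x) {c : M → 𝕜} (hc : ∀ x, 0 ≤ c x)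
    {g : 𝕜} {h : M → 𝕜} (h1 : ∀ x, h x = c x - g * t x + ∑ y, Q x y * h y) : 0 ≤ g := by
  obtain ⟨x, hx⟩ := exists_nonpos_of_add_average_le hQ hQ1 (u := h) (b := fun x => -g * t x)
    (fun x => by linarith [h1 x, hc x])
  by_contra hlt
  exact absurd hx (not_le.2 (mul_pos (neg_pos.2 (not_le.1 hlt)) (ht x)))

end Poisson

/-! ## The support of the distribution of the next regenerative state -/

theorem Relation.ReflTransGen.exists_path {α : Type*} {r : α → α → Prop} {a b : α}
    (h : Relation.ReflTransGen r a b) :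
    ∃ (n : ℕ) (p : ℕ → α), p 0 = a ∧ p n = b ∧ ∀ i < n, r (p i) (p (i + 1)) := by
  induction h with
  | refl => exact ⟨0, fun _ => a, rfl, rfl, by simp⟩
  | @tail b c _ hbc ih =>
    obtain ⟨n, p, h0, hn, hp⟩ := ih
    refine ⟨n + 1, fun i => if i ≤ n then p i else c, by simp [h0], by simp, fun i hi => ?_⟩
    rcases Nat.lt_succ_iff_lt_or_eq.1 hi with h | rfl
    · simpa [h.le, Nat.succ_le_of_lt h] using hp i h
    · simpa [hn] using hbc

theorem choiceLaw_apply {M : Type} [Fintype M] [MeasurableSpace M] [DiscreteMeasurableSpace M]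
    (p : M → ℝ) (B : Set M) :
    choiceLaw p B = ∑ m, ENNReal.ofReal (p m) * B.indicator 1 m := by
  simp [choiceLaw, Measure.finsetSum_apply]

theorem choiceLaw_singleton_pos {M : Type} [Fintype M] [MeasurableSpace M]
    [DiscreteMeasurableSpace M] {p : M → ℝ} {m : M} (hm : 0 < p m) : 0 < choiceLaw p {m} := by
  rw [choiceLaw_apply]
  refine lt_of_lt_of_le ?_ (Finset.single_le_sum (f := fun m' => ENNReal.ofReal (p m') *
    ({m} : Set M).indicator 1 m') (fun _ _ => zero_le) (Finset.mem_univ m))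
  simpa using hm

theorem choiceLaw_nonpos_eq_zero {M : Type} [Fintype M] [MeasurableSpace M]
    [DiscreteMeasurableSpace M] (p : M → ℝ) : choiceLaw p {m | ¬ 0 < p m} = 0 := by
  rw [choiceLaw_apply]
  refine Finset.sum_eq_zero fun m _ => ?_
  by_cases h : 0 < p m
  · simp [h]
  · rw [ENNReal.ofReal_of_nonpos (not_lt.1 h), zero_mul]

theorem expMeasure_Ioo_pos {r : ℝ} (hr : 0 < r) {a b : ℝ} (ha : 0 ≤ a) (hab : a < b) :
    0 < expMeasure r (Set.Ioo a b) := by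
  have h : expMeasure r = volume.withDensity (exponentialPDF r) := rfl
  have hm : Measurable (exponentialPDF r) := (measurable_exponentialPDFReal r).ennreal_ofReal
  rw [h, withDensity_apply _ measurableSet_Ioo, setLIntegral_pos_iff hm]
  have : Function.support (exponentialPDF r) ∩ Set.Ioo a b = Set.Ioo a b := by
    refine Set.inter_eq_right.2 fun x hx => ?_
    simp only [Function.mem_support, exponentialPDF]
    exact (ENNReal.ofReal_pos.2 (exponentialPDFReal_pos hr (ha.trans_lt hx.1))).ne'
  rw [this]
  simpa using hab

/-- The positive half-line is the union of the intervals (1/(m + 1), m + 1], so they cannot all be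
null. -/
theorem exists_Ioc_pos {μ : Measure ℝ} [IsProbabilityMeasure μ] (h : μ (Set.Iic 0) = 0) :
    ∃ c B : ℝ, 0 < c ∧ 0 < B ∧ 0 < μ (Set.Ioc c B) := by
  by_contra hcon
  push Not at hcon
  have hz : ∀ m : ℕ, μ (Set.Ioc (1 / ((m : ℝ) + 1)) (m + 1)) = 0 := fun m =>
    le_antisymm (hcon _ _ (by positivity) (by positivity)) zero_le
  have hun : (Set.univ : Set ℝ) ⊆
      Set.Iic 0 ∪ ⋃ m : ℕ, Set.Ioc (1 / ((m : ℝ) + 1)) (m + 1) := by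
    intro x _
    by_cases hx : x ≤ 0
    · exact Or.inl hx
    · right
      push Not at hx
      obtain ⟨m₁, hm₁⟩ := exists_nat_one_div_lt hx
      obtain ⟨m₂, hm₂⟩ := exists_nat_ge x
      refine Set.mem_iUnion.2 ⟨max m₁ m₂, ?_, ?_⟩
      · refine lt_of_le_of_lt ?_ hm₁
        gcongr
        exact le_max_left _ _
      · have : (m₂ : ℝ) ≤ (max m₁ m₂ : ℕ) := by exact_mod_cast le_max_right _ _
        linarith
  have := measure_mono_null hun (measure_union_null h (measure_iUnion_null hz))
  simp at this

/-! ### Cycle probabilities are positive exactly along paths of the transition graph. -/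

namespace ACTMC

variable {S A : Type} [Fintype S] [Fintype A] [MeasurableSpace S] [DiscreteMeasurableSpace S]

/-- From `r`, the state `w` can be the state of the next regenerative configuration: it is entered
from a state `v` that is reached from `r` by delay transitions while the alarm stays enabled. -/
def CycleReach (X : ACTMC S A) (r w : S) : Prop :=
  ∃ a v, X.alarm r = some a ∧
    Relation.ReflTransGen (fun v v' => 0 < X.P v v' ∧ X.alarm v' = some a) r v ∧
    (0 < X.Pa a v w ∨ (0 < X.P v w ∧ X.alarm w ≠ some a))

instance (X : ACTMC S A) : IsProbabilityMeasure (expMeasure X.rate) :=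
  isProbabilityMeasure_expMeasure X.rate_pos

instance (X : ACTMC S A) (s : S) : IsProbabilityMeasure (choiceLaw (X.P s)) :=
  (X.P_distr s).isProbabilityMeasure

instance (X : ACTMC S A) (s : S) : IsProbabilityMeasure (X.alarmLaw s) := by
  unfold alarmLaw
  cases X.alarm s with
  | none => exact inferInstance
  | some a => exact (X.Pa_distr a s).isProbabilityMeasure

instance (X : ACTMC S A) (a : A) : IsProbabilityMeasure (X.law a) := X.law_prob a

instance (X : ACTMC S A) : IsProbabilityMeasure X.noiseLaw := by
  unfold noiseLaw
  infer_instance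

instance (X : ACTMC S A) : IsProbabilityMeasure X.pathLaw := by
  unfold pathLaw
  infer_instance

theorem noiseLaw_delay (X : ACTMC S A) (T : Set ℝ) (v : S) (B : Set S) :
    X.noiseLaw {z | z.1 ∈ T ∧ z.2.1 v ∈ B} = expMeasure X.rate T * choiceLaw (X.P v) B := by
  have : {z : Noise S A | z.1 ∈ T ∧ z.2.1 v ∈ B} =
      T ×ˢ ((Function.eval v ⁻¹' B) ×ˢ Set.univ) := by
    ext z; simp
  rw [this, noiseLaw, Measure.prod_prod, Measure.prod_prod, measure_univ, mul_one,
    (measurePreserving_eval (fun s => choiceLaw (X.P s)) v).measure_preimage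
      (MeasurableSet.of_discrete).nullMeasurableSet]

theorem noiseLaw_alarm (X : ACTMC S A) (T : Set ℝ) (v : S) (B : Set S) :
    X.noiseLaw {z | z.1 ∈ T ∧ z.2.2.1 v ∈ B} = expMeasure X.rate T * X.alarmLaw v B := by
  have : {z : Noise S A | z.1 ∈ T ∧ z.2.2.1 v ∈ B} =
      T ×ˢ (Set.univ ×ˢ ((Function.eval v ⁻¹' B) ×ˢ Set.univ)) := by
    ext z; simp
  rw [this, noiseLaw, Measure.prod_prod, Measure.prod_prod, Measure.prod_prod, measure_univ,
    measure_univ, mul_one, one_mul,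
    (measurePreserving_eval X.alarmLaw v).measure_preimage
      (MeasurableSet.of_discrete).nullMeasurableSet]

omit [DiscreteMeasurableSpace S] in
theorem noiseLaw_timer (X : ACTMC S A) (a : A) {T : Set ℝ} (hT : MeasurableSet T) :
    X.noiseLaw {z | z.2.2.2 a ∈ T} = X.law a T := by
  have : {z : Noise S A | z.2.2.2 a ∈ T} =
      Set.univ ×ˢ (Set.univ ×ˢ (Set.univ ×ˢ (Function.eval a ⁻¹' T))) := by
    ext z; simp
  rw [this, noiseLaw, Measure.prod_prod, Measure.prod_prod, Measure.prod_prod, measure_univ,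
    measure_univ, measure_univ, one_mul, one_mul, one_mul,
    (measurePreserving_eval X.law a).measure_preimage hT.nullMeasurableSet]

omit [Fintype A] [DiscreteMeasurableSpace S] in
theorem alarmLaw_of_some (X : ACTMC S A) {s : S} {a : A} (h : X.alarm s = some a) :
    X.alarmLaw s = choiceLaw (X.Pa a s) := by
  unfold alarmLaw
  rw [h]

/-- A null successor is drawn with probability zero, and only countably many draws are involved. -/
theorem ae_transition_pos (X : ACTMC S A) : ∀ᵐ ω ∂X.pathLaw, ∀ n s,
    0 < X.P s ((ω n).2.1 s) ∧ ∀ a, X.alarm s = some a → 0 < X.Pa a s ((ω n).2.2.1 s) := by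
  rw [ae_all_iff]
  intro n
  have hmp := measurePreserving_eval_infinitePi (fun _ : ℕ => X.noiseLaw) n
  refine hmp.quasiMeasurePreserving.ae (p := fun z : Noise S A => ∀ s, 0 < X.P s (z.2.1 s) ∧
    ∀ a, X.alarm s = some a → 0 < X.Pa a s (z.2.2.1 s)) ?_
  rw [ae_all_iff]
  intro s
  refine Eventually.and ?_ ?_
  · have := X.noiseLaw_delay Set.univ s {m | ¬ 0 < X.P s m}
    rw [choiceLaw_nonpos_eq_zero, mul_zero] at this
    rw [ae_iff]
    simpa using this
  · rw [ae_all_iff]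
    intro a
    by_cases ha : X.alarm s = some a
    · have := X.noiseLaw_alarm Set.univ s {m | ¬ 0 < X.Pa a s m}
      rw [X.alarmLaw_of_some ha, choiceLaw_nonpos_eq_zero, mul_zero] at this
      rw [ae_iff]
      simpa [ha] using this
    · exact Eventually.of_forall fun z h => absurd h ha

/-- Almost surely all drawn transitions have positive probability. Before the first renewal no alarm
rings and the enabled alarm does not change, so the visited states form a delay path; the renewing
step is an alarm transition or a delay leaving the states of that alarm. -/
theorem cycleReach_of_cycleProb_pos (X : ACTMC S A) {r w : S} {a : A} (hr : X.alarm r = some a)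
    (h : 0 < X.cycleProb r w) : X.CycleReach r w := by
  by_contra hcon
  refine h.ne' ?_
  unfold cycleProb
  rw [ENNReal.toReal_eq_zero_iff]
  left
  have hae := X.ae_transition_pos
  rw [ae_iff] at hae
  refine measure_mono_null ?_ hae
  rintro ω ⟨j, hnot, hren, hw⟩ hgood
  refine hcon ?_
  have hpath : ∀ i ≤ j, X.alarm (X.conf r ω i).1 = some a ∧
      Relation.ReflTransGen (fun v v' => 0 < X.P v v' ∧ X.alarm v' = some a) r
        (X.conf r ω i).1 := by
    intro i
    induction i with
    | zero => exact fun _ => ⟨hr, Relation.ReflTransGen.refl⟩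
    | succ i ih =>
      intro hi
      obtain ⟨h1, h2⟩ := ih (by omega)
      have h3 := hnot i (by omega)
      simp only [renews, not_or, not_not] at h3
      obtain ⟨h4, h5, h6⟩ := h3
      have h7 : (X.conf r ω (i + 1)).1 = nextState (X.conf r ω i) (ω (i + 1)) := rfl
      have h8 : X.alarm (X.conf r ω (i + 1)).1 = some a := by rw [h7, h6, h1]
      refine ⟨h8, h2.tail ⟨?_, h8⟩⟩
      rw [h7, nextState, if_neg h4]
      exact (hgood _ _).1
  obtain ⟨h1, h2⟩ := hpath j le_rfl
  refine ⟨a, (X.conf r ω j).1, hr, h2, ?_⟩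
  have h7 : (X.conf r ω (j + 1)).1 = nextState (X.conf r ω j) (ω (j + 1)) := rfl
  rw [h7] at hw
  by_cases hri : rings (X.conf r ω j) (ω (j + 1))
  · left
    rw [← hw, nextState, if_pos hri]
    exact (hgood _ _).2 a h1
  · right
    have h9 : nextState (X.conf r ω j) (ω (j + 1)) = (ω (j + 1)).2.1 (X.conf r ω j).1 :=
      if_neg hri
    refine ⟨?_, ?_⟩
    · rw [← hw, h9]
      exact (hgood _ _).1
    · rw [← hw, ← h1]
      rcases hren with h | h | h
      · exact absurd h hri
      · rw [h, h1]; simp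
      · exact h

/-- The path is followed with positive probability: the initial timer exceeds some c > 0, and all
delays on the path are so short that the alarm does not ring. A last delay longer than any possible
timer value lets it ring; a short one leaves the states of the alarm. These conditions concern
finitely many independent inputs. -/
theorem cycleProb_pos_of_cycleReach (X : ACTMC S A) {r w : S} (h : X.CycleReach r w) :
    0 < X.cycleProb r w := by
  obtain ⟨a, v, hr, hpath, hlast⟩ := h
  obtain ⟨k, p, hp0, hpk, hp⟩ := hpath.exists_path
  obtain ⟨c, B, hc, hB, hcB⟩ := exists_Ioc_pos (X.law_pos a)
  -- The k delays of the path use up at most ke = c - 2e, so at least 2e of the timer is left for a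
  -- last delay shorter than e.
  set e : ℝ := c / (k + 2) with he
  have he0 : 0 < e := by positivity
  have hce : (k + 2 : ℝ) * e = c := by rw [he]; field_simp
  have halarm : ∀ i ≤ k, X.alarm (p i) = some a := by
    intro i hi
    rcases i with _ | i
    · rw [hp0, hr]
    · exact (hp i (by omega)).2
  -- A set of inputs for the last step that works for every remaining timer value between 2e and B.
  have hlaste : ∃ L : Set (Noise S A), MeasurableSet L ∧ 0 < X.noiseLaw L ∧ ∀ z ∈ L,
      ∀ η : ℝ≥0∞, ENNReal.ofReal (2 * e) ≤ η → η ≤ ENNReal.ofReal B →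
        X.renews (v, η) z ∧ nextState (v, η) z = w := by
    rcases hlast with hP | ⟨hP, hne⟩
    · refine ⟨{z | z.1 ∈ Set.Ioo B (B + 1) ∧ z.2.2.1 v ∈ ({w} : Set S)}, ?_, ?_, ?_⟩
      · measurability
      · rw [noiseLaw_alarm, X.alarmLaw_of_some (by rw [← hpk]; exact halarm k le_rfl)]
        exact ENNReal.mul_pos (expMeasure_Ioo_pos X.rate_pos hB.le (by linarith)).ne'
          (choiceLaw_singleton_pos hP).ne'
      · rintro z ⟨hz1, hz2⟩ η _ hη
        have hri : rings (v, η) z := hη.trans (ENNReal.ofReal_le_ofReal hz1.1.le)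
        exact ⟨Or.inl hri, by rw [nextState, if_pos hri]; exact hz2⟩
    · refine ⟨{z | z.1 ∈ Set.Ioo 0 e ∧ z.2.1 v ∈ ({w} : Set S)}, ?_, ?_, ?_⟩
      · measurability
      · rw [noiseLaw_delay]
        exact ENNReal.mul_pos (expMeasure_Ioo_pos X.rate_pos le_rfl he0).ne'
          (choiceLaw_singleton_pos hP).ne'
      · rintro z ⟨hz1, hz2⟩ η hη _
        have hri : ¬ rings (v, η) z := by
          refine not_le.2 (lt_of_lt_of_le ?_ hη)
          exact (ENNReal.ofReal_lt_ofReal_iff (by linarith)).2 (by linarith [hz1.2])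
        have hns : nextState (v, η) z = w := by rw [nextState, if_neg hri]; exact hz2
        refine ⟨Or.inr (Or.inr ?_), hns⟩
        rw [hns, ← hpk, halarm k le_rfl]
        exact hne
  obtain ⟨L, hLm, hLpos, hL⟩ := hlaste
  -- Input 0 supplies the initial timer, inputs 1, …, k lead from p (i - 1) to p i, and input k + 1
  -- makes the renewing step.
  set t : ℕ → Set (Noise S A) := fun i =>
    if i = 0 then {z | z.2.2.2 a ∈ Set.Ioc c B} else
      if i ≤ k then {z | z.1 ∈ Set.Ioo 0 e ∧ z.2.1 (p (i - 1)) ∈ ({p i} : Set S)} else L with ht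
  have htm : ∀ i, MeasurableSet (t i) := by
    intro i
    simp only [ht]
    split_ifs
    · exact (measurable_pi_apply a).comp (measurable_snd.comp (measurable_snd.comp
        measurable_snd)) measurableSet_Ioc
    · measurability
    · exact hLm
  have htpos : ∀ i, 0 < X.noiseLaw (t i) := by
    intro i
    simp only [ht]
    split_ifs with h0 hk
    · rw [X.noiseLaw_timer a measurableSet_Ioc]
      exact hcB
    · rw [noiseLaw_delay]
      refine ENNReal.mul_pos (expMeasure_Ioo_pos X.rate_pos le_rfl he0).ne'
        (choiceLaw_singleton_pos ?_).ne'
      have := (hp (i - 1) (by omega)).1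
      rwa [Nat.sub_add_cancel (Nat.pos_of_ne_zero h0)] at this
    · exact hLpos
  have hcyl : 0 < X.pathLaw (Set.pi (Finset.range (k + 2)) t) := by
    rw [pathLaw, Measure.infinitePi_pi _ fun i _ => htm i]
    exact pos_iff_ne_zero.2 (Finset.prod_ne_zero_iff.2 fun i _ => (htpos i).ne')
  unfold cycleProb
  refine ENNReal.toReal_pos ?_ (measure_ne_top _ _)
  refine (lt_of_lt_of_le hcyl (measure_mono ?_)).ne'
  intro ω hω
  have hωt : ∀ i < k + 2, ω i ∈ t i := fun i hi => hω i (by simpa using hi)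
  -- Without a renewal the timer is never redrawn, so after j steps at least c - je of it remains.
  have hinv : ∀ j ≤ k, (X.conf r ω j).1 = p j ∧
      ENNReal.ofReal (c - j * e) ≤ (X.conf r ω j).2 ∧ (X.conf r ω j).2 ≤ ENNReal.ofReal B ∧
      X.NotRenewedUpTo r ω j := by
    intro j
    induction j with
    | zero =>
      intro _
      have h0 := hωt 0 (by omega)
      simp only [ht, if_true] at h0
      have h1 : (X.conf r ω 0).2 = ENNReal.ofReal ((ω 0).2.2.2 a) := by
        simp [conf, freshTimer, hr]
      refine ⟨hp0.symm, ?_, ?_, fun i hi => absurd hi (by omega)⟩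
      · rw [h1]
        exact ENNReal.ofReal_le_ofReal (by simpa using h0.1.le)
      · rw [h1]
        exact ENNReal.ofReal_le_ofReal h0.2
    | succ j ih =>
      intro hj
      obtain ⟨h1, h2, h3, h4⟩ := ih (by omega)
      have hz := hωt (j + 1) (by omega)
      simp only [ht, Nat.succ_ne_zero, if_false, hj, if_true, Nat.add_sub_cancel] at hz
      obtain ⟨hz1, hz2⟩ := hz
      have hjk : (j : ℝ) + 1 ≤ k := by exact_mod_cast hj
      have hlow : 2 * e ≤ c - j * e := by nlinarith
      have hri : ¬ rings (X.conf r ω j) (ω (j + 1)) := by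
        refine not_le.2 (lt_of_lt_of_le ?_ h2)
        exact (ENNReal.ofReal_lt_ofReal_iff (by linarith)).2 (by linarith [hz1.2])
      have hns : nextState (X.conf r ω j) (ω (j + 1)) = p (j + 1) := by
        rw [nextState, if_neg hri, h1]
        exact hz2
      have hren : ¬ X.renews (X.conf r ω j) (ω (j + 1)) := by
        simp only [renews, not_or, not_not]
        rw [hns, h1, halarm _ hj, halarm _ (by omega : j ≤ k)]
        exact ⟨hri, by simp, rfl⟩
      have hconf : X.conf r ω (j + 1) =
          (p (j + 1), (X.conf r ω j).2 - ENNReal.ofReal (ω (j + 1)).1) := by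
        change X.nextConf (X.conf r ω j) (ω (j + 1)) = _
        rw [nextConf, if_neg hren, hns]
      refine ⟨by rw [hconf], ?_, ?_, ?_⟩
      · rw [hconf]
        refine le_trans ?_ (tsub_le_tsub_right h2 _)
        rw [← ENNReal.ofReal_sub _ hz1.1.le]
        refine ENNReal.ofReal_le_ofReal ?_
        push_cast
        linarith [hz1.2]
      · rw [hconf]
        exact tsub_le_self.trans h3
      · intro i hi
        rcases Nat.lt_succ_iff_lt_or_eq.1 hi with h | rfl
        exacts [h4 i h, hren]
  obtain ⟨h1, h2, h3, h4⟩ := hinv k le_rfl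
  have hz := hωt (k + 1) (by omega)
  simp only [ht, Nat.succ_ne_zero, if_false, not_le.2 (Nat.lt_succ_self k)] at hz
  have hlow : 2 * e ≤ c - k * e := by nlinarith
  have h5 : X.conf r ω k = (v, (X.conf r ω k).2) := by rw [← hpk, ← h1]
  have h6 := hL _ hz (X.conf r ω k).2 ((ENNReal.ofReal_le_ofReal hlow).trans h2) h3
  rw [← h5] at h6
  exact ⟨k, h4, h6.1, h6.2⟩

/-- The right-hand side does not mention the ringing-time laws, so changing the parameters preserves
the support. -/
theorem cycleProb_pos_iff (X : ACTMC S A) {r w : S} {a : A} (hr : X.alarm r = some a) :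
    0 < X.cycleProb r w ↔ X.CycleReach r w :=
  ⟨X.cycleReach_of_cycleProb_pos hr, X.cycleProb_pos_of_cycleReach⟩

end ACTMC

/-! ## Structure of the discretized semi-MDP -/

namespace ParametricACTMC

section Regenerative

variable {S A : Type} [Fintype S]

theorem isSetting_of_alarm_eq_some {N : ParametricACTMC S A} (s : N.RegState) {a : A}
    (ha : N.alarm s.1 = some a) : N.IsSetting s.1 := by
  rcases s.2 with h | h
  · rw [ha] at h
    cases h
  · exact h

theorem regState_of_delay {N : ParametricACTMC S A} {v w : S} (hP : 0 < N.P v w)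
    (h : ∀ a, N.alarm w = some a → N.alarm v ≠ some a) : N.alarm w = none ∨ N.IsSetting w := by
  cases hw : N.alarm w with
  | none => exact Or.inl rfl
  | some a => exact Or.inr ⟨a, hw, v, Or.inr ⟨h a hw, hP⟩⟩

theorem regState_of_alarm {N : ParametricACTMC S A} {v w : S} {b : A} (hv : N.alarm v = some b)
    (hP : 0 < N.Pa b v w) : N.alarm w = none ∨ N.IsSetting w := by
  cases hw : N.alarm w with
  | none => exact Or.inl rfl
  | some a => exact Or.inr ⟨a, hw, v, Or.inl ⟨b, hv, hP⟩⟩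

theorem regState_eq {N : ParametricACTMC S A} (hloc : N.Localized) {s s' : N.RegState} {a : A}
    (hs : N.alarm s.1 = some a) (hs' : N.alarm s'.1 = some a) : s = s' :=
  Subtype.ext ((hloc a).unique ⟨hs, isSetting_of_alarm_eq_some s hs⟩
    ⟨hs', isSetting_of_alarm_eq_some s' hs'⟩)

theorem regState_nonempty (N : ParametricACTMC S A) (hloc : N.Localized) [Nonempty S] :
    Nonempty N.RegState := by
  obtain ⟨s⟩ := ‹Nonempty S›
  cases hs : N.alarm s with
  | none => exact ⟨⟨s, Or.inl hs⟩⟩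
  | some a =>
    obtain ⟨r, hr, _⟩ := hloc a
    exact ⟨⟨r, Or.inr hr.2⟩⟩

/-- Allows sums over regenerative states to be replaced by sums over all states when the terms
vanish elsewhere. -/
theorem sum_regState {N : ParametricACTMC S A} {R : Type*} [AddCommMonoid R] (f : S → R)
    (hf : ∀ s, ¬ (N.alarm s = none ∨ N.IsSetting s) → f s = 0) :
    ∑ s : N.RegState, f s.1 = ∑ s, f s := by
  refine Finset.sum_of_injOn (fun s : N.RegState => s.1) (fun s _ s' _ h => Subtype.ext h)
    (fun _ _ => by simp) (fun s _ hs => hf s fun h => hs ⟨⟨s, h⟩, by simp only [Finset.coe_univ]; trivial, rfl⟩) fun _ _ => rfl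

theorem P_nonneg (N : ParametricACTMC S A) (s s' : S) : 0 ≤ N.P s s' := by
  have h : (0 : ℝ) ≤ (N.P s s' : ℝ) := (N.P_distr s).1 s'
  exact_mod_cast h

theorem P_eq_zero_of_not_regState {N : ParametricACTMC S A} {s : S} (hs : N.alarm s = none)
    {s' : S} (hs' : ¬ (N.alarm s' = none ∨ N.IsSetting s')) : N.P s s' = 0 := by
  by_contra h
  exact hs' (regState_of_delay (lt_of_le_of_ne (N.P_nonneg s s') (Ne.symm h)) (by simp [hs]))

theorem isDistr_P {N : ParametricACTMC S A} (s : N.RegState) (hs : N.alarm s.1 = none) :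
    IsDistr fun s' : N.RegState => (N.P s.1 s'.1 : ℝ) := by
  refine ⟨fun s' => (N.P_distr s.1).1 s'.1, ?_⟩
  rw [sum_regState fun s' => (N.P s.1 s' : ℝ)]
  · exact (N.P_distr s.1).2
  · intro s' hs'
    rw [P_eq_zero_of_not_regState hs hs', Rat.cast_zero]

/-- The row of v has all its mass at v. Hence edges of alarms that are not enabled contribute only
loops. -/
theorem alarm_self {N : ParametricACTMC S A} {a : A} {v w : S} (hv : N.alarm v ≠ some a)
    (h : 0 < N.Pa a v w) : w = v := by
  by_contra hne
  have h1 : N.Pa a v v = 1 := N.Pa_self a v hv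
  have h2 : ∑ s', N.Pa a v s' = 1 := by
    have h : ∑ s', (N.Pa a v s' : ℝ) = 1 := (N.Pa_distr a v).2
    exact_mod_cast h
  have h3 : ∀ s', 0 ≤ N.Pa a v s' := fun s' => by
    have h : (0 : ℝ) ≤ (N.Pa a v s' : ℝ) := (N.Pa_distr a v).1 s'
    exact_mod_cast h
  have h4 := Finset.add_le_sum (fun s' _ => h3 s') (Finset.mem_univ v) (Finset.mem_univ w)
    (Ne.symm hne)
  linarith

/-! ### Actions -/

theorem mem_actionSet_iff {N : ParametricACTMC S A} {δ : S → ℚ} {s : S} {a : A}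
    (ha : N.alarm s = some a) {d : ℚ} : d ∈ N.actionSet δ s ↔
      (d < N.hi a ∧ ∃ i : ℕ, d = N.lo a + i * δ s) ∨ d = N.hi a := by
  unfold actionSet
  rw [ha]
  rfl

theorem mem_actionSet_iff_of_none {N : ParametricACTMC S A} {δ : S → ℚ} {s : S}
    (hs : N.alarm s = none) {d : ℚ} : d ∈ N.actionSet δ s ↔ d = 0 := by
  unfold actionSet
  rw [hs]
  rfl

theorem act_mem_Icc {N : ParametricACTMC S A} {δ : S → ℚ} {s : N.RegState} {a : A}
    (ha : N.alarm s.1 = some a) (hδ : 0 < δ s.1) (b : N.Act δ s) :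
    b.1 ∈ Set.Icc (N.lo a) (N.hi a) := by
  rcases (mem_actionSet_iff ha).1 b.2 with ⟨hlt, i, hi⟩ | h
  · refine ⟨?_, hlt.le⟩
    rw [hi]
    have : 0 ≤ (i : ℚ) * δ s.1 := by positivity
    linarith
  · rw [h]
    exact ⟨N.lo_le_hi a, le_rfl⟩

theorem act_subsingleton {N : ParametricACTMC S A} {δ : S → ℚ} {s : N.RegState}
    (hs : N.alarm s.1 = none) (b b' : N.Act δ s) : b = b' := by
  exact Subtype.ext (((mem_actionSet_iff_of_none hs).1 b.2).trans
    ((mem_actionSet_iff_of_none hs).1 b'.2).symm)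

theorem act_nonempty (N : ParametricACTMC S A) (δ : S → ℚ) (s : N.RegState) :
    Nonempty (N.Act δ s) := by
  cases hs : N.alarm s.1 with
  | none => exact ⟨⟨0, (mem_actionSet_iff_of_none hs).2 rfl⟩⟩
  | some a => exact ⟨⟨N.hi a, (mem_actionSet_iff hs).2 (Or.inr rfl)⟩⟩

theorem act_finite (N : ParametricACTMC S A) {δ : S → ℚ} (hδ : ∀ s, N.IsSetting s → 0 < δ s)
    (s : N.RegState) : Finite (N.Act δ s) := by
  cases hs : N.alarm s.1 with
  | none =>
    have : Subsingleton (N.Act δ s) := ⟨act_subsingleton hs⟩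
    infer_instance
  | some a =>
    have hpos := hδ s.1 (isSetting_of_alarm_eq_some s hs)
    obtain ⟨K, hK⟩ := exists_nat_gt ((N.hi a - N.lo a) / δ s.1)
    have hfin : (N.actionSet δ s.1).Finite := by
      refine Set.Finite.subset ((Finset.finite_toSet ((Finset.range K).image
        fun i : ℕ => N.lo a + i * δ s.1)).union (Set.finite_singleton (N.hi a))) fun d hd => ?_
      rcases (mem_actionSet_iff hs).1 hd with ⟨hlt, i, hi⟩ | h
      · left
        rw [Finset.mem_coe, Finset.mem_image]
        refine ⟨i, Finset.mem_range.2 ?_, hi.symm⟩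
        have h1 : (i : ℚ) < (N.hi a - N.lo a) / δ s.1 := by
          rw [lt_div_iff₀ hpos]
          linarith
        exact_mod_cast h1.trans hK
      · exact Or.inr h
    exact hfin.to_subtype

theorem strategy_finite (N : ParametricACTMC S A) {δ : S → ℚ}
    (hδ : ∀ s, N.IsSetting s → 0 < δ s) : Finite (N.Strategy δ) := by
  have := N.act_finite hδ
  exact Pi.finite

theorem strategy_nonempty (N : ParametricACTMC S A) (δ : S → ℚ) : Nonempty (N.Strategy δ) :=
  ⟨fun s => (N.act_nonempty δ s).some⟩

end Regenerative

/-! ### Supports of the effects and irreducibility. -/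

variable {S A : Type} [Fintype S] [Fintype A] [MeasurableSpace S] [DiscreteMeasurableSpace S]

omit [DiscreteMeasurableSpace S] in
theorem effProb_nonneg (N : ParametricACTMC S A) (s : N.RegState) (d : ℝ) (s' : N.RegState) :
    0 ≤ N.effProb s d s' := by
  unfold effProb
  split
  · exact (N.P_distr s.1).1 s'.1
  · exact ENNReal.toReal_nonneg

omit [DiscreteMeasurableSpace S] in
theorem effProb_of_none {N : ParametricACTMC S A} {s : N.RegState} (hs : N.alarm s.1 = none)
    (d : ℝ) (s' : N.RegState) : N.effProb s d s' = N.P s.1 s'.1 := by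
  unfold effProb
  rw [hs]

omit [DiscreteMeasurableSpace S] in
theorem effTime_of_none {N : ParametricACTMC S A} {s : N.RegState} (hs : N.alarm s.1 = none)
    (d : ℝ) : N.effTime s d = 1 / N.rate := by
  unfold effTime
  rw [hs]

omit [DiscreteMeasurableSpace S] in
theorem effCost_of_none {N : ParametricACTMC S A} (C : Costs S) {s : N.RegState}
    (hs : N.alarm s.1 = none) (d : ℝ) :
    N.effCost C s d = C.R s.1 / N.rate + ∑ s', N.P s.1 s' * C.I s.1 s' := by
  unfold effCost
  rw [hs]

omit [DiscreteMeasurableSpace S] in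
theorem effCost_nonneg (N : ParametricACTMC S A) (C : Costs S) (s : N.RegState) (d : ℝ) :
    0 ≤ N.effCost C s d := by
  unfold effCost
  split
  · have h1 : (0 : ℝ) < N.rate := by exact_mod_cast N.rate_pos
    have h2 : (0 : ℝ) ≤ C.R s.1 := by exact_mod_cast C.R_nonneg s.1
    have h3 : 0 ≤ ∑ s', N.P s.1 s' * C.I s.1 s' :=
      Finset.sum_nonneg fun s' _ => mul_nonneg (N.P_nonneg s.1 s') (C.I_nonneg s.1 s')
    exact add_nonneg (div_nonneg h2 h1.le) (by exact_mod_cast h3)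
  · exact ENNReal.toReal_nonneg

/-- The parameter d₀ enters only the law of the ringing times, on which `CycleReach` does not
depend, so reachability for d₀ and for d is the same proposition. -/
theorem effProb_pos_of_cycleReach {N : ParametricACTMC S A} {s s' : N.RegState} {a : A}
    (hs : N.alarm s.1 = some a) {d₀ : ℝ}
    (h : (N.inst (N.paramAt a d₀)).CycleReach s.1 s'.1) (d : ℝ) : 0 < N.effProb s d s' := by
  unfold effProb
  rw [hs]
  exact (ACTMC.cycleProb_pos_iff (N.inst (N.paramAt a d)) (r := s.1) (a := a) hs).2 h

/-- The support of `Π_s(d)` does not depend on `d`. -/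
theorem effProb_pos_congr {N : ParametricACTMC S A} {s s' : N.RegState} {d : ℝ}
    (h : 0 < N.effProb s d s') (d' : ℝ) : 0 < N.effProb s d' s' := by
  cases hs : N.alarm s.1 with
  | none =>
    rw [effProb_of_none hs] at h ⊢
    exact h
  | some a =>
    unfold effProb at h
    rw [hs] at h
    exact effProb_pos_of_cycleReach hs
      ((ACTMC.cycleProb_pos_iff (N.inst (N.paramAt a d)) (r := s.1) (a := a) hs).1 h) d'

theorem effProb_eq_zero_congr (N : ParametricACTMC S A) (s s' : N.RegState) (d d' : ℝ) :
    N.effProb s d s' = 0 ↔ N.effProb s d' s' = 0 := by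
  constructor <;> intro h <;> by_contra hne
  · exact (effProb_pos_congr (lt_of_le_of_ne (N.effProb_nonneg _ _ _) (Ne.symm hne)) d).ne' h
  · exact (effProb_pos_congr (lt_of_le_of_ne (N.effProb_nonneg _ _ _) (Ne.symm hne)) d').ne' h

/-- While walking along edges from x to y, keep a regenerative state r, reachable from x, that
explains the current state v: r = v if no alarm is enabled, and otherwise v is reached from r by
delays with the same alarm enabled. Each edge prolongs the current cycle, ends it in a new
regenerative state, or is a loop of a disabled alarm. -/
theorem reflTransGen_effProb {N : ParametricACTMC S A} (hconn : N.StronglyConnected)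
    (hloc : N.Localized) (x y : N.RegState) :
    Relation.ReflTransGen (fun s s' : N.RegState => ∀ d, 0 < N.effProb s d s') x y := by
  have key : ∀ v, Relation.ReflTransGen N.Edge x.1 v → ∃ r : N.RegState,
      Relation.ReflTransGen (fun s s' : N.RegState => ∀ d, 0 < N.effProb s d s') x r ∧
      (N.alarm v = none → r.1 = v) ∧ ∀ a, N.alarm v = some a → N.alarm r.1 = some a ∧
        Relation.ReflTransGen (fun v v' => 0 < N.P v v' ∧ N.alarm v' = some a) r.1 v := by
    intro v hv
    induction hv with
    | refl => exact ⟨x, .refl, fun _ => rfl, fun a ha => ⟨ha, .refl⟩⟩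
    | @tail v w _ hvw ih =>
      obtain ⟨r, hr, hnone, hsome⟩ := ih
      have hnew : ∀ hw : N.alarm w = none ∨ N.IsSetting w,
          (∀ d, 0 < N.effProb r d ⟨w, hw⟩) → ∃ r' : N.RegState,
          Relation.ReflTransGen (fun s s' : N.RegState => ∀ d, 0 < N.effProb s d s') x r' ∧
          (N.alarm w = none → r'.1 = w) ∧ ∀ a, N.alarm w = some a → N.alarm r'.1 = some a ∧
          Relation.ReflTransGen (fun v v' => 0 < N.P v v' ∧ N.alarm v' = some a) r'.1 w :=
        fun hw he => ⟨⟨w, hw⟩, hr.tail he, fun _ => rfl, fun a ha => ⟨ha, .refl⟩⟩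
      have hcycle : ∀ (a : A) (hw : N.alarm w = none ∨ N.IsSetting w), N.alarm v = some a →
          (0 < N.Pa a v w ∨ (0 < N.P v w ∧ N.alarm w ≠ some a)) →
          ∀ d, 0 < N.effProb r d ⟨w, hw⟩ := by
        intro a hw hv h
        obtain ⟨hra, hrv⟩ := hsome a hv
        refine effProb_pos_of_cycleReach hra (d₀ := 0) ⟨a, v, hra, ?_, ?_⟩
        · exact Relation.ReflTransGen.mono (fun p q hpq => ⟨Rat.cast_pos.2 hpq.1, hpq.2⟩) _ _ hrv
        · exact h.imp (fun h => Rat.cast_pos.2 h) fun h => ⟨Rat.cast_pos.2 h.1, h.2⟩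
      rcases hvw with hP | ⟨b, hPb⟩
      · cases hv : N.alarm v with
        | none =>
          have hw := regState_of_delay hP (fun a _ => by rw [hv]; simp)
          refine hnew hw fun d => ?_
          have hrv := hnone hv
          refine lt_of_lt_of_eq ?_ (effProb_of_none (s := r) (by rw [hrv, hv]) d _).symm
          rw [hrv]
          exact Rat.cast_pos.2 hP
        | some a =>
          by_cases hwa : N.alarm w = some a
          · refine ⟨r, hr, fun h => by simp [hwa] at h, fun a' ha' => ?_⟩
            obtain rfl : a = a' := by rw [hwa] at ha'; exact Option.some.inj ha'
            exact ⟨(hsome a hv).1, (hsome a hv).2.tail ⟨hP, hwa⟩⟩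
          · have hw := regState_of_delay hP (fun a' ha' h => by
              rw [hv] at h
              exact hwa (ha'.trans h.symm))
            exact hnew hw (hcycle a hw hv (Or.inr ⟨hP, hwa⟩))
      · by_cases hv : N.alarm v = some b
        · have hw := regState_of_alarm hv hPb
          exact hnew hw (hcycle b hw hv (Or.inl hPb))
        · obtain rfl := alarm_self hv hPb
          exact ⟨r, hr, hnone, hsome⟩
  obtain ⟨r, hr, hnone, hsome⟩ := key y.1 (hconn x.1 y.1)
  -- The walk may reach y by a delay within a cycle, without a renewal in y. But r and y are then
  -- setting states of the same alarm, and localization identifies them.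
  have : r = y := by
    cases hy : N.alarm y.1 with
    | none => exact Subtype.ext (hnone hy)
    | some a => exact regState_eq hloc (hsome a hy).1 hy
  exact this ▸ hr

theorem IsApprox.reflTransGen {N : ParametricACTMC S A} {C : Costs S} {δ : S → ℚ} {κ : ℚ}
    {M : SemiMDP N.RegState (N.Act δ)} (hM : N.IsApprox C δ κ M)
    (hconn : N.StronglyConnected) (hloc : N.Localized) (σ : N.Strategy δ) (x y : N.RegState) :
    Relation.ReflTransGen (fun s s' : N.RegState => 0 < M.Q s (σ s) s') x y := by
  refine Relation.ReflTransGen.mono (fun s s' h => ?_) _ _ (reflTransGen_effProb hconn hloc x y)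
  refine lt_of_le_of_ne ((M.distr _ _).1 _) fun h0 => ?_
  exact (h _).ne' (((hM s (σ s)).support s').1 h0.symm)

end ParametricACTMC

/-! ## Termination of the policy iteration -/

namespace Oracles

section Precision

variable {S A : Type} [Fintype S]

theorem xi_le_kappa (O : Oracles S) (N : ParametricACTMC S A) (ε : ℚ) :
    4 * O.xi N ε ≤ O.κ ε := by
  classical
  have : O.xi N ε ≤ O.κ ε / 4 := Finset.min'_le _ _ (Finset.mem_insert_self _ _)
  linarith

theorem xi_le_pmin (O : Oracles S) (N : ParametricACTMC S A) (ε : ℚ) {s : S}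
    (hs : N.IsSetting s) : 3 * O.xi N ε ≤ O.pmin s := by
  classical
  have : O.xi N ε ≤ O.pmin s / 3 := Finset.min'_le _ _ (Finset.mem_insert_of_mem
    (Finset.mem_image_of_mem _ (by simpa using hs)))
  linarith

theorem xi_mem (O : Oracles S) (N : ParametricACTMC S A) (ε : ℚ) :
    4 * O.xi N ε = O.κ ε ∨ ∃ s, N.IsSetting s ∧ 3 * O.xi N ε = O.pmin s := by
  classical
  have h : O.xi N ε ∈ insert (O.κ ε / 4)
      ((Finset.univ.filter fun s => N.IsSetting s).image fun s => O.pmin s / 3) :=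
    Finset.min'_mem _ _
  rcases Finset.mem_insert.1 h with h | h
  · left; linarith
  · obtain ⟨s, hs, hx⟩ := Finset.mem_image.1 h
    exact Or.inr ⟨s, by simpa using hs, by linarith⟩

end Precision

variable {S A : Type} [Fintype S] [Fintype A] [MeasurableSpace S] [DiscreteMeasurableSpace S]
  {O : Oracles S} {N : ParametricACTMC S A} {C : Costs S} {ε : ℚ}

omit [DiscreteMeasurableSpace S] in
theorem xi_pos (h1 : O.Assumption1 N C) (h4 : O.Assumption4 N) (hε : 0 < ε) : 0 < O.xi N ε := by
  rcases O.xi_mem N ε with h | ⟨s, hs, h⟩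
  · linarith [(h1 ε hε).2.1]
  · obtain ⟨a, ha, _⟩ := id hs
    have := (h4 ⟨s, Or.inr hs⟩ a ha).1
    simp only at this
    linarith

omit [DiscreteMeasurableSpace S] in
/-- The semi-MDP `M_ξ` is well defined. -/
theorem exists_determines (h1 : O.Assumption1 N C) (h2 : O.Assumption2 N C)
    (h4 : O.Assumption4 N) (hε : 0 < ε) :
    ∃ M : SemiMDP N.RegState (N.Act (O.δ ε)), O.Determines N C ε M ∧
      N.IsApprox C (O.δ ε) (O.xi N ε) M := by
  classical
  have hξ := xi_pos h1 h4 hε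
  have key : ∀ s (b : N.Act (O.δ ε) s), ∃ (q : N.RegState → ℝ) (t c : ℝ),
      IsKappaApprox (O.xi N ε : ℝ) (N.effProb s (b.1 : ℝ)) (N.effTime s (b.1 : ℝ))
        (N.effCost C s (b.1 : ℝ)) q t c ∧
      (N.alarm s.1 = none →
        (∀ s', q s' = N.P s.1 s'.1) ∧ t = 1 / N.rate ∧
          c = C.R s.1 / N.rate + ∑ s', N.P s.1 s' * C.I s.1 s') ∧
      (N.alarm s.1 ≠ none →
        (∀ s', q s' = O.prob (O.xi N ε) s.1 b.1 s'.1) ∧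
          t = O.time (O.xi N ε) s.1 b.1 ∧ c = O.cost (O.xi N ε) s.1 b.1) := by
    intro s b
    have hξ' : (0 : ℝ) ≤ O.xi N ε := by exact_mod_cast hξ.le
    cases hs : N.alarm s.1 with
    | none =>
      refine ⟨N.effProb s b.1, N.effTime s b.1, N.effCost C s b.1, ⟨?_, ?_, ?_, ?_, ?_, ?_, ?_⟩,
        fun _ => ⟨fun s' => ParametricACTMC.effProb_of_none hs _ s',
          ParametricACTMC.effTime_of_none hs _, ParametricACTMC.effCost_of_none C hs _⟩,
        fun h => absurd rfl h⟩
      · have := ParametricACTMC.isDistr_P s hs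
        convert this using 2
        exact ParametricACTMC.effProb_of_none hs _ _
      · rw [ParametricACTMC.effTime_of_none hs]
        have : (0 : ℝ) < N.rate := by exact_mod_cast N.rate_pos
        positivity
      · exact N.effCost_nonneg C s _
      · exact fun _ => Iff.rfl
      · intro m; simpa using hξ'
      · simpa using hξ'
      · simpa using hξ'
    | some a =>
      refine ⟨_, _, _, h2 _ hξ s a hs b.1 ?_, by simp, fun _ => ⟨fun _ => rfl, rfl, rfl⟩⟩
      exact ParametricACTMC.act_mem_Icc hs
        ((h1 ε hε).1 _ (ParametricACTMC.isSetting_of_alarm_eq_some s hs)) b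
  choose q t c hq h5 h6 using key
  exact ⟨⟨q, t, c, fun s b => (hq s b).distr, fun s b => (hq s b).time_nonneg,
    fun s b => (hq s b).cost_nonneg⟩, fun s b => ⟨h5 s b, h6 s b⟩, hq⟩

omit [DiscreteMeasurableSpace S] in
theorem time_pos (h1 : O.Assumption1 N C) (hε : 0 < ε) {κ : ℚ} (hκ : κ ≤ O.κ ε)
    {M : SemiMDP N.RegState (N.Act (O.δ ε))} (hM : N.IsApprox C (O.δ ε) κ M)
    (s : N.RegState) (b : N.Act (O.δ ε) s) : 0 < M.t s b := by
  have h3 := (h1 ε hε).2.2.1 s b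
  have h4 := (abs_le.1 (hM s b).time_close).2
  have h5 : (κ : ℝ) ≤ O.κ ε := by exact_mod_cast hκ
  linarith

omit [Fintype A] [MeasurableSpace S] [DiscreteMeasurableSpace S] in
/-- The effects of `M_ξ` are rational. -/
theorem Determines.exists_rat {M : SemiMDP N.RegState (N.Act (O.δ ε))}
    (hD : O.Determines N C ε M) (s : N.RegState) (b : N.Act (O.δ ε) s) :
    ∃ (q : N.RegState → ℚ) (t c : ℚ),
      (∀ s', M.Q s b s' = q s') ∧ M.t s b = t ∧ M.c s b = c := by
  by_cases hs : N.alarm s.1 = none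
  · obtain ⟨e1, e2, e3⟩ := (hD s b).1 hs
    refine ⟨fun s' => N.P s.1 s'.1, 1 / N.rate,
      C.R s.1 / N.rate + ∑ s', N.P s.1 s' * C.I s.1 s', e1, ?_, ?_⟩
    · rw [e2]; push_cast; rfl
    · rw [e3]; push_cast; rfl
  · obtain ⟨e1, e2, e3⟩ := (hD s b).2 hs
    exact ⟨_, _, _, e1, e2, e3⟩

/-- All effects of M_ξ are rational, so the Poisson equation is solved over ℚ; the gain is
nonnegative because the costs are. -/
theorem exists_isEvaluation (hconn : N.StronglyConnected) (hloc : N.Localized)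
    (h1 : O.Assumption1 N C) (hε : 0 < ε) (hξ : 0 < O.xi N ε)
    {M : SemiMDP N.RegState (N.Act (O.δ ε))} (hD : O.Determines N C ε M)
    (hM : N.IsApprox C (O.δ ε) (O.xi N ε) M) (s₀ : N.RegState) (σ : N.Strategy (O.δ ε)) :
    ∃ (g : ℚ) (h : N.RegState → ℚ), IsEvaluation M s₀ σ g h := by
  have : Nonempty N.RegState := ⟨s₀⟩
  have hκ : O.xi N ε ≤ O.κ ε := by linarith [O.xi_le_kappa N ε]
  choose q t c hq ht hc using fun s => hD.exists_rat s (σ s)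
  have hpos : ∀ s, 0 < t s := fun s => by
    have := time_pos h1 hε hκ hM s (σ s)
    rw [ht] at this
    exact_mod_cast this
  have hq0 : ∀ s s', 0 ≤ q s s' := fun s s' => by
    have := (M.distr s (σ s)).1 s'
    rw [hq] at this
    exact_mod_cast this
  have hq1 : ∀ s, ∑ s', q s s' = 1 := fun s => by
    have := (M.distr s (σ s)).2
    simp only [hq] at this
    exact_mod_cast this
  have hc0 : ∀ s, 0 ≤ c s := fun s => by
    have := M.c_nonneg s (σ s)
    rw [hc] at this
    exact_mod_cast this
  have hirr : ∀ x y, Relation.ReflTransGen (fun x y => 0 < q x y) x y := fun x y =>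
    Relation.ReflTransGen.mono (fun s s' h => by
      rw [hq] at h
      exact_mod_cast h) _ _ (hM.reflTransGen hconn hloc σ x y)
  obtain ⟨g, h, h0, hgh⟩ := exists_poisson_solution hq0 hq1 hirr hpos c s₀
  have hreal : ∀ s, (h s : ℝ) = rank M g h s (σ s) := fun s => by
    rw [rank, ht, hc]
    simp only [hq]
    exact_mod_cast hgh s
  refine ⟨g, h, gain_nonneg hq0 hq1 hpos hc0 hgh, fun s => ?_, h0, hreal⟩
  exact M.expMP_eq_ofReal σ s (fun s => time_pos h1 hε hκ hM s (σ s)) hreal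

omit [Fintype A] [MeasurableSpace S] [DiscreteMeasurableSpace S] in
theorem best_nonempty (hδ : ∀ s, N.IsSetting s → 0 < O.δ ε s)
    (M : SemiMDP N.RegState (N.Act (O.δ ε))) (σ : N.Strategy (O.δ ε)) (g : ℚ)
    (h : N.RegState → ℚ) (s : N.RegState) (a : A) :
    (O.best N ε M σ g h s a).Nonempty := by
  have := N.act_finite hδ s
  obtain ⟨b, hb, hmin⟩ := Set.exists_min_image (O.candidates N ε σ g h s a) (rank M g h s)
    (Set.toFinite _) ⟨σ s, Or.inl rfl⟩
  exact ⟨b, hb, hmin⟩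

theorem exists_step (hconn : N.StronglyConnected) (hloc : N.Localized)
    (h1 : O.Assumption1 N C) (hε : 0 < ε) (hξ : 0 < O.xi N ε)
    {M : SemiMDP N.RegState (N.Act (O.δ ε))} (hD : O.Determines N C ε M)
    (hM : N.IsApprox C (O.δ ε) (O.xi N ε) M) (s₀ : N.RegState) (σ : N.Strategy (O.δ ε)) :
    ∃ σ', O.Step N ε M s₀ σ σ' := by
  obtain ⟨g, h, hgh⟩ := exists_isEvaluation hconn hloc h1 hε hξ hD hM s₀ σ
  have key : ∀ s, ∃ b : N.Act (O.δ ε) s, (N.alarm s.1 = none → b = σ s) ∧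
      ∀ a, N.alarm s.1 = some a → (σ s ∈ O.best N ε M σ g h s a → b = σ s) ∧
        (σ s ∉ O.best N ε M σ g h s a → b ∈ O.best N ε M σ g h s a) := by
    intro s
    cases hs : N.alarm s.1 with
    | none => exact ⟨σ s, fun _ => rfl, by simp⟩
    | some a =>
      by_cases hb : σ s ∈ O.best N ε M σ g h s a
      · refine ⟨σ s, fun _ => rfl, fun a' ha' => ?_⟩
        obtain rfl := Option.some.inj ha'
        exact ⟨fun _ => rfl, fun h => absurd hb h⟩
      · obtain ⟨b, hb'⟩ := best_nonempty (h1 ε hε).1 M σ g h s a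
        refine ⟨b, by simp, fun a' ha' => ?_⟩
        obtain rfl := Option.some.inj ha'
        exact ⟨fun h => absurd h hb, fun _ => hb'⟩
  choose σ' hσ' using key
  exact ⟨σ', g, h, hgh, hσ'⟩

omit [Fintype A] [MeasurableSpace S] [DiscreteMeasurableSpace S] in
/-- Policy improvement does not increase any rank, and decreases the rank where it changes the
strategy. -/
theorem rank_improvement {M : SemiMDP N.RegState (N.Act (O.δ ε))} {σ σ' : N.Strategy (O.δ ε)}
    {g : ℚ} {h : N.RegState → ℚ}
    (hstep : ∀ s, (N.alarm s.1 = none → σ' s = σ s) ∧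
      ∀ a, N.alarm s.1 = some a →
        (σ s ∈ O.best N ε M σ g h s a → σ' s = σ s) ∧
        (σ s ∉ O.best N ε M σ g h s a → σ' s ∈ O.best N ε M σ g h s a)) (s : N.RegState) :
    σ' s = σ s ∨ rank M g h s (σ' s) < rank M g h s (σ s) := by
  cases hs : N.alarm s.1 with
  | none => exact Or.inl ((hstep s).1 hs)
  | some a =>
    by_cases hb : σ s ∈ O.best N ε M σ g h s a
    · exact Or.inl (((hstep s).2 a hs).1 hb)
    · right
      have h1 := ((hstep s).2 a hs).2 hb
      have h2 : ∃ b ∈ O.candidates N ε σ g h s a, rank M g h s b < rank M g h s (σ s) := by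
        by_contra hcon
        push Not at hcon
        exact hb ⟨Or.inl rfl, hcon⟩
      obtain ⟨b, hbC, hlt⟩ := h2
      exact (h1.2 b hbC).trans_lt hlt

/-- Each iteration that changes the strategy strictly lowers the gain, and the gain is determined by
the strategy; so no strategy can recur among finitely many. -/
theorem terminates (hconn : N.StronglyConnected) (hloc : N.Localized)
    (h1 : O.Assumption1 N C) (hε : 0 < ε) (hξ : 0 < O.xi N ε)
    {M : SemiMDP N.RegState (N.Act (O.δ ε))} (hD : O.Determines N C ε M)
    (hM : N.IsApprox C (O.δ ε) (O.xi N ε) M) : O.Terminates N ε M := by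
  refine fun s₀ => ⟨exists_step hconn hloc h1 hε hξ hD hM s₀, ?_⟩
  rintro ⟨τ, hτ⟩
  have : Nonempty N.RegState := ⟨s₀⟩
  have hκ : O.xi N ε ≤ O.κ ε := by linarith [O.xi_le_kappa N ε]
  choose g h hgh hstep using fun n => (hτ n).1
  have hanti : StrictAnti g := by
    refine strictAnti_nat_of_succ_lt fun n => ?_
    have himp := rank_improvement (hstep n)
    have hlt : (g (n + 1) : ℝ) < g n := by
      refine gain_lt_of_improvement (Q := fun s => M.Q s (τ (n + 1) s))
        (fun s => (M.distr s _).1) (fun s => (M.distr s _).2)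
        (hM.reflTransGen hconn hloc _) (fun s => time_pos h1 hε hκ hM s (τ (n + 1) s))
        (c := fun s => M.c s (τ (n + 1) s)) (h := fun s => (h n s : ℝ))
        (h' := fun s => (h (n + 1) s : ℝ)) (hgh (n + 1)).2.2.2 (fun s => ?_) ?_
      · rw [(hgh n).2.2.2 s]
        rcases himp s with heq | hlt
        · rw [heq]; exact le_rfl
        · exact hlt.le
      · obtain ⟨s, hs⟩ := Function.ne_iff.1 (hτ n).2
        refine ⟨s, ?_⟩
        rw [(hgh n).2.2.2 s]
        exact (himp s).resolve_left hs
    exact_mod_cast hlt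
  have := N.strategy_finite (h1 ε hε).1
  -- A repeated strategy has the same expected mean-payoff both times, hence the same gain, since
  -- `ENNReal.ofReal` is injective on nonnegative reals.
  obtain ⟨m, n, hmn, heq⟩ := Finite.exists_ne_map_eq_of_infinite τ
  have e1 := (hgh m).2.1 s₀
  have e2 := (hgh n).2.1 s₀
  rw [heq, e2] at e1
  have e3 : (g n : ℝ) = g m := (ENNReal.ofReal_eq_ofReal_iff (by exact_mod_cast (hgh n).1)
    (by exact_mod_cast (hgh m).1)).1 e1
  exact hmn (hanti.injective (by exact_mod_cast e3.symm))

end Oracles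

/-! ## Correctness of the policy iteration -/

theorem IsKappaApprox.mono {M : Type} [Fintype M] {ξ κ : ℝ} (hle : ξ ≤ κ) {q q' : M → ℝ}
    {t c t' c' : ℝ} (h : IsKappaApprox ξ q t c q' t' c') : IsKappaApprox κ q t c q' t' c' :=
  ⟨h.distr, h.time_nonneg, h.cost_nonneg, h.support, fun m => (h.prob_close m).trans hle,
    h.time_close.trans hle, h.cost_close.trans hle⟩

/-- Transport of a ranking inequality: if `(q, t, c)` is ranked above `(q₁, t₁, c₁)`, and
`(q₂, t₂, c₂)` approximates the same effects as `(q₁, t₁, c₁)`, then the effects approximated by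
`(q, t, c)` have a coarser approximation that is ranked above `(q₂, t₂, c₂)`. -/
theorem exists_approx_rank_ge {M : Type} [Fintype M] {ξ κ : ℝ} (hξ : 0 < ξ) (hκ : 4 * ξ ≤ κ)
    {Q Q₁ q q₁ q₂ : M → ℝ} {T K T₁ K₁ t c t₁ c₁ t₂ c₂ : ℝ}
    (hb : IsKappaApprox ξ Q T K q t c) (hb₁ : IsKappaApprox ξ Q₁ T₁ K₁ q₁ t₁ c₁)
    (hb₂ : IsKappaApprox ξ Q₁ T₁ K₁ q₂ t₂ c₂) (hsupp : ∀ m, Q m = 0 ↔ Q₁ m = 0)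
    (hmin : ∀ m, Q m ≠ 0 → 3 * ξ ≤ Q m) (hT : κ < T) (hK : 0 ≤ K) (g : ℝ) (h : M → ℝ)
    (hF : c₁ - g * t₁ + ∑ m, q₁ m * h m ≤ c - g * t + ∑ m, q m * h m) :
    ∃ (q' : M → ℝ) (t' c' : ℝ), IsKappaApprox κ Q T K q' t' c' ∧
      c₂ - g * t₂ + ∑ m, q₂ m * h m ≤ c' - g * t' + ∑ m, q' m * h m := by
  set H : ℝ := ∑ m, |h m| with hH
  have hH0 : 0 ≤ H := Finset.sum_nonneg fun _ _ => abs_nonneg _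
  -- The shift of the probabilities is damped by 1 - θ, with θ > 0 so that the support survives, but
  -- so small that damping changes the rank by at most ξ.
  set θ : ℝ := 1 / (2 * H + 2) with hθ
  have hθ0 : 0 < θ := by positivity
  have hθ1 : θ ≤ 1 := by
    rw [hθ, div_le_one (by positivity)]
    linarith
  have hθH : 2 * θ * H ≤ 1 := by
    rw [hθ, mul_one_div, div_mul_eq_mul_div, div_le_one (by positivity)]
    linarith
  have hd : ∀ m, |q₂ m - q₁ m| ≤ 2 * ξ := fun m => by
    have e1 := abs_le.1 (hb₁.prob_close m)
    have e2 := abs_le.1 (hb₂.prob_close m)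
    rw [abs_le]
    constructor <;> linarith [e1.1, e1.2, e2.1, e2.2]
  have hd' : ∀ m, |(1 - θ) * (q₂ m - q₁ m)| ≤ (1 - θ) * (2 * ξ) := fun m => by
    rw [abs_mul, abs_of_nonneg (by linarith : 0 ≤ 1 - θ)]
    exact mul_le_mul_of_nonneg_left (hd m) (by linarith)
  have hθξ : 0 < θ * ξ := mul_pos hθ0 hξ
  have hzero : ∀ m, Q m = 0 → q m + (1 - θ) * (q₂ m - q₁ m) = 0 := fun m hm => by
    rw [(hb.support m).2 hm, (hb₁.support m).2 ((hsupp m).1 hm),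
      (hb₂.support m).2 ((hsupp m).1 hm)]
    ring
  -- On the support q m ≥ 3ξ - ξ = 2ξ, whereas the damped shift is at most (1 - θ) · 2ξ.
  have hposi : ∀ m, Q m ≠ 0 → 0 < q m + (1 - θ) * (q₂ m - q₁ m) := fun m hm => by
    have e1 := abs_le.1 (hb.prob_close m)
    have e2 := abs_le.1 (hd' m)
    have e3 := hmin m hm
    nlinarith [e1.1, e1.2, e2.1, e2.2]
  -- Add the differences between (q₂, t₂, c₂) and (q₁, t₁, c₁) to (q, t, c). Truncation at 0 keeps
  -- the cost nonnegative, and the extra ξ pays for the damping. Each value moves at most ξ + 2ξ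
  -- away from the exact one, the cost at most ξ further: this is where 4ξ ≤ κ is needed.
  refine ⟨fun m => q m + (1 - θ) * (q₂ m - q₁ m), t + (t₂ - t₁), max 0 (c + (c₂ - c₁)) + ξ,
    ⟨⟨fun m => ?_, ?_⟩, ?_, ?_, fun m => ⟨fun hm => ?_, hzero m⟩, fun m => ?_, ?_, ?_⟩, ?_⟩
  · by_cases hm : Q m = 0
    · exact (hzero m hm).ge
    · exact (hposi m hm).le
  · rw [Finset.sum_add_distrib, ← Finset.mul_sum, Finset.sum_sub_distrib, hb.distr.2,
      hb₁.distr.2, hb₂.distr.2]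
    ring
  · have e1 := abs_le.1 hb.time_close
    have e2 := abs_le.1 hb₁.time_close
    have e3 := abs_le.1 hb₂.time_close
    linarith [e1.1, e1.2, e2.1, e2.2, e3.1, e3.2]
  · positivity
  · by_contra hne
    exact (hposi m hne).ne' hm
  · have e1 := abs_le.1 (hb.prob_close m)
    have e2 := abs_le.1 (hd' m)
    rw [abs_le]
    constructor <;> nlinarith [e1.1, e1.2, e2.1, e2.2]
  · have e1 := abs_le.1 hb.time_close
    have e2 := abs_le.1 hb₁.time_close
    have e3 := abs_le.1 hb₂.time_close
    rw [abs_le]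
    constructor <;> linarith [e1.1, e1.2, e2.1, e2.2, e3.1, e3.2]
  · have e1 := abs_le.1 hb.cost_close
    have e2 := abs_le.1 hb₁.cost_close
    have e3 := abs_le.1 hb₂.cost_close
    rw [abs_le]
    rcases max_cases 0 (c + (c₂ - c₁)) with ⟨h1, h2⟩ | ⟨h1, h2⟩ <;> rw [h1] <;>
      constructor <;> linarith [e1.1, e1.2, e2.1, e2.2, e3.1, e3.2]
  · have hsum : ∑ m, (q m + (1 - θ) * (q₂ m - q₁ m)) * h m =
        ∑ m, q m * h m + ∑ m, q₂ m * h m - ∑ m, q₁ m * h m - θ * ∑ m, (q₂ m - q₁ m) * h m := by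
      rw [Finset.mul_sum, ← Finset.sum_add_distrib, ← Finset.sum_sub_distrib,
        ← Finset.sum_sub_distrib]
      exact Finset.sum_congr rfl fun m _ => by ring
    have herr : θ * ∑ m, (q₂ m - q₁ m) * h m ≤ ξ := by
      have e1 : ∑ m, (q₂ m - q₁ m) * h m ≤ 2 * ξ * H := by
        rw [hH, Finset.mul_sum]
        refine Finset.sum_le_sum fun m _ => (le_abs_self _).trans ?_
        rw [abs_mul]
        exact mul_le_mul_of_nonneg_right (hd m) (abs_nonneg _)
      calc θ * ∑ m, (q₂ m - q₁ m) * h m ≤ θ * (2 * ξ * H) := mul_le_mul_of_nonneg_left e1 hθ0.le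
        _ = (2 * θ * H) * ξ := by ring
        _ ≤ ξ := mul_le_of_le_one_left hξ.le hθH
    have hmax : c + (c₂ - c₁) ≤ max 0 (c + (c₂ - c₁)) := le_max_right _ _
    rw [hsum]
    linarith

/-- If the value at `b` does not exceed the values at distance `δ` on both sides, the derivative
vanishes somewhere in between. -/
theorem exists_hasDerivWithinAt_zero {f : ℝ → ℝ} {l u b δ : ℝ} (hδ : 0 < δ)
    (hf : DifferentiableOn ℝ f (Set.Icc l u)) (hl : l ≤ b - δ) (hu : b + δ ≤ u)
    (h1 : f b ≤ f (b - δ)) (h2 : f b ≤ f (b + δ)) :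
    ∃ x ∈ Set.Icc l u, |x - b| ≤ δ ∧ HasDerivWithinAt f 0 (Set.Icc l u) x := by
  have hsub : Set.Icc (b - δ) (b + δ) ⊆ Set.Icc l u := Set.Icc_subset_Icc hl hu
  obtain ⟨y, hy, hmin⟩ := isCompact_Icc.exists_isMinOn (Set.nonempty_Icc.2 (by linarith))
    (hf.continuousOn.mono hsub)
  -- A minimum at an endpoint of [b - δ, b + δ] is not below f b, so in that case the interior point
  -- b is a minimizer too.
  have hx : ∃ x ∈ Set.Ioo (b - δ) (b + δ), IsMinOn f (Set.Icc (b - δ) (b + δ)) x := by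
    have hb : f b ≤ f y → IsMinOn f (Set.Icc (b - δ) (b + δ)) b := fun hle z hz =>
      hle.trans (hmin hz)
    have hbm : b ∈ Set.Ioo (b - δ) (b + δ) := ⟨by linarith, by linarith⟩
    rcases eq_or_lt_of_le hy.1 with h | h
    · exact ⟨b, hbm, hb (h ▸ h1)⟩
    · rcases eq_or_lt_of_le hy.2 with h' | h'
      · exact ⟨b, hbm, hb (h' ▸ h2)⟩
      · exact ⟨y, ⟨h, h'⟩, hmin⟩
  obtain ⟨x, hxm, hxmin⟩ := hx
  refine ⟨x, hsub (Set.Ioo_subset_Icc_self hxm), abs_le.2 ⟨by linarith [hxm.1],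
    by linarith [hxm.2]⟩, ?_⟩
  have hloc : IsLocalMin f x := hxmin.isLocalMin (Icc_mem_nhds hxm.1 hxm.2)
  have hdiff : DifferentiableAt ℝ f x := hf.differentiableAt
    (mem_of_superset (Icc_mem_nhds hxm.1 hxm.2) hsub)
  have := hdiff.hasDerivAt
  rw [hloc.deriv_eq_zero] at this
  exact this.hasDerivWithinAt

/-! ### Stable strategies are optimal in a perturbed semi-MDP. -/

namespace Oracles

variable {S A : Type} [Fintype S] [Fintype A] [MeasurableSpace S] [DiscreteMeasurableSpace S]
  {O : Oracles S} {N : ParametricACTMC S A} {C : Costs S} {ε : ℚ}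

omit [Fintype A] [MeasurableSpace S] [DiscreteMeasurableSpace S] in
theorem extend_val (h : N.RegState → ℚ) (s : N.RegState) : extend h s.1 = h s := by
  unfold extend
  rw [dif_pos s.2]
  rfl

omit [Fintype A] [MeasurableSpace S] [DiscreteMeasurableSpace S] in
/-- Minimizers over all actions of a ranking function with approximated roots are candidates. -/
theorem mem_candidates_of_isMin {σ : N.Strategy (O.δ ε)} {g : ℚ} {h : N.RegState → ℚ}
    {s : N.RegState} {a : A} (ha : N.alarm s.1 = some a) (hδ : 0 < O.δ ε s.1) {f : ℝ → ℝ}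
    (hf : DifferentiableOn ℝ f (Set.Icc (N.lo a : ℝ) (N.hi a)))
    (hroots : ∀ x ∈ Set.Icc (N.lo a : ℝ) (N.hi a),
      HasDerivWithinAt f 0 (Set.Icc (N.lo a : ℝ) (N.hi a)) x →
        ∃ r ∈ O.roots s.1 (O.δ ε s.1 / 2) (O.xi N ε) g (extend h),
          |x - (r : ℝ)| ≤ (O.δ ε s.1 / 2 : ℚ))
    {b : N.Act (O.δ ε) s} (hb : ∀ b' : N.Act (O.δ ε) s, f (b.1 : ℝ) ≤ f (b'.1 : ℝ)) :
    b ∈ O.candidates N ε σ g h s a := by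
  by_contra hcon
  have hfar : ∀ r ∈ (O.roots s.1 (O.δ ε s.1 / 2) (O.xi N ε) g (extend h)) ++ [N.lo a, N.hi a],
      3 * O.δ ε s.1 / 2 < |b.1 - r| := by
    intro r hr
    by_contra hle
    exact hcon (Or.inr ⟨r, hr, not_lt.1 hle⟩)
  have hlo := hfar (N.lo a) (by simp)
  have hhi := hfar (N.hi a) (by simp)
  have hmem := ParametricACTMC.act_mem_Icc ha hδ b
  rw [abs_of_nonneg (by linarith [hmem.1])] at hlo
  rw [abs_of_nonpos (by linarith [hmem.2])] at hhi
  -- A non-candidate is farther than 3δ/2 from both ends. So it is not u_a, and it is a grid point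
  -- whose two grid neighbours are actions as well.
  rcases (ParametricACTMC.mem_actionSet_iff ha).1 b.2 with ⟨hlt, i, hi⟩ | heq
  · have hi1 : 1 ≤ i := by
      by_contra h0
      have : i = 0 := by omega
      rw [this] at hi
      simp at hi
      linarith
    have hL : b.1 - O.δ ε s.1 ∈ N.actionSet (O.δ ε) s.1 := by
      refine (ParametricACTMC.mem_actionSet_iff ha).2 (Or.inl ⟨by linarith, i - 1, ?_⟩)
      rw [Nat.cast_sub hi1, hi]
      push_cast
      ring
    have hR : b.1 + O.δ ε s.1 ∈ N.actionSet (O.δ ε) s.1 := by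
      refine (ParametricACTMC.mem_actionSet_iff ha).2 (Or.inl ⟨by linarith, i + 1, ?_⟩)
      rw [hi]
      push_cast
      ring
    have h1 := hb ⟨_, hL⟩
    have h2 := hb ⟨_, hR⟩
    simp only [Rat.cast_sub, Rat.cast_add] at h1 h2
    have hδ' : (0 : ℝ) < O.δ ε s.1 := by exact_mod_cast hδ
    have hl' : (N.lo a : ℝ) ≤ (b.1 : ℝ) - O.δ ε s.1 := by
      have : N.lo a ≤ b.1 - O.δ ε s.1 := by linarith
      exact_mod_cast this
    have hu' : (b.1 : ℝ) + O.δ ε s.1 ≤ N.hi a := by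
      have : b.1 + O.δ ε s.1 ≤ N.hi a := by linarith
      exact_mod_cast this
    obtain ⟨x, hx, hxb, hder⟩ := exists_hasDerivWithinAt_zero hδ' hf hl' hu' h1 h2
    obtain ⟨r, hr, hxr⟩ := hroots x hx hder
    -- The root is within δ of b and r is within δ/2 of the root, which explains the radius 3δ/2 of
    -- the candidates.
    have h3 : |(b.1 : ℝ) - r| ≤ 3 * O.δ ε s.1 / 2 := by
      push_cast at hxr
      have e1 := abs_le.1 hxb
      have e2 := abs_le.1 hxr
      rw [abs_le]
      constructor <;> linarith [e1.1, e1.2, e2.1, e2.2]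
    have h4 : |b.1 - r| ≤ 3 * O.δ ε s.1 / 2 := by exact_mod_cast h3
    exact absurd (hfar r (by simp [hr])) (not_lt.2 h4)
  · rw [heq] at hhi
    linarith

/-- A strategy which the policy improvement leaves unchanged is optimal in some approximation of
the discretization. -/
theorem epsOptimal_of_step_self (h1 : O.Assumption1 N C) (h3 : O.Assumption3 N C)
    (h4 : O.Assumption4 N) (hε : 0 < ε)
    {M : SemiMDP N.RegState (N.Act (O.δ ε))}
    (hM : N.IsApprox C (O.δ ε) (O.xi N ε) M) {s₀ : N.RegState} {σ : N.Strategy (O.δ ε)}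
    (hstep : O.Step N ε M s₀ σ σ) : N.EpsOptimal C ε fun a => (N.paramOf σ a : ℝ) := by
  have : Nonempty N.RegState := ⟨s₀⟩
  have hξ := xi_pos h1 h4 hε
  have h4ξ := O.xi_le_kappa N ε
  have hκ : O.xi N ε ≤ O.κ ε := by linarith
  have hξ' : (0 : ℝ) < O.xi N ε := by exact_mod_cast hξ
  have h4ξ' : 4 * (O.xi N ε : ℝ) ≤ O.κ ε := by exact_mod_cast h4ξ
  have hκ' : (O.xi N ε : ℝ) ≤ O.κ ε := by exact_mod_cast hκ
  obtain ⟨g, h, hgh, hself⟩ := hstep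
  -- Effects for M': every action is ranked at least h, and the actions of σ keep their effects, so
  -- that g and h still solve the Poisson equation of σ.
  have key : ∀ s (b : N.Act (O.δ ε) s), ∃ (q : N.RegState → ℝ) (t c : ℝ),
      IsKappaApprox (O.κ ε : ℝ) (N.effProb s (b.1 : ℝ)) (N.effTime s (b.1 : ℝ))
        (N.effCost C s (b.1 : ℝ)) q t c ∧
      (h s : ℝ) ≤ c - g * t + ∑ s', q s' * h s' ∧
      (b = σ s → q = M.Q s b ∧ t = M.t s b ∧ c = M.c s b) := by
    intro s b
    have hown : (h s : ℝ) ≤ rank M g h s b → ∃ (q : N.RegState → ℝ) (t c : ℝ),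
        IsKappaApprox (O.κ ε : ℝ) (N.effProb s (b.1 : ℝ)) (N.effTime s (b.1 : ℝ))
          (N.effCost C s (b.1 : ℝ)) q t c ∧
        (h s : ℝ) ≤ c - g * t + ∑ s', q s' * h s' ∧
        (b = σ s → q = M.Q s b ∧ t = M.t s b ∧ c = M.c s b) := fun hle =>
      ⟨_, _, _, (hM s b).mono hκ', hle, fun _ => ⟨rfl, rfl, rfl⟩⟩
    cases hs : N.alarm s.1 with
    | none =>
      refine hown (le_of_eq ?_)
      rw [ParametricACTMC.act_subsingleton hs b (σ s)]
      exact hgh.2.2.2 s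
    | some a =>
      have hset := ParametricACTMC.isSetting_of_alarm_eq_some s hs
      have hδ := (h1 ε hε).1 _ hset
      have hbest : σ s ∈ O.best N ε M σ g h s a := by
        by_contra hb
        exact hb (((hself s).2 a hs).2 hb)
      by_cases hbC : b ∈ O.candidates N ε σ g h s a
      · refine hown ?_
        rw [hgh.2.2.2 s]
        exact hbest.2 b hbC
      · obtain ⟨q, t, c, happ, hF⟩ := h3 s a hs (O.δ ε s.1 / 2) (O.xi N ε) (by linarith) hξ
        obtain ⟨hdiff, hroots⟩ := hF g (extend h)
        have hfin := N.act_finite (h1 ε hε).1 s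
        have hne := N.act_nonempty (O.δ ε) s
        -- The analytic minimizer over all actions is a candidate, so σ is known to be ranked no
        -- higher than it in M_ξ.
        obtain ⟨bm, hbm⟩ := Finite.exists_min fun b' : N.Act (O.δ ε) s =>
          rankReal q t c g (fun s' => (extend h s'.1 : ℝ)) (b'.1 : ℝ)
        have hbmC : bm ∈ O.candidates N ε σ g h s a :=
          mem_candidates_of_isMin hs hδ hdiff hroots hbm
        have hIcc : ∀ b' : N.Act (O.δ ε) s, (b'.1 : ℝ) ∈ Set.Icc (N.lo a : ℝ) (N.hi a) :=
          fun b' => by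
            have := ParametricACTMC.act_mem_Icc hs hδ b'
            exact ⟨by exact_mod_cast this.1, by exact_mod_cast this.2⟩
        have hle := hbm b
        simp only [rankReal, extend_val] at hle
        -- The analytic inequality between `bm` and `b` is carried over to the effects of M_ξ at
        -- `bm` and new effects at `b`.
        obtain ⟨q', t', c', hq', hrank⟩ := exists_approx_rank_ge hξ' h4ξ' (happ _ (hIcc b))
          (happ _ (hIcc bm)) (hM s bm) (fun s' => N.effProb_eq_zero_congr s s' _ _)
          (fun s' hs' => by
            have e1 := (h4 s a hs).2 _ (hIcc b) s'
              (lt_of_le_of_ne (N.effProb_nonneg _ _ _) (Ne.symm hs'))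
            have e2 : 3 * (O.xi N ε : ℝ) ≤ O.pmin s.1 := by
              exact_mod_cast O.xi_le_pmin N ε hset
            linarith)
          ((h1 ε hε).2.2.1 s b) (N.effCost_nonneg C s _) g (fun s' => (h s' : ℝ)) hle
        refine ⟨q', t', c', hq', ?_, fun heq => absurd (heq ▸ Or.inl rfl) hbC⟩
        refine le_trans ?_ hrank
        rw [hgh.2.2.2 s]
        exact hbest.2 bm hbmC
  choose q t c happ hrank hσ using key
  let M' : SemiMDP N.RegState (N.Act (O.δ ε)) :=
    ⟨q, t, c, fun s b => (happ s b).distr, fun s b => (happ s b).time_nonneg,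
      fun s b => (happ s b).cost_nonneg⟩
  have hM' : N.IsApprox C (O.δ ε) (O.κ ε) M' := happ
  have hpos := time_pos h1 hε le_rfl hM'
  -- In M' the strategy σ has mean-payoff g, and the ranking inequality at all actions bounds every
  -- other strategy below by g.
  refine (h1 ε hε).2.2.2 M' hM' σ fun s τ => ?_
  have e1 : M'.expMP σ s = ENNReal.ofReal g := by
    refine M'.expMP_eq_ofReal σ s (fun s => hpos s _) (h := fun s => (h s : ℝ)) fun s => ?_
    obtain ⟨f1, f2, f3⟩ := hσ s (σ s) rfl
    change (h s : ℝ) = c s (σ s) - g * t s (σ s) + ∑ s', q s (σ s) s' * h s'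
    rw [f1, f2, f3]
    exact hgh.2.2.2 s
  rw [e1]
  exact M'.ofReal_le_expMP τ s (fun s => hpos s _) (h := fun s => (h s : ℝ)) fun s => hrank s (τ s)

end Oracles

/-! ## Certificates for the termination of the loop -/

namespace Oracles

section Certificate

variable {S A : Type} [Fintype S]

/-- The rank of the parameter `d` in `s`, for a bias vector on all states. -/
def rankAt (O : Oracles S) (ξ g : ℚ) (h : S → ℚ) (s : S) (d : ℚ) : ℚ :=
  O.cost ξ s d - g * O.time ξ s d + ∑ s', O.prob ξ s d s' * h s'

/-- The parameters `p`, the gain `g` and the bias `h` satisfy the conditions under which the loop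
of the algorithm is left. -/
structure IsStable (O : Oracles S) (N : ParametricACTMC S A) (C : Costs S) (ε ξ : ℚ)
    (p : A → ℚ) (g : ℚ) (h : S → ℚ) (s₀ : S) : Prop where
  base_mem : N.alarm s₀ = none ∨ N.IsSetting s₀
  base : h s₀ = 0
  eq_zero : ∀ s, ¬ (N.alarm s = none ∨ N.IsSetting s) → h s = 0
  eval_off : ∀ s, N.alarm s = none →
    N.rate * h s + g = C.R s + N.rate * ∑ s', N.P s s' * C.I s s' + N.rate * ∑ s', N.P s s' * h s'
  mem_act : ∀ s a, N.IsSetting s → N.alarm s = some a → p a ∈ N.actionSet (O.δ ε) s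
  eval_set : ∀ s a, N.IsSetting s → N.alarm s = some a → h s = O.rankAt ξ g h s (p a)
  minimal : ∀ s a, N.IsSetting s → N.alarm s = some a → ∀ d ∈ N.actionSet (O.δ ε) s,
    (∃ r ∈ O.roots s (O.δ ε s / 2) ξ g h ++ [N.lo a, N.hi a], |d - r| ≤ 3 * O.δ ε s / 2) →
      h s ≤ O.rankAt ξ g h s d

/-- By localization the state chosen in `paramOf` is the only regenerative state with alarm a. -/
theorem paramOf_eq {N : ParametricACTMC S A} (hloc : N.Localized) {δ : S → ℚ} (σ : N.Strategy δ)
    {s : N.RegState} {a : A} (ha : N.alarm s.1 = some a) : N.paramOf σ a = (σ s).1 := by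
  have h : ∃ s : N.RegState, N.alarm s.1 = some a := ⟨s, ha⟩
  unfold ParametricACTMC.paramOf
  rw [dif_pos h]
  have := ParametricACTMC.regState_eq hloc h.choose_spec ha
  rw [this]

variable {O : Oracles S} {N : ParametricACTMC S A} {C : Costs S} {ε : ℚ}
  {M : SemiMDP N.RegState (N.Act (O.δ ε))}

theorem extend_restrict {h : S → ℚ}
    (h0 : ∀ s, ¬ (N.alarm s = none ∨ N.IsSetting s) → h s = 0) :
    extend (N := N) (fun s => h s.1) = h := by
  funext s
  unfold extend
  split_ifs with hs
  · rfl
  · exact (h0 s hs).symm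

theorem extend_eq_zero (h : N.RegState → ℚ) (s : S)
    (hs : ¬ (N.alarm s = none ∨ N.IsSetting s)) : extend h s = 0 := by
  unfold extend
  rw [dif_neg hs]

/-- Since h vanishes off the regenerative states, the sum in the rank may run over all of S;
certificates can thus use vectors on all states. -/
theorem rank_of_alarm (hD : O.Determines N C ε M) {g : ℚ} {h : S → ℚ}
    (h0 : ∀ s, ¬ (N.alarm s = none ∨ N.IsSetting s) → h s = 0) {s : N.RegState}
    (hs : N.alarm s.1 ≠ none) (b : N.Act (O.δ ε) s) :
    rank M g (fun s => h s.1) s b = (O.rankAt (O.xi N ε) g h s.1 b.1 : ℚ) := by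
  obtain ⟨e1, e2, e3⟩ := (hD s b).2 hs
  have e4 := ParametricACTMC.sum_regState (N := N)
    (fun s' => O.prob (O.xi N ε) s.1 b.1 s' * h s') fun s' hs' => by rw [h0 s' hs', mul_zero]
  rw [rank, rankAt, ← e4, e2, e3]
  simp only [e1]
  push_cast
  rfl

theorem rank_of_none (hD : O.Determines N C ε M) {g : ℚ} {h : S → ℚ} {s : N.RegState}
    (hs : N.alarm s.1 = none) (b : N.Act (O.δ ε) s) :
    rank M g (fun s => h s.1) s b = (C.R s.1 / N.rate + ∑ s', N.P s.1 s' * C.I s.1 s' -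
      g * (1 / N.rate) + ∑ s', N.P s.1 s' * h s' : ℚ) := by
  obtain ⟨e1, e2, e3⟩ := (hD s b).1 hs
  have e4 := ParametricACTMC.sum_regState (N := N) (fun s' => N.P s.1 s' * h s') fun s' hs' => by
    rw [ParametricACTMC.P_eq_zero_of_not_regState hs hs', zero_mul]
  rw [rank, ← e4, e2, e3]
  simp only [e1]
  push_cast
  rfl

/-- Multiplication by the rate removes the division, so the certificate involves only sums and
products. -/
theorem eval_off_iff {N : ParametricACTMC S A} {C : Costs S} {g : ℚ} {h : S → ℚ} {s : S} :
    N.rate * h s + g = C.R s + N.rate * ∑ s', N.P s s' * C.I s s' +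
      N.rate * ∑ s', N.P s s' * h s' ↔
    h s = C.R s / N.rate + ∑ s', N.P s s' * C.I s s' - g * (1 / N.rate) +
      ∑ s', N.P s s' * h s' := by
  have hr := N.rate_pos
  generalize ∑ s', N.P s s' * C.I s s' = x
  generalize ∑ s', N.P s s' * h s' = y
  constructor
  · intro e
    field_simp
    linarith
  · intro e
    rw [e]
    field_simp
    ring

end Certificate

variable {S A : Type} [Fintype S] [Fintype A] [MeasurableSpace S] [DiscreteMeasurableSpace S]
  {O : Oracles S} {N : ParametricACTMC S A} {C : Costs S} {ε : ℚ}
  {M : SemiMDP N.RegState (N.Act (O.δ ε))}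

omit [DiscreteMeasurableSpace S] in
-- The guessed g and h need not come from a run: by the law of large numbers, any solution of the
-- Poisson equation yields the true gain. Minimality over the candidates then makes the improvement
-- keep the strategy.
theorem IsStable.exists_step (hloc : N.Localized) (h1 : O.Assumption1 N C) (hε : 0 < ε)
    (hξ : 0 < O.xi N ε) (hD : O.Determines N C ε M) (hM : N.IsApprox C (O.δ ε) (O.xi N ε) M)
    {p : A → ℚ} {g : ℚ} {h : S → ℚ} {s₀ : S} (hst : O.IsStable N C ε (O.xi N ε) p g h s₀) :
    ∃ (σ : N.Strategy (O.δ ε)) (s₀ : N.RegState), O.Step N ε M s₀ σ σ ∧ N.paramOf σ = p := by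
  have hκ : O.xi N ε ≤ O.κ ε := by linarith [O.xi_le_kappa N ε]
  let r₀ : N.RegState := ⟨s₀, hst.base_mem⟩
  have : Nonempty N.RegState := ⟨r₀⟩
  have hex : ∀ s : N.RegState, ∃ b : N.Act (O.δ ε) s, ∀ a, N.alarm s.1 = some a → b.1 = p a := by
    intro s
    cases hs : N.alarm s.1 with
    | none => exact ⟨(N.act_nonempty (O.δ ε) s).some, by simp⟩
    | some a =>
      refine ⟨⟨p a, hst.mem_act s.1 a (ParametricACTMC.isSetting_of_alarm_eq_some s hs) hs⟩, ?_⟩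
      intro a' ha'
      obtain rfl := Option.some.inj ha'
      rfl
  choose σ hσ using hex
  have hrank : ∀ s, ((h s.1 : ℚ) : ℝ) = rank M g (fun s => h s.1) s (σ s) := by
    intro s
    cases hs : N.alarm s.1 with
    | none =>
      rw [rank_of_none hD hs, ← eval_off_iff.1 (hst.eval_off s.1 hs)]
    | some a =>
      rw [rank_of_alarm hD hst.eq_zero (by simp [hs]), hσ s a hs,
        ← hst.eval_set s.1 a (ParametricACTMC.isSetting_of_alarm_eq_some s hs) hs]
  have hpos := fun s => time_pos h1 hε hκ hM s (σ s)
  -- The sign of g is not part of the certificate; it follows from the nonnegative costs.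
  have hg : (0 : ℝ) ≤ g := gain_nonneg (Q := fun s => M.Q s (σ s)) (fun s => (M.distr s _).1)
    (fun s => (M.distr s _).2) hpos (fun s => M.c_nonneg s (σ s))
    (h := fun s : N.RegState => (h s.1 : ℝ)) hrank
  refine ⟨σ, r₀, ⟨g, fun s => h s.1, ⟨by exact_mod_cast hg, fun s => ?_, hst.base, hrank⟩,
    fun s => ⟨fun _ => rfl, fun a ha => ⟨fun _ => rfl, fun hb => ?_⟩⟩⟩, ?_⟩
  · exact M.expMP_eq_ofReal σ s hpos (h := fun s : N.RegState => (h s.1 : ℝ)) hrank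
  · refine ⟨Or.inl rfl, fun b hb => ?_⟩
    rcases hb with hb | ⟨r, hr, hbr⟩
    · rw [hb]
    · rw [← hrank s, rank_of_alarm hD hst.eq_zero (by simp [ha])]
      rw [extend_restrict hst.eq_zero] at hr
      exact_mod_cast hst.minimal s.1 a (ParametricACTMC.isSetting_of_alarm_eq_some s ha) ha b.1
        b.2 ⟨r, hr, hbr⟩
  · funext a
    obtain ⟨s, ⟨hs, hset⟩, _⟩ := hloc a
    exact (paramOf_eq hloc σ (s := ⟨s, Or.inr hset⟩) hs).trans (hσ ⟨s, Or.inr hset⟩ a hs)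

omit [Fintype A] [MeasurableSpace S] [DiscreteMeasurableSpace S] in
-- If the improvement leaves σ unchanged, σ is itself among the best candidates, so its evaluation
-- is a certificate.
theorem exists_isStable_of_step (hloc : N.Localized)
    (hD : O.Determines N C ε M) {s₀ : N.RegState} {σ : N.Strategy (O.δ ε)}
    (hstep : O.Step N ε M s₀ σ σ) :
    ∃ (g : ℚ) (h : S → ℚ), O.IsStable N C ε (O.xi N ε) (N.paramOf σ) g h s₀.1 := by
  obtain ⟨g, h, hgh, hself⟩ := hstep
  have h0 := extend_eq_zero h
  have hh : (fun s : N.RegState => extend h s.1) = h := funext fun s => extend_val h s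
  have hbest : ∀ s a, N.alarm s.1 = some a → σ s ∈ O.best N ε M σ g h s a := by
    intro s a ha
    by_contra hb
    exact hb (((hself s).2 a ha).2 hb)
  have hrank : ∀ (s : N.RegState) (b : N.Act (O.δ ε) s), N.alarm s.1 ≠ none →
      rank M g h s b = (O.rankAt (O.xi N ε) g (extend h) s.1 b.1 : ℚ) := fun s b hs => by
    rw [← rank_of_alarm hD h0 hs, hh]
  have hval : ∀ s : N.RegState, (extend h s.1 : ℝ) = rank M g h s (σ s) := fun s => by
    rw [extend_val]
    exact hgh.2.2.2 s
  refine ⟨g, extend h, s₀.2, (extend_val h s₀).trans hgh.2.2.1, h0, fun s hs => ?_,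
    fun s a hset ha => ?_, fun s a hset ha => ?_, fun s a hset ha d hd hr => ?_⟩
  · have e := hval ⟨s, Or.inl hs⟩
    have e2 := rank_of_none hD (g := g) (h := extend h) (s := ⟨s, Or.inl hs⟩) hs
      (σ ⟨s, Or.inl hs⟩)
    rw [hh] at e2
    exact eval_off_iff.2 (by exact_mod_cast e.trans e2)
  · rw [paramOf_eq hloc σ (s := ⟨s, Or.inr hset⟩) ha]
    exact (σ ⟨s, Or.inr hset⟩).2
  · have e := (hval ⟨s, Or.inr hset⟩).trans (hrank ⟨s, Or.inr hset⟩ _ (ne_of_eq_of_ne ha (by simp)))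
    rw [paramOf_eq hloc σ (s := ⟨s, Or.inr hset⟩) ha]
    exact_mod_cast e
  · have e := (hbest ⟨s, Or.inr hset⟩ a ha).2 ⟨d, hd⟩ (Or.inr hr)
    rw [← hval ⟨s, Or.inr hset⟩] at e
    exact_mod_cast e.trans_eq (hrank ⟨s, Or.inr hset⟩ ⟨d, hd⟩ (ne_of_eq_of_ne ha (by simp)))

omit [Fintype A] [MeasurableSpace S] [DiscreteMeasurableSpace S] in
/-- The loop is left eventually, since it cannot be repeated forever. -/
theorem Terminates.exists_step_self (hT : O.Terminates N ε M) (s₀ : N.RegState) :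
    ∃ σ, O.Step N ε M s₀ σ σ := by
  obtain ⟨hstep, hfin⟩ := hT s₀
  choose next hnext using hstep
  by_contra hcon
  push Not at hcon
  refine hfin ⟨fun n => next^[n] (N.strategy_nonempty (O.δ ε)).some, fun n => ?_⟩
  simp only [Function.iterate_succ_apply']
  refine ⟨hnext _, fun heq => ?_⟩
  have := hnext (next^[n] (N.strategy_nonempty (O.δ ε)).some)
  rw [heq] at this
  exact hcon _ this

end Oracles

/-! ## Tables of the data of an instance -/

theorem List.getD_ofFn_val {β : Type*} {n : ℕ} (f : Fin n → β) (b : β) (s : Fin n) :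
    (List.ofFn f).getD s.val b = f s := by
  simp [List.getD]

theorem Nat.exists_lt_and_iff_fin {n : ℕ} {p : ℕ → Prop} : (∃ j < n, p j) ↔ ∃ s : Fin n, p s :=
  ⟨fun ⟨j, hj, h⟩ => ⟨⟨j, hj⟩, h⟩, fun ⟨s, h⟩ => ⟨s, s.2, h⟩⟩

theorem Nat.forall_lt_imp_iff_fin {n : ℕ} {p : ℕ → Prop} : (∀ j < n, p j) ↔ ∀ s : Fin n, p s :=
  ⟨fun h s => h s s.2, fun h j hj => h ⟨j, hj⟩⟩

theorem ParametricACTMC.alarm_map_eq {n k : ℕ} (N : ParametricACTMC (Fin n) (Fin k)) (s : Fin n)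
    (a : Fin k) : (N.alarm s).map Fin.val = some a.val ↔ N.alarm s = some a := by
  cases N.alarm s with
  | none => simp
  | some b => simp [Fin.ext_iff]

namespace Tables

variable {ι : Type} {n k : ι → ℕ}

section Definitions

variable (N : ∀ i, ParametricACTMC (Fin (n i)) (Fin (k i))) (C : ∀ i, Costs (Fin (n i)))
  (O : ∀ i, Oracles (Fin (n i)))

/-- State and alarm types vary with the instance, so the data are read from lists at natural
indices. Default values occur only out of range, and the stopping condition uses bounded indices. -/
def alarm (i : ι) (j : ℕ) : Option ℕ :=
  (List.ofFn fun s => ((N i).alarm s).map Fin.val).getD j none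

def P (i : ι) (j l : ℕ) : ℚ :=
  ((List.ofFn fun s => List.ofFn fun s' => (N i).P s s').getD j []).getD l 0

def Pa (i : ι) (a j l : ℕ) : ℚ :=
  (((List.ofFn fun a => List.ofFn fun s => List.ofFn fun s' => (N i).Pa a s s').getD a []).getD j
    []).getD l 0

def lo (i : ι) (a : ℕ) : ℚ := (List.ofFn (N i).lo).getD a 0

def hi (i : ι) (a : ℕ) : ℚ := (List.ofFn (N i).hi).getD a 0

def R (i : ι) (j : ℕ) : ℚ := (List.ofFn (C i).R).getD j 0

def I (i : ι) (j l : ℕ) : ℚ :=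
  ((List.ofFn fun s => List.ofFn fun s' => (C i).I s s').getD j []).getD l 0

def δ (i : ι) (ε : ℚ) (j : ℕ) : ℚ := (List.ofFn ((O i).δ ε)).getD j 0

def pmin (i : ι) (j : ℕ) : ℚ := (List.ofFn (O i).pmin).getD j 0

def prob (i : ι) (ξ d : ℚ) (j l : ℕ) : ℚ :=
  ((List.ofFn fun s => List.ofFn fun s' => (O i).prob ξ s d s').getD j []).getD l 0

def time (i : ι) (ξ d : ℚ) (j : ℕ) : ℚ := (List.ofFn fun s => (O i).time ξ s d).getD j 0

def cost (i : ι) (ξ d : ℚ) (j : ℕ) : ℚ := (List.ofFn fun s => (O i).cost ξ s d).getD j 0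

def IsSetting (i : ι) (j : ℕ) : Prop :=
  ∃ a < k i, alarm N i j = some a ∧ ∃ l < n i,
    (∃ b < k i, alarm N i l = some b ∧ 0 < Pa N i b l j) ∨
      (¬ alarm N i l = some a ∧ 0 < P N i l j)

def IsReg (i : ι) (j : ℕ) : Prop := alarm N i j = none ∨ IsSetting N i j

/-- Characterizes ξ as an attained lower bound, with denominators cleared, so that the minimum
itself need not be computed. -/
def IsPrecision (i : ι) (ε ξ : ℚ) : Prop :=
  4 * ξ ≤ (O i).κ ε ∧ (∀ j < n i, IsSetting N i j → 3 * ξ ≤ pmin O i j) ∧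
    (4 * ξ = (O i).κ ε ∨ ∃ j < n i, IsSetting N i j ∧ 3 * ξ = pmin O i j)

def rankAt (i : ι) (ξ g : ℚ) (h : List ℚ) (j : ℕ) (d : ℚ) : ℚ :=
  cost O i ξ d j + (-1) * (g * time O i ξ d j) +
    ∑ l ∈ Finset.range (n i), prob O i ξ d j l * h.getD l 0

/-- `d` has distance at most `3 δ / 2` from an entry of `L`. -/
def IsNear (e d : ℚ) (L : List ℚ) : Prop :=
  ∃ m < L.length, d ≤ 3 / 2 * e + L.getD m 0 ∧ L.getD m 0 ≤ 3 / 2 * e + d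

variable (f : ι × ℕ × ℚ × ℚ × ℚ × List ℚ → List ℚ)

def rootList (i : ι) (ε ξ g : ℚ) (h : List ℚ) (j a : ℕ) : List ℚ :=
  f (i, j, 1 / 2 * δ O i ε j, ξ, g, h) ++ [lo N i a, hi N i a]

/-- The conditions for leaving the loop in the state `j` with alarm `a`. -/
def IsStableAt (i : ι) (ε : ℚ) (p : List ℚ) (g : ℚ) (h : List ℚ) (K : ℕ) (ξ : ℚ) (j a : ℕ) :
    Prop :=
  hi N i a ≤ lo N i a + K * δ O i ε j ∧
  (p.getD a 0 = hi N i a ∨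
    (p.getD a 0 < hi N i a ∧ ∃ m < K, p.getD a 0 = lo N i a + m * δ O i ε j)) ∧
  h.getD j 0 = rankAt O i ξ g h j (p.getD a 0) ∧
  (IsNear (δ O i ε j) (hi N i a) (rootList N O f i ε ξ g h j a) →
    h.getD j 0 ≤ rankAt O i ξ g h j (hi N i a)) ∧
  ∀ m < K, lo N i a + m * δ O i ε j < hi N i a →
    IsNear (δ O i ε j) (lo N i a + m * δ O i ε j) (rootList N O f i ε ξ g h j a) →
    h.getD j 0 ≤ rankAt O i ξ g h j (lo N i a + m * δ O i ε j)

/-- The conditions for leaving the loop, in terms of the tables. -/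
def IsStable (i : ι) (ε : ℚ) (p : List ℚ) (g : ℚ) (h : List ℚ) (K : ℕ) (ξ : ℚ) (s₀ : ℕ) :
    Prop :=
  p.length = k i ∧ h.length = n i ∧ s₀ < n i ∧ IsPrecision N O i ε ξ ∧
  IsReg N i s₀ ∧ h.getD s₀ 0 = 0 ∧ (∀ j < n i, ¬ IsReg N i j → h.getD j 0 = 0) ∧
  (∀ j < n i, alarm N i j = none → (N i).rate * h.getD j 0 + g = R C i j +
    (N i).rate * (∑ l ∈ Finset.range (n i), P N i j l * I C i j l) +
    (N i).rate * ∑ l ∈ Finset.range (n i), P N i j l * h.getD l 0) ∧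
  ∀ j < n i, ∀ a < k i, IsSetting N i j → alarm N i j = some a →
    IsStableAt N O f i ε p g h K ξ j a

end Definitions

/-! ### The tables express the original stopping condition. -/

section Values

variable {N : ∀ i, ParametricACTMC (Fin (n i)) (Fin (k i))} {C : ∀ i, Costs (Fin (n i))}
  {O : ∀ i, Oracles (Fin (n i))} {i : ι}

theorem alarm_val (s : Fin (n i)) : alarm N i s = ((N i).alarm s).map Fin.val :=
  List.getD_ofFn_val _ _ _

theorem alarm_eq_some (s : Fin (n i)) (a : Fin (k i)) :
    alarm N i s = some a.val ↔ (N i).alarm s = some a := by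
  rw [alarm_val, ParametricACTMC.alarm_map_eq]

theorem alarm_eq_none (s : Fin (n i)) : alarm N i s = none ↔ (N i).alarm s = none := by
  rw [alarm_val, Option.map_eq_none_iff]

theorem P_val (s s' : Fin (n i)) : P N i s s' = (N i).P s s' := by
  simp only [P, List.getD_ofFn_val]

theorem Pa_val (a : Fin (k i)) (s s' : Fin (n i)) : Pa N i a s s' = (N i).Pa a s s' := by
  simp only [Pa, List.getD_ofFn_val]

theorem I_val (s s' : Fin (n i)) : I C i s s' = (C i).I s s' := by
  simp only [I, List.getD_ofFn_val]

theorem lo_val (a : Fin (k i)) : lo N i a = (N i).lo a := List.getD_ofFn_val _ _ _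

theorem hi_val (a : Fin (k i)) : hi N i a = (N i).hi a := List.getD_ofFn_val _ _ _

theorem R_val (s : Fin (n i)) : R C i s = (C i).R s := List.getD_ofFn_val _ _ _

theorem δ_val (ε : ℚ) (s : Fin (n i)) : δ O i ε s = (O i).δ ε s := List.getD_ofFn_val _ _ _

theorem pmin_val (s : Fin (n i)) : pmin O i s = (O i).pmin s := List.getD_ofFn_val _ _ _

theorem isSetting_iff (s : Fin (n i)) : IsSetting N i s ↔ (N i).IsSetting s := by
  simp only [IsSetting, ParametricACTMC.IsSetting, Nat.exists_lt_and_iff_fin, alarm_eq_some, Pa_val,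
    P_val, ne_eq]

theorem isReg_iff (s : Fin (n i)) :
    IsReg N i s ↔ ((N i).alarm s = none ∨ (N i).IsSetting s) := by
  rw [IsReg, alarm_eq_none, isSetting_iff]

theorem rankAt_val (ξ g : ℚ) (h : Fin (n i) → ℚ) (s : Fin (n i)) (d : ℚ) :
    rankAt O i ξ g (List.ofFn h) s d = (O i).rankAt ξ g h s d := by
  simp only [rankAt, Oracles.rankAt, cost, time, prob, Finset.sum_range, List.getD_ofFn_val]
  ring

/-- A lower bound of the finite set that is attained is its minimum. -/
theorem isPrecision_iff (ε ξ : ℚ) : IsPrecision N O i ε ξ ↔ ξ = (O i).xi (N i) ε := by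
  simp only [IsPrecision, Nat.exists_lt_and_iff_fin, Nat.forall_lt_imp_iff_fin, isSetting_iff, pmin_val]
  constructor
  · rintro ⟨h1, h2, h3⟩
    refine le_antisymm ?_ ?_
    · rcases (O i).xi_mem (N i) ε with h | ⟨s, hs, h⟩
      · linarith
      · linarith [h2 s hs]
    · rcases h3 with h | ⟨s, hs, h⟩
      · linarith [(O i).xi_le_kappa (N i) ε]
      · linarith [(O i).xi_le_pmin (N i) ε hs]
  · rintro rfl
    exact ⟨(O i).xi_le_kappa (N i) ε, fun s hs => (O i).xi_le_pmin (N i) ε hs,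
      (O i).xi_mem (N i) ε⟩

theorem isNear_iff (e d : ℚ) (L : List ℚ) :
    IsNear e d L ↔ ∃ r ∈ L, |d - r| ≤ 3 * e / 2 := by
  constructor
  · rintro ⟨m, hm, h1, h2⟩
    refine ⟨L.getD m 0, ?_, abs_le.2 ⟨by linarith, by linarith⟩⟩
    rw [List.getD_eq_getElem _ _ hm]
    exact List.getElem_mem hm
  · rintro ⟨r, hr, h⟩
    obtain ⟨m, hm, rfl⟩ := List.getElem_of_mem hr
    refine ⟨m, hm, ?_⟩
    rw [List.getD_eq_getElem _ _ hm]
    obtain ⟨h1, h2⟩ := abs_le.1 h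
    constructor <;> linarith

variable {f : ι × ℕ × ℚ × ℚ × ℚ × List ℚ → List ℚ}

theorem isStableAt_iff (hf : ∀ i s e κ g h, (O i).roots s e κ g h = f (i, s.val, e, κ, g, List.ofFn h))
    {ε : ℚ} (p : Fin (k i) → ℚ) (g : ℚ) (h : Fin (n i) → ℚ) (K : ℕ) (ξ : ℚ) (s : Fin (n i))
    (a : Fin (k i)) (ha : (N i).alarm s = some a) (hδ : 0 < (O i).δ ε s) :
    IsStableAt N O f i ε (List.ofFn p) g (List.ofFn h) K ξ s a ↔
      (N i).hi a ≤ (N i).lo a + K * (O i).δ ε s ∧ p a ∈ (N i).actionSet ((O i).δ ε) s ∧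
      h s = (O i).rankAt ξ g h s (p a) ∧ ∀ d ∈ (N i).actionSet ((O i).δ ε) s,
        (∃ r ∈ (O i).roots s ((O i).δ ε s / 2) ξ g h ++ [(N i).lo a, (N i).hi a],
          |d - r| ≤ 3 * (O i).δ ε s / 2) → h s ≤ (O i).rankAt ξ g h s d := by
  have hhalf : 1 / 2 * (O i).δ ε s = (O i).δ ε s / 2 := by ring
  simp only [IsStableAt, isNear_iff, rootList, hi_val, lo_val, δ_val, rankAt_val,
    List.getD_ofFn_val, hhalf, ← hf, ParametricACTMC.mem_actionSet_iff ha]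
  refine and_congr_right fun hK => ?_
  -- The inequality u_a ≤ ℓ_a + Kδ makes K exceed every index of a grid point below u_a, so a
  -- quantifier bounded by K covers all of them.
  have hm : ∀ m : ℕ, (N i).lo a + m * (O i).δ ε s < (N i).hi a → m < K := fun m hlt => by
    have : (m : ℚ) * (O i).δ ε s < K * (O i).δ ε s := by linarith
    exact_mod_cast lt_of_mul_lt_mul_right this hδ.le
  refine and_congr ?_ (and_congr_right fun _ => ?_)
  · constructor
    · rintro (h | ⟨h, m, _, e⟩)
      exacts [Or.inr h, Or.inl ⟨h, m, e⟩]
    · rintro (⟨h, m, e⟩ | h)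
      exacts [Or.inr ⟨h, m, hm m (e ▸ h), e⟩, Or.inl h]
  · constructor
    · rintro ⟨h1, h2⟩ d (⟨hd, m, e⟩ | rfl) hr
      · subst e
        exact h2 m (hm m hd) hd hr
      · exact h1 hr
    · exact fun h => ⟨fun hr => h _ (Or.inr rfl) hr,
        fun m _ hlt hr => h _ (Or.inl ⟨hlt, m, rfl⟩) hr⟩

theorem isStable_iff (hf : ∀ i s e κ g h, (O i).roots s e κ g h = f (i, s.val, e, κ, g, List.ofFn h))
    {ε : ℚ} (hδ : ∀ s, (N i).IsSetting s → 0 < (O i).δ ε s)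
    (p : Fin (k i) → ℚ) (g : ℚ) (h : Fin (n i) → ℚ) (K : ℕ) (ξ : ℚ) (s₀ : Fin (n i)) :
    IsStable N C O f i ε (List.ofFn p) g (List.ofFn h) K ξ s₀ ↔
      ξ = (O i).xi (N i) ε ∧ (O i).IsStable (N i) (C i) ε ξ p g h s₀ ∧
      ∀ s a, (N i).IsSetting s → (N i).alarm s = some a →
        (N i).hi a ≤ (N i).lo a + K * (O i).δ ε s := by
  have hat : (∀ (s : Fin (n i)) (a : Fin (k i)), (N i).IsSetting s → (N i).alarm s = some a →
      IsStableAt N O f i ε (List.ofFn p) g (List.ofFn h) K ξ s a) ↔ _ :=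
    forall₂_congr fun s a => forall₂_congr fun hs ha =>
      isStableAt_iff hf p g h K ξ s a ha (hδ s hs)
  simp only [IsStable, isPrecision_iff, List.length_ofFn, Nat.forall_lt_imp_iff_fin, isReg_iff,
    isSetting_iff, alarm_eq_none, alarm_eq_some, R_val, P_val, I_val, Finset.sum_range,
    List.getD_ofFn_val, true_and, s₀.2, hat]
  constructor
  · rintro ⟨h1, h2, h3, h4, h5, h6⟩
    exact ⟨h1, ⟨h2, h3, h4, h5, fun s a hs ha => (h6 s a hs ha).2.1,
      fun s a hs ha => (h6 s a hs ha).2.2.1, fun s a hs ha => (h6 s a hs ha).2.2.2⟩,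
      fun s a hs ha => (h6 s a hs ha).1⟩
  · rintro ⟨h1, ⟨h2, h3, h4, h5, h6, h7, h8⟩, h9⟩
    exact ⟨h1, h2, h3, h4, h5, fun s a hs ha => ⟨h9 s a hs ha, h6 s a hs ha, h7 s a hs ha,
      h8 s a hs ha⟩⟩

end Values

end Tables

/-! ## Computability of the stopping condition -/

theorem Computable.rat_mul_const {α : Type*} [Primcodable α] {f : α → ℚ} (c : ℚ)
    (hf : Computable f) : Computable fun a => c * f a :=
  (Computable.const c).rat_mul hf

namespace Tables

variable {ι : Type} [Primcodable ι] {n k : ι → ℕ}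
  {N : ∀ i, ParametricACTMC (Fin (n i)) (Fin (k i))} {C : ∀ i, Costs (Fin (n i))}
  {O : ∀ i, Oracles (Fin (n i))} {α : Type} [Primcodable α]

section Instance

variable (hN : ComputableInstances N C)

include hN

/-- The arguments here and below are computable functions on an arbitrary coded type, so the
statements remain applicable when bounded quantifiers extend the context by pairing. -/
theorem computable_rate {u : α → ι} (hu : Computable u) : Computable fun x => (N (u x)).rate :=
  (Computable.fst.comp hN).comp hu

theorem computable_stateCount {u : α → ι} (hu : Computable u) : Computable fun x => n (u x) :=
  ((Computable.list_length.comp (Computable.fst.comp (Computable.snd.comp hN))).of_eq fun i => by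
    simp [instanceData]).comp hu

theorem computable_alarmCount {u : α → ι} (hu : Computable u) : Computable fun x => k (u x) :=
  ((Computable.list_length.comp (Computable.fst.comp (Computable.snd.comp (Computable.snd.comp
    (Computable.snd.comp (Computable.snd.comp hN)))))).of_eq fun i => by
    simp [instanceData]).comp hu

theorem computable_P {u : α → ι} {j l : α → ℕ} (hu : Computable u) (hj : Computable j)
    (hl : Computable l) : Computable fun x => P N (u x) (j x) (l x) :=
  Computable.list_getD _ (Computable.list_getD _ ((Computable.fst.comp
    (Computable.snd.comp hN)).comp hu) hj) hl

theorem computable_alarm {u : α → ι} {j : α → ℕ} (hu : Computable u) (hj : Computable j) :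
    Computable fun x => alarm N (u x) (j x) :=
  Computable.list_getD _ ((Computable.fst.comp
    (Computable.snd.comp (Computable.snd.comp hN))).comp hu) hj

theorem computable_Pa {u : α → ι} {a j l : α → ℕ} (hu : Computable u) (ha : Computable a)
    (hj : Computable j) (hl : Computable l) : Computable fun x => Pa N (u x) (a x) (j x) (l x) :=
  Computable.list_getD _ (Computable.list_getD _ (Computable.list_getD _ ((Computable.fst.comp
    (Computable.snd.comp (Computable.snd.comp (Computable.snd.comp hN)))).comp hu) ha) hj) hl

theorem computable_lo {u : α → ι} {a : α → ℕ} (hu : Computable u) (ha : Computable a) :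
    Computable fun x => lo N (u x) (a x) :=
  Computable.list_getD _ ((Computable.fst.comp (Computable.snd.comp (Computable.snd.comp
    (Computable.snd.comp (Computable.snd.comp hN))))).comp hu) ha

theorem computable_hi {u : α → ι} {a : α → ℕ} (hu : Computable u) (ha : Computable a) :
    Computable fun x => hi N (u x) (a x) :=
  Computable.list_getD _ ((Computable.fst.comp (Computable.snd.comp (Computable.snd.comp
    (Computable.snd.comp (Computable.snd.comp (Computable.snd.comp hN)))))).comp hu) ha

theorem computable_R {u : α → ι} {j : α → ℕ} (hu : Computable u) (hj : Computable j) :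
    Computable fun x => R C (u x) (j x) :=
  Computable.list_getD _ ((Computable.fst.comp (Computable.snd.comp (Computable.snd.comp
    (Computable.snd.comp (Computable.snd.comp (Computable.snd.comp (Computable.snd.comp
      hN))))))).comp hu) hj

theorem computable_I {u : α → ι} {j l : α → ℕ} (hu : Computable u) (hj : Computable j)
    (hl : Computable l) : Computable fun x => I C (u x) (j x) (l x) :=
  Computable.list_getD _ (Computable.list_getD _ ((Computable.fst.comp (Computable.snd.comp
    (Computable.snd.comp (Computable.snd.comp (Computable.snd.comp (Computable.snd.comp
      (Computable.snd.comp (Computable.snd.comp hN)))))))).comp hu) hj) hl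

theorem computablePred_isSetting {u : α → ι} {j : α → ℕ} (hu : Computable u)
    (hj : Computable j) : ComputablePred fun x => IsSetting N (u x) (j x) := by
  refine ComputablePred.exists_lt_pred ?_ (computable_alarmCount hN hu)
  have hu1 : Computable fun x : α × ℕ => u x.1 := hu.comp Computable.fst
  have hj1 : Computable fun x : α × ℕ => j x.1 := hj.comp Computable.fst
  refine (Computable.eq_pred (computable_alarm hN hu1 hj1)
    (Computable.option_some.comp Computable.snd)).and_pred ?_
  refine ComputablePred.exists_lt_pred ?_ (computable_stateCount hN hu1)
  have hu2 : Computable fun x : (α × ℕ) × ℕ => u x.1.1 := hu1.comp Computable.fst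
  have hj2 : Computable fun x : (α × ℕ) × ℕ => j x.1.1 := hj1.comp Computable.fst
  have ha2 : Computable fun x : (α × ℕ) × ℕ => x.1.2 := Computable.snd.comp Computable.fst
  have hl2 : Computable fun x : (α × ℕ) × ℕ => x.2 := Computable.snd
  refine ComputablePred.or_pred ?_ ?_
  · refine ComputablePred.exists_lt_pred ?_ (computable_alarmCount hN hu2)
    have hu3 : Computable fun x : ((α × ℕ) × ℕ) × ℕ => u x.1.1.1 := hu2.comp Computable.fst
    have hj3 : Computable fun x : ((α × ℕ) × ℕ) × ℕ => j x.1.1.1 := hj2.comp Computable.fst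
    have hl3 : Computable fun x : ((α × ℕ) × ℕ) × ℕ => x.1.2 := hl2.comp Computable.fst
    have hb3 : Computable fun x : ((α × ℕ) × ℕ) × ℕ => x.2 := Computable.snd
    exact (Computable.eq_pred (computable_alarm hN hu3 hl3)
      (Computable.option_some.comp hb3)).and_pred
        ((Computable.const 0).rat_lt (computable_Pa hN hu3 hb3 hl3 hj3))
  · exact (Computable.eq_pred (computable_alarm hN hu2 hl2)
      (Computable.option_some.comp ha2)).not.and_pred
        ((Computable.const 0).rat_lt (computable_P hN hu2 hl2 hj2))

theorem computablePred_isReg {u : α → ι} {j : α → ℕ} (hu : Computable u)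
    (hj : Computable j) : ComputablePred fun x => IsReg N (u x) (j x) :=
  (Computable.eq_pred (computable_alarm hN hu hj) (Computable.const none)).or_pred
    (computablePred_isSetting hN hu hj)

end Instance

section Oracle

variable (hO : ComputableOracles O)

include hO

theorem computable_δ {u : α → ι} {ε : α → ℚ} {j : α → ℕ} (hu : Computable u)
    (hε : Computable ε) (hj : Computable j) : Computable fun x => δ O (u x) (ε x) (j x) :=
  Computable.list_getD _ (hO.δ.comp (hu.pair hε)) hj

theorem computable_κ {u : α → ι} {ε : α → ℚ} (hu : Computable u)
    (hε : Computable ε) : Computable fun x => (O (u x)).κ (ε x) :=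
  Computable.comp (f := fun x : ι × ℚ => (O x.1).κ x.2) (g := fun x => (u x, ε x)) hO.κ
    (hu.pair hε)

theorem computable_pmin {u : α → ι} {j : α → ℕ} (hu : Computable u)
    (hj : Computable j) : Computable fun x => pmin O (u x) (j x) :=
  Computable.list_getD _ (hO.pmin.comp hu) hj

theorem computable_prob {u : α → ι} {ξ d : α → ℚ} {j l : α → ℕ} (hu : Computable u)
    (hξ : Computable ξ) (hd : Computable d) (hj : Computable j) (hl : Computable l) :
    Computable fun x => prob O (u x) (ξ x) (d x) (j x) (l x) :=
  Computable.list_getD _ (Computable.list_getD _ (hO.prob.comp (hu.pair (hξ.pair hd))) hj) hl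

theorem computable_time {u : α → ι} {ξ d : α → ℚ} {j : α → ℕ} (hu : Computable u)
    (hξ : Computable ξ) (hd : Computable d) (hj : Computable j) :
    Computable fun x => time O (u x) (ξ x) (d x) (j x) :=
  Computable.list_getD _ (hO.time.comp (hu.pair (hξ.pair hd))) hj

theorem computable_cost {u : α → ι} {ξ d : α → ℚ} {j : α → ℕ} (hu : Computable u)
    (hξ : Computable ξ) (hd : Computable d) (hj : Computable j) :
    Computable fun x => cost O (u x) (ξ x) (d x) (j x) :=
  Computable.list_getD _ (hO.cost.comp (hu.pair (hξ.pair hd))) hj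

variable (hN : ComputableInstances N C)

include hN

theorem computablePred_isPrecision {u : α → ι} {ε ξ : α → ℚ} (hu : Computable u)
    (hε : Computable ε) (hξ : Computable ξ) :
    ComputablePred fun x => IsPrecision N O (u x) (ε x) (ξ x) := by
  have hκ := computable_κ hO hu hε
  have h4 := hξ.rat_mul_const 4
  have hu1 : Computable fun x : α × ℕ => u x.1 := hu.comp Computable.fst
  have hξ1 : Computable fun x : α × ℕ => 3 * ξ x.1 := (hξ.rat_mul_const 3).comp Computable.fst
  have hj1 : Computable fun x : α × ℕ => x.2 := Computable.snd
  have hs := computablePred_isSetting hN hu1 hj1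
  have hp := computable_pmin hO hu1 hj1
  refine (h4.rat_le hκ).and_pred (ComputablePred.and_pred ?_ (ComputablePred.or_pred ?_ ?_))
  · exact ComputablePred.forall_lt_pred (hs.imp_pred (hξ1.rat_le hp)) (computable_stateCount hN hu)
  · exact Computable.eq_pred h4 hκ
  · exact ComputablePred.exists_lt_pred (hs.and_pred (Computable.eq_pred hξ1 hp))
      (computable_stateCount hN hu)

theorem computable_rankAt {u : α → ι} {ξ g d : α → ℚ} {h : α → List ℚ} {j : α → ℕ}
    (hu : Computable u) (hξ : Computable ξ) (hg : Computable g) (hh : Computable h)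
    (hj : Computable j) (hd : Computable d) :
    Computable fun x => rankAt O (u x) (ξ x) (g x) (h x) (j x) (d x) := by
  refine ((computable_cost hO hu hξ hd hj).rat_add ((hg.rat_mul
    (computable_time hO hu hξ hd hj)).rat_mul_const (-1))).rat_add ?_
  refine Computable.rat_sum_range (computable_stateCount hN hu) ?_
  have hl1 : Computable fun x : α × ℕ => x.2 := Computable.snd
  exact (computable_prob hO (hu.comp Computable.fst) (hξ.comp Computable.fst)
    (hd.comp Computable.fst) (hj.comp Computable.fst) hl1).rat_mul
      (Computable.list_getD _ (hh.comp Computable.fst) hl1)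

end Oracle

theorem computablePred_isNear {e d : α → ℚ} {L : α → List ℚ} (he : Computable e)
    (hd : Computable d) (hL : Computable L) :
    ComputablePred fun x => IsNear (e x) (d x) (L x) := by
  refine ComputablePred.exists_lt_pred ?_ (Computable.list_length.comp hL)
  have he1 : Computable fun x : α × ℕ => 3 / 2 * e x.1 :=
    (he.rat_mul_const (3 / 2)).comp Computable.fst
  have hd1 : Computable fun x : α × ℕ => d x.1 := hd.comp Computable.fst
  have hL1 : Computable fun x : α × ℕ => (L x.1).getD x.2 0 :=
    Computable.list_getD _ (hL.comp Computable.fst) Computable.snd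
  exact (hd1.rat_le (he1.rat_add hL1)).and_pred (hL1.rat_le (he1.rat_add hd1))

section Stable

variable (hN : ComputableInstances N C) (hO : ComputableOracles O)
  {f : ι × ℕ × ℚ × ℚ × ℚ × List ℚ → List ℚ} (hf : Computable f)

include hN hO hf

theorem computable_rootList {u : α → ι} {ε ξ g : α → ℚ} {h : α → List ℚ} {j a : α → ℕ}
    (hu : Computable u) (hε : Computable ε) (hξ : Computable ξ) (hg : Computable g)
    (hh : Computable h) (hj : Computable j) (ha : Computable a) :
    Computable fun x => rootList N O f (u x) (ε x) (ξ x) (g x) (h x) (j x) (a x) :=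
  Computable.list_append.comp
    (hf.comp (hu.pair (hj.pair (((computable_δ hO hu hε hj).rat_mul_const (1 / 2)).pair
      (hξ.pair (hg.pair hh))))))
    (Computable.list_cons.comp (computable_lo hN hu ha)
      (Computable.list_cons.comp (computable_hi hN hu ha) (Computable.const [])))

theorem computablePred_isStableAt {u : α → ι} {ε ξ g : α → ℚ} {p h : α → List ℚ}
    {K j a : α → ℕ} (hu : Computable u) (hε : Computable ε) (hp : Computable p)
    (hg : Computable g) (hh : Computable h) (hK : Computable K) (hξ : Computable ξ)
    (hj : Computable j) (ha : Computable a) :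
    ComputablePred fun x =>
      IsStableAt N O f (u x) (ε x) (p x) (g x) (h x) (K x) (ξ x) (j x) (a x) := by
  have hhi := computable_hi hN hu ha
  have hlo := computable_lo hN hu ha
  have hδ := computable_δ hO hu hε hj
  have hpa := Computable.list_getD 0 hp ha
  have hhj := Computable.list_getD 0 hh hj
  have hroot := computable_rootList hN hO hf hu hε hξ hg hh hj ha
  have hrank := fun {d : α → ℚ} (hd : Computable d) =>
    computable_rankAt hO hN hu hξ hg hh hj hd
  have hd1 : Computable fun x : α × ℕ =>
      lo N (u x.1) (a x.1) + x.2 * δ O (u x.1) (ε x.1) (j x.1) :=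
    (hlo.comp Computable.fst).rat_add
      ((Computable.rat_natCast Computable.snd).rat_mul (hδ.comp Computable.fst))
  have hhi1 : Computable fun x : α × ℕ => hi N (u x.1) (a x.1) := hhi.comp Computable.fst
  have hrank1 : Computable fun x : α × ℕ => rankAt O (u x.1) (ξ x.1) (g x.1) (h x.1) (j x.1)
      (lo N (u x.1) (a x.1) + x.2 * δ O (u x.1) (ε x.1) (j x.1)) :=
    computable_rankAt hO hN (hu.comp Computable.fst) (hξ.comp Computable.fst)
      (hg.comp Computable.fst) (hh.comp Computable.fst) (hj.comp Computable.fst) hd1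
  refine ComputablePred.and_pred ?_ (ComputablePred.and_pred ?_ (ComputablePred.and_pred ?_
    (ComputablePred.and_pred ?_ ?_)))
  · exact hhi.rat_le (hlo.rat_add ((Computable.rat_natCast hK).rat_mul hδ))
  · refine (Computable.eq_pred hpa hhi).or_pred ((hpa.rat_lt hhi).and_pred ?_)
    refine ComputablePred.exists_lt_pred ?_ hK
    exact Computable.eq_pred (hpa.comp Computable.fst) hd1
  · exact Computable.eq_pred hhj (hrank hpa)
  · exact (computablePred_isNear hδ hhi hroot).imp_pred (hhj.rat_le (hrank hhi))
  · refine ComputablePred.forall_lt_pred ?_ hK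
    refine (hd1.rat_lt hhi1).imp_pred (ComputablePred.imp_pred ?_ ?_)
    · exact computablePred_isNear (hδ.comp Computable.fst) hd1 (hroot.comp Computable.fst)
    · exact (hhj.comp Computable.fst).rat_le hrank1

theorem computablePred_isStable {u : α → ι} {ε ξ g : α → ℚ} {p h : α → List ℚ}
    {K s₀ : α → ℕ} (hu : Computable u) (hε : Computable ε) (hp : Computable p)
    (hg : Computable g) (hh : Computable h) (hK : Computable K) (hξ : Computable ξ)
    (hs₀ : Computable s₀) :
    ComputablePred fun x => IsStable N C O f (u x) (ε x) (p x) (g x) (h x) (K x) (ξ x) (s₀ x) := by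
  have hn := computable_stateCount hN hu
  have hk := computable_alarmCount hN hu
  have hu1 : Computable fun x : α × ℕ => u x.1 := hu.comp Computable.fst
  have hh1 : Computable fun x : α × ℕ => h x.1 := hh.comp Computable.fst
  have hj1 : Computable fun x : α × ℕ => x.2 := Computable.snd
  have hhj1 := Computable.list_getD 0 hh1 hj1
  have hu2 : Computable fun x : (α × ℕ) × ℕ => u x.1.1 := hu1.comp Computable.fst
  have hh2 : Computable fun x : (α × ℕ) × ℕ => h x.1.1 := hh1.comp Computable.fst
  have hj2 : Computable fun x : (α × ℕ) × ℕ => x.1.2 := Computable.snd.comp Computable.fst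
  have hl2 : Computable fun x : (α × ℕ) × ℕ => x.2 := Computable.snd
  have hP2 := computable_P hN hu2 hj2 hl2
  refine (Computable.eq_pred (Computable.list_length.comp hp) hk).and_pred
    ((Computable.eq_pred (Computable.list_length.comp hh) hn).and_pred
    (((Primrec.nat_lt.computablePred).comp_computable (hs₀.pair hn)).and_pred
    ((computablePred_isPrecision hO hN hu hε hξ).and_pred
    ((computablePred_isReg hN hu hs₀).and_pred
    ((Computable.eq_pred (Computable.list_getD 0 hh hs₀) (Computable.const 0)).and_pred
    (ComputablePred.and_pred ?_ (ComputablePred.and_pred ?_ ?_)))))))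
  · exact ComputablePred.forall_lt_pred ((computablePred_isReg hN hu1 hj1).not.imp_pred
      (Computable.eq_pred hhj1 (Computable.const 0))) hn
  · refine ComputablePred.forall_lt_pred ?_ hn
    have hrate := computable_rate hN hu1
    have hsum1 : Computable fun x : α × ℕ =>
        ∑ l ∈ Finset.range (n (u x.1)), P N (u x.1) x.2 l * I C (u x.1) x.2 l :=
      Computable.rat_sum_range (computable_stateCount hN hu1)
        (hP2.rat_mul (computable_I hN hu2 hj2 hl2))
    have hsum2 : Computable fun x : α × ℕ =>
        ∑ l ∈ Finset.range (n (u x.1)), P N (u x.1) x.2 l * (h x.1).getD l 0 :=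
      Computable.rat_sum_range (computable_stateCount hN hu1)
        (hP2.rat_mul (Computable.list_getD 0 hh2 hl2))
    exact (Computable.eq_pred (computable_alarm hN hu1 hj1) (Computable.const none)).imp_pred
      (Computable.eq_pred ((hrate.rat_mul hhj1).rat_add (hg.comp Computable.fst))
        (((computable_R hN hu1 hj1).rat_add (hrate.rat_mul hsum1)).rat_add
          (hrate.rat_mul hsum2)))
  · refine ComputablePred.forall_lt_pred ?_ hn
    refine ComputablePred.forall_lt_pred ?_ (hk.comp Computable.fst)
    refine (computablePred_isSetting hN hu2 hj2).imp_pred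
      ((Computable.eq_pred (computable_alarm hN hu2 hj2)
        (Computable.option_some.comp hl2)).imp_pred ?_)
    have hc := fun {β : Type} [Primcodable β] {v : α → β} (hv : Computable v) =>
      (hv.comp Computable.fst : Computable fun x : α × ℕ => v x.1).comp
        (Computable.fst : Computable (Prod.fst : (α × ℕ) × ℕ → α × ℕ))
    exact computablePred_isStableAt hN hO hf hu2 (hc hε) (hc hp) (hc hg) (hc hh) (hc hK) (hc hξ)
      hj2 hl2

end Stable

end Tables

/-! ## Synthesis by search for a stable parameter function -/

/-- A decidable relation that is total has a computable choice function. -/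
theorem ComputablePred.exists_computable_choice {α β : Type*} [Primcodable α] [Primcodable β]
    [Inhabited β] {Q : α → β → Prop} (hQ : ComputablePred fun x : α × β => Q x.1 x.2)
    (hex : ∀ a, ∃ b, Q a b) : ∃ f : α → β, Computable f ∧ ∀ a, Q a (f a) := by
  classical
  -- The search runs over codes: `T a m` says that m decodes to a value related to a.
  let T : α → ℕ → Prop := fun a m => ∃ b, Encodable.decode m = some b ∧ Q a b
  have hT : ComputablePred fun x : α × ℕ => T x.1 x.2 := by
    have hpair : Computable fun y : (α × ℕ) × β => (y.1.1, y.2) :=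
      (Computable.fst.comp Computable.fst).pair Computable.snd
    have hg : Computable₂ fun (x : α × ℕ) (b : β) => decide (Q x.1 b) :=
      (hQ.comp_computable hpair).decide
    refine Computable.computablePred (Computable.of_eq (Computable.option_casesOn
      (Computable.decode.comp Computable.snd) (Computable.const false) hg) ?_)
    rintro ⟨a, m⟩
    rw [Bool.eq_iff_iff, decide_eq_true_iff]
    change _ ↔ ∃ b, Encodable.decode m = some b ∧ Q a b
    cases hm : (Encodable.decode m : Option β) <;> simp
  have hex' : ∀ a, ∃ m, T a m := fun a => by
    obtain ⟨b, hb⟩ := hex a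
    exact ⟨Encodable.encode b, b, Encodable.encodek b, hb⟩
  refine ⟨fun a => ((Encodable.decode (Nat.find (hex' a)) : Option β)).getD default,
    Computable.option_getD (Computable.decode.comp (Computable.find (P := T) hT hex'))
      (Computable.const default), fun a => ?_⟩
  obtain ⟨b, hb, hQb⟩ := Nat.find_spec (hex' a)
  simpa [hb] using hQb

theorem List.exists_eq_ofFn {β : Type*} {n : ℕ} {l : List β} (h : l.length = n) :
    ∃ f : Fin n → β, l = List.ofFn f :=
  ⟨fun a => l.get (a.cast h.symm), by subst h; exact (List.ofFn_get l).symm⟩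

namespace ParametricACTMC

variable {S A : Type} [Fintype S] [Fintype A]

/-- Each state and alarm has its own bound, and the sum of all bounds serves for all of them. -/
theorem exists_nat_hi_le (N : ParametricACTMC S A) {δ : S → ℚ}
    (hδ : ∀ s, N.IsSetting s → 0 < δ s) : ∃ K : ℕ, ∀ s a, N.IsSetting s → N.alarm s = some a →
      N.hi a ≤ N.lo a + K * δ s := by
  have h (x : S × A) : ∃ K : ℕ, N.IsSetting x.1 → N.hi x.2 ≤ N.lo x.2 + K * δ x.1 := by
    by_cases hs : N.IsSetting x.1
    · obtain ⟨K, hK⟩ := exists_nat_ge ((N.hi x.2 - N.lo x.2) / δ x.1)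
      rw [div_le_iff₀ (hδ _ hs)] at hK
      exact ⟨K, fun _ => by linarith⟩
    · exact ⟨0, fun h => absurd h hs⟩
  choose K hK using h
  refine ⟨∑ x, K x, fun s a hs _ => (hK (s, a) hs).trans ?_⟩
  have h1 : (K (s, a) : ℚ) ≤ (∑ x, K x : ℕ) := by
    exact_mod_cast Finset.single_le_sum (f := K) (fun _ _ => Nat.zero_le _) (Finset.mem_univ (s, a))
  have h2 := mul_le_mul_of_nonneg_right h1 (hδ s hs).le
  linarith

end ParametricACTMC

theorem theorem1 {ι : Type} [Primcodable ι] (n k : ι → ℕ) (hn : ∀ i, 0 < n i)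
    (N : ∀ i, ParametricACTMC (Fin (n i)) (Fin (k i))) (C : ∀ i, Costs (Fin (n i)))
    (O : ∀ i, Oracles (Fin (n i)))
    (hconn : ∀ i, (N i).StronglyConnected) (hloc : ∀ i, (N i).Localized)
    (hN : ComputableInstances N C) (hO : ComputableOracles O)
    (h1 : ∀ i, (O i).Assumption1 (N i) (C i)) (h2 : ∀ i, (O i).Assumption2 (N i) (C i))
    (h3 : ∀ i, (O i).Assumption3 (N i) (C i)) (h4 : ∀ i, (O i).Assumption4 (N i)) :
    ∃ out : ι × ℚ → List ℚ, Computable out ∧ ∀ i (ε : ℚ), 0 < ε →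
      ∃ M : SemiMDP (N i).RegState ((N i).Act ((O i).δ ε)),
        (O i).Determines (N i) (C i) ε M ∧
        (N i).IsApprox (C i) ((O i).δ ε) ((O i).xi (N i) ε) M ∧
        (O i).Terminates (N i) ε M ∧
        (∀ s₀ σ₀ σ, (O i).Returns (N i) ε M s₀ σ₀ σ →
          (N i).EpsOptimal (C i) ε fun a => ((N i).paramOf σ a : ℝ)) ∧
        ∃ s₀ σ₀ σ, (O i).Returns (N i) ε M s₀ σ₀ σ ∧
          out (i, ε) = List.ofFn ((N i).paramOf σ) := by
  obtain ⟨f, hf, hroots⟩ := hO.roots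
  -- Certificates are required only for ε > 0, which makes the relation total; for other ε any value
  -- is allowed.
  let Q : ι × ℚ → List ℚ × ℚ × List ℚ × ℕ × ℚ × ℕ → Prop := fun x c => 0 < x.2 →
    Tables.IsStable N C O f x.1 x.2 c.1 c.2.1 c.2.2.1 c.2.2.2.1 c.2.2.2.2.1 c.2.2.2.2.2
  have hQ : ComputablePred fun x : (ι × ℚ) × List ℚ × ℚ × List ℚ × ℕ × ℚ × ℕ => Q x.1 x.2 := by
    have hi := Computable.fst.comp (Computable.fst (α := ι × ℚ)
      (β := List ℚ × ℚ × List ℚ × ℕ × ℚ × ℕ))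
    have hε := Computable.snd.comp (Computable.fst (α := ι × ℚ)
      (β := List ℚ × ℚ × List ℚ × ℕ × ℚ × ℕ))
    have c0 := Computable.snd (α := ι × ℚ) (β := List ℚ × ℚ × List ℚ × ℕ × ℚ × ℕ)
    have c1 := Computable.snd.comp c0
    have c2 := Computable.snd.comp c1
    have c3 := Computable.snd.comp c2
    have c4 := Computable.snd.comp c3
    exact ((Computable.const 0).rat_lt hε).imp_pred (Tables.computablePred_isStable hN hO hf hi hε
      (Computable.fst.comp c0) (Computable.fst.comp c1) (Computable.fst.comp c2)
      (Computable.fst.comp c3) (Computable.fst.comp c4) (Computable.snd.comp c4))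
  -- Termination yields a strategy that an iteration reproduces, and with it a certificate for the
  -- search.
  have hex : ∀ x, ∃ c, Q x c := by
    rintro ⟨i, ε⟩
    by_cases hε : 0 < ε
    · obtain ⟨M, hD, hM⟩ := Oracles.exists_determines (h1 i) (h2 i) (h4 i) hε
      have hξ := Oracles.xi_pos (h1 i) (h4 i) hε
      have : Nonempty (Fin (n i)) := ⟨⟨0, hn i⟩⟩
      have s₀ : (N i).RegState := (ParametricACTMC.regState_nonempty (N i) (hloc i)).some
      obtain ⟨σ, hσ⟩ := (Oracles.terminates (hconn i) (hloc i) (h1 i) hε hξ hD hM).exists_step_self s₀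
      obtain ⟨g, h, hst⟩ := Oracles.exists_isStable_of_step (hloc i) hD hσ
      obtain ⟨K, hK⟩ := (N i).exists_nat_hi_le (h1 i ε hε).1
      exact ⟨(List.ofFn ((N i).paramOf σ), g, List.ofFn h, K, (O i).xi (N i) ε, s₀.1), fun _ =>
        (Tables.isStable_iff hroots (h1 i ε hε).1 _ _ _ _ _ _).2 ⟨rfl, hst, hK⟩⟩
    · exact ⟨default, fun h => absurd h hε⟩
  obtain ⟨c, hc, hcQ⟩ := hQ.exists_computable_choice hex
  refine ⟨fun x => (c x).1, Computable.fst.comp hc, fun i ε hε => ?_⟩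
  obtain ⟨M, hD, hM⟩ := Oracles.exists_determines (h1 i) (h2 i) (h4 i) hε
  have hξ := Oracles.xi_pos (h1 i) (h4 i) hε
  refine ⟨M, hD, hM, Oracles.terminates (hconn i) (hloc i) (h1 i) hε hξ hD hM,
    fun s₀ σ₀ σ hσ => Oracles.epsOptimal_of_step_self (h1 i) (h3 i) (h4 i) hε hM hσ.2, ?_⟩
  have hst := hcQ (i, ε) hε
  -- The certificate fixes the lengths of its lists, so they are tables of functions on the alarms
  -- and the states.
  obtain ⟨p, hp⟩ := List.exists_eq_ofFn hst.1
  obtain ⟨h, hh⟩ := List.exists_eq_ofFn hst.2.1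
  have hs := hst.2.2.1
  rw [hp, hh] at hst
  obtain ⟨hx, hst, -⟩ := (Tables.isStable_iff hroots (h1 i ε hε).1 p _ h _ _ ⟨_, hs⟩).1 hst
  rw [hx] at hst
  obtain ⟨σ, s₀, hσ, hpσ⟩ := hst.exists_step (hloc i) (h1 i) hε hξ hD hM
  -- With σ itself as the initial strategy, the algorithm leaves the loop after one iteration.
  exact ⟨s₀, σ, σ, ⟨Relation.ReflTransGen.refl, hσ⟩, by rw [hpσ]; exact hp⟩
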